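/- Lemma 2.4 (coercivity of $E_h$). Setting. Let $\Omega\subset\mathbb R^2$ be a bounded Lipschitz domain (open and connected) and $\partial_D\Omega\subset\partial\Omega$ a non-empty relatively open subset. Let $k\ge 2$ and let $\widehat T$ be the closed unit triangle with $\mathbb V=\mathbb P_k$, or the closed unit square with $\mathbb V=\mathbb Q_k$. A mesh $\mathcal T_h$ of $\Omega$ is a finite set of closed elements $T=F_T(\widehat T)$ with pairwise disjoint interiors and union $\overline\Omega$, where $F_T\in[\mathbb V]^2$ is injective on $\widehat T$; hanging nodes are allowed. It is shape regular with constant $\sigma$ if $\|DF_T\|\le\sigma h_T$ and $\|(DF_T)^{-1}\|\le\sigma h_T^{-1}$ on $\widehat T$, with $h_T=\operatorname{diam}T$. A positive measurable function $h$ is a mesh density function with constant $\kappa$ if $\kappa^{-1}h_T\le h\le\kappa h_T$ on every $T\in\mathcal T_h$. Let $$\mathbb V_h^k=\{v_h\in L^2(\Omega): v_h\circ F_T\in\mathbb V\ \ \forall T\in\mathcal T_h\},$$ and let $\nabla_h,D_h^2,\Delta_h$ be the elementwise operators. Let $\Gamma_h^0$ be the union of the interelement boundaries inside $\Omega$, $\Gamma_h^b=\partial_D\Omega$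 (up to vertices, the union of the boundary edges in $\partial_D\Omega$), and $\Gamma_h=\Gamma_h^0\cup\Gamma_h^b$. Data: $g\in[H^1(\Omega)]^3$, $\Phi\in[H^1(\Omega)]^{3\times2}$, $f\in[L^2(\Omega)]^3$. On $\Gamma_h^0$ let $\mu$ be a unit normal, pointing from $T^-$ to $T^+$, and on $\Gamma_h^b$ let $\mu$ be the outward unit normal. For $y_h\in[\mathbb V_h^k]^3$ put $[y_h]=y_h^--y_h^+$, $[\nabla_hy_h]=\nabla_hy_h^--\nabla_hy_h^+$ on $\Gamma_h^0$. Averages $\{\cdot\}$ are arithmetic means of the two sides on $\Gamma_h^0$ and the one-sided value on $\Gamma_h^b$. Writing $y_h\in\mathbb V_h^k(g,\Phi)$ means that $y_h\in[\mathbb V_h^k]^3$ and that on $\Gamma_h^b$ the jumps are $[y_h]=y_h-g$, $[\nabla_hy_h]=\nabla_hy_h-\Phi$ (in the sense of traces). For $\gamma_0,\gamma_1>0$ let $$\begin{aligned}a_h(y_h,y_h)=\;&\|D_h^2y_h\|_{L^2(\Omega)}^2-2\big(\{\partial_\mu\nabla_hy_h\},[\nabla_hy_h]\big)_{L^2(\Gamma_h)}+2\big(\{\partial_\mu\Delta_hy_h\},[y_h]\big)_{L^2(\Gamma_h)}\\&+\gamma_1\|h^{-1/2}[\nabla_hy_h]\|_{L^2(\Gamma_h)}^2+\gamma_0\|h^{-3/2}[y_h]\|_{L^2(\Gamma_h)}^2,\end{aligned}$$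 $$E_h[y_h]=\tfrac12a_h(y_h,y_h)-(f,y_h)_{L^2(\Omega)},$$ $$\|y_h\|_{H_h^2(\Omega)}^2=\|D_h^2y_h\|_{L^2(\Omega)}^2+\|h^{-1/2}[\nabla_hy_h]\|_{L^2(\Gamma_h)}^2+\|h^{-3/2}[y_h]\|_{L^2(\Gamma_h)}^2,$$ $$R(g,\Phi,f)=\|g\|_{H^1(\Omega)}^2+\|\Phi\|_{H^1(\Omega)}^2+\|f\|_{L^2(\Omega)}^2 .$$ Claim. There are constants $\gamma>0$ and $c>0$, depending only on $\widehat T,k,\sigma,\kappa$, and for each pair $(\Omega,\partial_D\Omega)$ there is a constant $C_F^*>0$, depending only on $\Omega,\partial_D\Omega,\widehat T,k,\sigma,\kappa$, such that for all $\gamma_0,\gamma_1\ge\gamma$, all meshes $\mathcal T_h$ of $\Omega$ that are shape regular with constant $\sigma$, all mesh density functions $h$ with constant $\kappa$, and all data $(g,\Phi,f)$ as above, $$\|y_h\|_{H_h^2(\Omega)}^2\le c\,\big(E_h[y_h]+C_F^*\,R(g,\Phi,f)\big)\qquad\forall\,y_h\in\mathbb V_h^k(g,\Phi).$$ -/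

import Mathlib

open MeasureTheory Filter Topology
open scoped ContDiff

noncomputable section

namespace DGPlate

/-- The Euclidean plane. -/
abbrev E2 : Type := EuclideanSpace ℝ (Fin 2)

/-! ### Domains, weak gradients, traces -/

/-- Bounded Lipschitz domain of the plane: open, connected, bounded, and near each boundary point,
in suitable orthonormal coordinates, the strict epigraph of a Lipschitz function. -/
structure IsLipschitzDomain (Ω : Set E2) : Prop where
  isOpen : IsOpen Ω
  isConnected : IsConnected Ω
  isBounded : Bornology.IsBounded Ω
  graph : ∀ x ∈ frontier Ω, ∃ (L : E2 ≃ₗᵢ[ℝ] E2) (r : ℝ) (K : NNReal) (φ : ℝ → ℝ),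
    0 < r ∧ LipschitzWith K φ ∧ ∀ z ∈ Metric.ball x r, (z ∈ Ω ↔ φ (L z 0) < L z 1)

/-- `Γ` is a non-empty, relatively open part of the boundary of `Ω`. -/
def IsDirichletPart (Ω Γ : Set E2) : Prop :=
  Γ.Nonempty ∧ ∃ U : Set E2, IsOpen U ∧ Γ = U ∩ frontier Ω

/-- `a`-th partial derivative relative to the set `T`. On the closed elements `T` used below this
is the usual partial derivative in the interior, extended continuously to the boundary. -/
def pd (T : Set E2) (a : Fin 2) (u : E2 → ℝ) : E2 → ℝ :=
  fun x => fderivWithin ℝ u T x (EuclideanSpace.single a 1)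

/-- `u ∈ H¹(Ω)` with weak gradient `Du = (Du 0, Du 1)`. -/
structure IsH1 (Ω : Set E2) (u : E2 → ℝ) (Du : Fin 2 → E2 → ℝ) : Prop where
  memLp : MemLp u 2 (volume.restrict Ω)
  memLp_grad : ∀ a, MemLp (Du a) 2 (volume.restrict Ω)
  weak : ∀ φ : E2 → ℝ, ContDiff ℝ ∞ φ → HasCompactSupport φ → tsupport φ ⊆ Ω →
    ∀ a, ∫ x in Ω, u x * pd Set.univ a φ x = - ∫ x in Ω, Du a x * φ x

/-- `‖u‖²` in `H¹(Ω)`, for `u` with weak gradient `Du`. -/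
def h1NormSq (Ω : Set E2) (u : E2 → ℝ) (Du : Fin 2 → E2 → ℝ) : ℝ :=
  (∫ x in Ω, u x ^ 2) + ∑ a, ∫ x in Ω, Du a x ^ 2

/-- `t ∈ L²(Γ)` is the trace on `Γ ⊆ ∂Ω` of the function `u ∈ H¹(Ω)` with weak gradient `Du`:
there are functions, smooth on the whole plane, that converge to `u` in `H¹(Ω)` and whose
restrictions to `Γ` converge to `t` in `L²(Γ)` (with respect to arc length). -/
def IsTrace (Ω Γ : Set E2) (u : E2 → ℝ) (Du : Fin 2 → E2 → ℝ) (t : E2 → ℝ) : Prop :=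
  MemLp t 2 (μH[1].restrict Γ) ∧
  ∃ φ : ℕ → E2 → ℝ, (∀ m, ContDiff ℝ ∞ (φ m)) ∧
    Tendsto (fun m => eLpNorm (fun x => φ m x - u x) 2 (volume.restrict Ω)) atTop (𝓝 0) ∧
    (∀ a, Tendsto (fun m => eLpNorm (fun x => pd Set.univ a (φ m) x - Du a x) 2
      (volume.restrict Ω)) atTop (𝓝 0)) ∧
    Tendsto (fun m => eLpNorm (fun x => φ m x - t x) 2 (μH[1].restrict Γ)) atTop (𝓝 0)

/-! ### Isoparametric meshes -/

/-- The two kinds of reference element. -/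
inductive RefShape
  | triangle
  | square

/-- The closed reference element: unit triangle or unit square. -/
def refElement : RefShape → Set E2
  | .triangle => {x | 0 ≤ x 0 ∧ 0 ≤ x 1 ∧ x 0 + x 1 ≤ 1}
  | .square => {x | 0 ≤ x 0 ∧ x 0 ≤ 1 ∧ 0 ≤ x 1 ∧ x 1 ≤ 1}

/-- Polynomials on the reference element: `ℙ_k` (total degree at most `k`) on the triangle, `ℚ_k`
(degree at most `k` in each variable) on the square. -/
def refPoly (k : ℕ) : RefShape → Submodule ℝ (MvPolynomial (Fin 2) ℝ)
  | .triangle => MvPolynomial.restrictTotalDegree (Fin 2) ℝ k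
  | .square => MvPolynomial.restrictDegree (Fin 2) ℝ k

/-- The map of the plane with the given two polynomial components. -/
def polyMap (P : Fin 2 → MvPolynomial (Fin 2) ℝ) (x : E2) : E2 :=
  WithLp.toLp 2 fun a => MvPolynomial.eval (fun b => x b) (P a)

/-- An isoparametric mesh of `Ω` (hanging nodes allowed): finitely many closed elements
`T i = F i (T̂)`, where the maps `F i`, with components in `ℙ_k` (resp. `ℚ_k`), are injective on the
reference element `T̂`. The elements have disjoint interiors and represent `Ω` exactly. -/
structure Mesh (s : RefShape) (k : ℕ) (Ω : Set E2) where
  /-- number of elements -/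
  N : ℕ
  /-- components of the element maps -/
  P : Fin N → Fin 2 → MvPolynomial (Fin 2) ℝ
  P_mem : ∀ i a, P i a ∈ refPoly k s
  injOn : ∀ i, Set.InjOn (polyMap (P i)) (refElement s)
  disjoint_interior : ∀ i j, i ≠ j →
    Disjoint (interior (polyMap (P i) '' refElement s)) (interior (polyMap (P j) '' refElement s))
  cover : ⋃ i, polyMap (P i) '' refElement s = closure Ω

variable {s : RefShape} {k : ℕ} {Ω : Set E2}

/-- The element map `F i`. -/
def Mesh.F (M : Mesh s k Ω) (i : Fin M.N) : E2 → E2 := polyMap (M.P i)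

/-- The closed element `T i`. -/
def Mesh.T (M : Mesh s k Ω) (i : Fin M.N) : Set E2 := M.F i '' refElement s

/-- The element size `h_T`. -/
def Mesh.size (M : Mesh s k Ω) (i : Fin M.N) : ℝ := Metric.diam (M.T i)

/-- Shape regularity with constant `σ`: on the reference element `‖DF‖ ≤ σ h_T` and
`‖(DF)⁻¹‖ ≤ σ / h_T`. -/
def Mesh.IsShapeRegular (M : Mesh s k Ω) (σ : ℝ) : Prop :=
  ∀ i, ∀ x ∈ refElement s, ∀ v : E2,
    ‖fderiv ℝ (M.F i) x v‖ ≤ σ * M.size i * ‖v‖ ∧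
    M.size i * ‖v‖ ≤ σ * ‖fderiv ℝ (M.F i) x v‖

/-- `h` is a mesh density function: measurable, positive and equivalent, with constant `κ`, to the
size of each element on that element. -/
def Mesh.IsDensity (M : Mesh s k Ω) (κ : ℝ) (h : E2 → ℝ) : Prop :=
  Measurable h ∧ ∀ i, ∀ x ∈ M.T i, 0 < h x ∧ M.size i ≤ κ * h x ∧ h x ≤ κ * M.size i

/-! ### Skeleton, jumps, averages -/

/-- `n` is the outward unit normal to `T` at `x`: seen from `x`, the set `T` is to first order the
half plane `⟪·, n⟫ ≤ 0`. There is at most one such `n`. -/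
def IsOuterNormal (T : Set E2) (x n : E2) : Prop :=
  ‖n‖ = 1 ∧ ∀ v : E2,
    (inner ℝ v n < 0 → ∀ᶠ r : ℝ in 𝓝[>] 0, x + r • v ∈ T) ∧
    (0 < inner ℝ v n → ∀ᶠ r : ℝ in 𝓝[>] 0, x + r • v ∉ T)

open Classical in
/-- The outward unit normal to `T` at `x` (zero where there is none, such as at vertices). -/
def outerNormal (T : Set E2) (x : E2) : E2 :=
  if hn : ∃ n, IsOuterNormal T x n then hn.choose else 0

/-- The pieces of the active skeleton. For `i < j`, `edge Γ i (some j)` is the interface in `Ω`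
between `T⁻ = T i` and `T⁺ = T j`, so that each interface occurs once;
`edge Γ i none` is the part of the Dirichlet boundary `Γ` that belongs to `T⁻ = T i`. -/
def Mesh.edge (M : Mesh s k Ω) (Γ : Set E2) (i : Fin M.N) : Option (Fin M.N) → Set E2
  | some j => if i < j then M.T i ∩ M.T j ∩ Ω else ∅
  | none => M.T i ∩ Γ

/-- Integral over the full skeleton `Γ_h = Γ_h⁰ ∪ Γ_h^b` with respect to arc length. -/
def Mesh.skeletonIntegral (M : Mesh s k Ω) (Γ : Set E2)
    (G : Fin M.N → Option (Fin M.N) → E2 → ℝ) : ℝ :=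
  ∑ i, ∑ o, ∫ x in M.edge Γ i o, G i o x ∂μH[1]

/-- Integral over `Ω` of an elementwise defined function. -/
def Mesh.brokenIntegral (M : Mesh s k Ω) (G : Fin M.N → E2 → ℝ) : ℝ :=
  ∑ i, ∫ x in Ω ∩ M.T i, G i x

/-- An elementwise defined map into `ℝ³` (`val i n` is the `n`-th component on the element `T i`;
its values off `T i` never matter), together with the boundary data `bdVal`, `bdGrad`
that enter its boundary jumps. -/
structure DGField (M : Mesh s k Ω) where
  val : Fin M.N → Fin 3 → E2 → ℝ
  bdVal : Fin 3 → E2 → ℝ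
  bdGrad : Fin 3 → Fin 2 → E2 → ℝ

namespace DGField

variable {M : Mesh s k Ω}

/-- The pieces of `y` form an element of `[𝕍_h^k]³`: `y ∘ F_T` belongs to `ℙ_k` (resp. `ℚ_k`)
on the reference element, for each element and each component. -/
def IsDG (y : DGField M) : Prop :=
  ∀ i n, ∃ p ∈ refPoly k s, ∀ x ∈ refElement s,
    y.val i n (M.F i x) = MvPolynomial.eval (fun b => x b) p

/-- First derivative `∂_a y_n` on `T i`. -/
def d1 (y : DGField M) (n : Fin 3) (a : Fin 2) (i : Fin M.N) : E2 → ℝ :=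
  pd (M.T i) a (y.val i n)

/-- Second derivative `∂_b ∂_a y_n` on `T i`. -/
def d2 (y : DGField M) (n : Fin 3) (a b : Fin 2) (i : Fin M.N) : E2 → ℝ :=
  pd (M.T i) b (y.d1 n a i)

/-- Third derivative `∂_c ∂_b ∂_a y_n` on `T i`. -/
def d3 (y : DGField M) (n : Fin 3) (a b c : Fin 2) (i : Fin M.N) : E2 → ℝ :=
  pd (M.T i) c (y.d2 n a b i)

/-- Jump `[y_n]`: `y⁻ - y⁺` on an interface, `y - g` on the Dirichlet boundary. -/
def jump (y : DGField M) (n : Fin 3) (i : Fin M.N) : Option (Fin M.N) → E2 → ℝ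
  | some j => fun x => y.val i n x - y.val j n x
  | none => fun x => y.val i n x - y.bdVal n x

/-- Jump `[∂_a y_n]`: `∂_a y⁻ - ∂_a y⁺` on an interface, `∂_a y - Φ_a` on the Dirichlet
boundary. -/
def jumpGrad (y : DGField M) (n : Fin 3) (a : Fin 2) (i : Fin M.N) : Option (Fin M.N) → E2 → ℝ
  | some j => fun x => y.d1 n a i x - y.d1 n a j x
  | none => fun x => y.d1 n a i x - y.bdGrad n a x

end DGField

/-- Average of an elementwise defined function. -/
def Mesh.avg (M : Mesh s k Ω) (w : Fin M.N → E2 → ℝ) (i : Fin M.N) :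
    Option (Fin M.N) → E2 → ℝ
  | some j => fun x => (w i x + w j x) / 2
  | none => w i

namespace DGField

variable {M : Mesh s k Ω}

/-- `{∂_μ ∂_a y_n}`, with `μ` the unit normal pointing out of `T⁻ = T i`. -/
def avgNormalGrad (y : DGField M) (n : Fin 3) (a : Fin 2) (i : Fin M.N) (o : Option (Fin M.N))
    (x : E2) : ℝ :=
  ∑ b, outerNormal (M.T i) x b * M.avg (fun l => y.d2 n a b l) i o x

/-- `{∂_μ Δ y_n}`, with `μ` the unit normal pointing out of `T⁻ = T i`. -/
def avgNormalLap (y : DGField M) (n : Fin 3) (i : Fin M.N) (o : Option (Fin M.N))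
    (x : E2) : ℝ :=
  ∑ b, outerNormal (M.T i) x b * M.avg (fun l z => ∑ a, y.d3 n a a b l z) i o x

end DGField

/-! ### The discrete energy -/

variable (M : Mesh s k Ω) (Γ : Set E2) (h : E2 → ℝ)

/-- `(D_h² w, D_h² v)` in `L²(Ω)`. -/
def hessInner (w v : DGField M) : ℝ :=
  M.brokenIntegral fun i x => ∑ n, ∑ a, ∑ b, w.d2 n a b i x * v.d2 n a b i x

/-- `({∂_μ ∇_h w}, [∇_h v])` in `L²(Γ_h)`. -/
def consGrad (w v : DGField M) : ℝ :=
  M.skeletonIntegral Γ fun i o x => ∑ n, ∑ a, w.avgNormalGrad n a i o x * v.jumpGrad n a i o x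

/-- `({∂_μ Δ_h w}, [v])` in `L²(Γ_h)`. -/
def consLap (w v : DGField M) : ℝ :=
  M.skeletonIntegral Γ fun i o x => ∑ n, w.avgNormalLap n i o x * v.jump n i o x

/-- `(h⁻¹ [∇_h w], [∇_h v])` in `L²(Γ_h)`. -/
def penGrad (w v : DGField M) : ℝ :=
  M.skeletonIntegral Γ fun i o x =>
    (h x)⁻¹ * ∑ n, ∑ a, w.jumpGrad n a i o x * v.jumpGrad n a i o x

/-- `(h⁻³ [w], [v])` in `L²(Γ_h)`. -/
def penVal (w v : DGField M) : ℝ :=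
  M.skeletonIntegral Γ fun i o x =>
    (h x ^ 3)⁻¹ * ∑ n, w.jump n i o x * v.jump n i o x

/-- The symmetric interior penalty form `a_h(w, v)`. -/
def aH (γ₀ γ₁ : ℝ) (w v : DGField M) : ℝ :=
  hessInner M w v - consGrad M Γ w v - consGrad M Γ v w
    + consLap M Γ w v + consLap M Γ v w
    + γ₁ * penGrad M Γ h w v + γ₀ * penVal M Γ h w v

/-- The discrete energy `E_h[y] = ½ a_h(y, y) - (f, y)`. -/
def energy (γ₀ γ₁ : ℝ) (f : Fin 3 → E2 → ℝ) (y : DGField M) : ℝ :=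
  1 / 2 * aH M Γ h γ₀ γ₁ y y - M.brokenIntegral fun i x => ∑ n, f n x * y.val i n x

/-- `‖y‖²` for the discrete `H²` norm, with boundary jumps taken relative to the boundary data
of `y`. -/
def h2NormSq (y : DGField M) : ℝ :=
  hessInner M y y + penGrad M Γ h y y + penVal M Γ h y y

/-- `y ∈ 𝕍_h^k(g, Φ)`: the pieces of `y` are in `[𝕍_h^k]³` and its boundary data are the traces of
`g` and `Φ` on the Dirichlet boundary. -/
structure IsDiscreteFn (g : Fin 3 → E2 → ℝ) (Dg : Fin 3 → Fin 2 → E2 → ℝ)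
    (Φ : Fin 3 → Fin 2 → E2 → ℝ) (DΦ : Fin 3 → Fin 2 → Fin 2 → E2 → ℝ) (y : DGField M) : Prop where
  isDG : y.IsDG
  traceVal : ∀ n, IsTrace Ω Γ (g n) (Dg n) (y.bdVal n)
  traceGrad : ∀ n a, IsTrace Ω Γ (Φ n a) (DΦ n a) (y.bdGrad n a)

/-- `R(g, Φ, f) = ‖g‖²_{H¹} + ‖Φ‖²_{H¹} + ‖f‖²_{L²}`. -/
def dataR (Ω : Set E2) (g : Fin 3 → E2 → ℝ) (Dg : Fin 3 → Fin 2 → E2 → ℝ)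
    (Φ : Fin 3 → Fin 2 → E2 → ℝ) (DΦ : Fin 3 → Fin 2 → Fin 2 → E2 → ℝ)
    (f : Fin 3 → E2 → ℝ) : ℝ :=
  (∑ n, h1NormSq Ω (g n) (Dg n)) + (∑ n, ∑ a, h1NormSq Ω (Φ n a) (DΦ n a))
    + ∑ n, ∫ x in Ω, f n x ^ 2

end DGPlate

end

open MeasureTheory DGPlate

namespace DGPlate

open scoped ENNReal NNReal

/-! ### Rotated Cartesian coordinates and lines -/

/-! The terms of the energy without a sign are the two consistency terms and the load; both are
absorbed into the broken Hessian and the penalties. Young's inequality with weight `h` or `h ^ 3`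
bounds each consistency term by a small multiple of the broken Hessian plus a large multiple of the
matching penalty (`DGField.exists_abs_cons_le`). The constant comes from trace and inverse
inequalities on single elements, so it depends only on the reference shape, `k`, `σ`, `κ`, and large
`γ₀`, `γ₁` absorb the penalties. The load requires the `L²` norm of `y` to be bounded by the
discrete norm and the data (`DGField.exists_l2_le`): a broken Poincaré inequality
(`Mesh.exists_broken_poincare`) is applied to the first derivatives and then to `y` itself, and the
boundary data are estimated by the trace theorem (`exists_integral_trace_sq_le`). Only here do `Ω`
and `Γ` affect a constant. The load is split with a weight `t` that depends on this constant, and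
`t` enters only the factor of the data, so `γ` and `c` do not see the domain.

Element estimates. On a curved element `y` is not a polynomial, but its derivatives of each order
pull back to a polynomial of bounded degree divided by a power of the Jacobian; this class (`IsRat`)
is closed under differentiation (`IsRat.pd`). Shape regularity pins the Jacobian between multiples
of the squared size, so equivalence of norms on polynomials over the reference element gives
`exists_sq_le_integral_of_isRat` and `exists_abs_pd_le_of_isRat`. For the sum over the skeleton each
element may meet only boundedly many others: the density `h` makes touching elements comparable in
size, and areas are counted (`Mesh.exists_card_neighbors_le`).

Poincaré inequality. Let `V` be the largest of the elementwise values `w ^ 2`. Along almost every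
line `V` grows at most by the integral of the elementwise gradient plus the jumps crossed; summed
over parallel lines, the jumps cost no more than their integral over the interfaces, since
projection does not increase length (`exists_sum_majorant`, `PiecewiseC1.lineVariation`). Any such
`V` has its integral over `Ω` bounded by its variation and its integral over `Γ`
(`isControlled_of_isLipschitzDomain`): lines that start on `Γ` control a ball, translation and
connectedness spread this to every interior point, the Lipschitz graphs extend it to the boundary,
and compactness makes the constant uniform. For `w ^ 2`, the gradient `2w∇w` and the jumps `(w⁻ +
w⁺)(w⁻ - w⁺)` are split by Young's inequality, and the part with `w ^ 2` is absorbed. Following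
lines from the interior back to the boundary gives the trace theorem
(`exists_lintegral_frontier_le`). -/

/-- The point with coordinates `(s, t)` in the orthonormal frame given by `L`. -/
noncomputable def pt (L : E2 ≃ₗᵢ[ℝ] E2) (s t : ℝ) : E2 := L.symm !₂[s, t]

@[simp] lemma coord_zero_pt (L : E2 ≃ₗᵢ[ℝ] E2) (s t : ℝ) : L (pt L s t) 0 = s := by simp [pt]

@[simp] lemma coord_one_pt (L : E2 ≃ₗᵢ[ℝ] E2) (s t : ℝ) : L (pt L s t) 1 = t := by simp [pt]

@[simp] lemma pt_coord (L : E2 ≃ₗᵢ[ℝ] E2) (z : E2) : pt L (L z 0) (L z 1) = z := by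
  have : !₂[L z 0, L z 1] = L z := by
    ext i; fin_cases i <;> rfl
  rw [pt, this, L.symm_apply_apply]

lemma pt_add (L : E2 ≃ₗᵢ[ℝ] E2) (s t s' t' : ℝ) :
    pt L (s + s') (t + t') = pt L s t + pt L s' t' := by
  rw [pt, pt, pt, ← map_add]
  congr 1
  ext i; fin_cases i <;> simp

lemma pt_smul (L : E2 ≃ₗᵢ[ℝ] E2) (c s t : ℝ) : pt L (c * s) (c * t) = c • pt L s t := by
  rw [pt, pt, ← map_smul]
  congr 1
  ext i; fin_cases i <;> simp

lemma pt_add_vertical (L : E2 ≃ₗᵢ[ℝ] E2) (s t τ : ℝ) : pt L s (t + τ) = pt L s t + τ • pt L 0 1 := by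
  rw [← pt_smul, ← pt_add]; simp

lemma norm_pt_zero_one (L : E2 ≃ₗᵢ[ℝ] E2) : ‖pt L 0 1‖ = 1 := by
  simp [pt, EuclideanSpace.norm_eq]

lemma continuous_pt (L : E2 ≃ₗᵢ[ℝ] E2) : Continuous fun p : ℝ × ℝ => pt L p.1 p.2 := by
  unfold pt
  fun_prop

lemma dist_pt_le (L : E2 ≃ₗᵢ[ℝ] E2) (s t s' t' : ℝ) :
    dist (pt L s t) (pt L s' t') ≤ |s - s'| + |t - t'| := by
  rw [pt, pt, LinearIsometryEquiv.dist_map, EuclideanSpace.dist_eq]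
  simp only [Real.dist_eq, sq_abs, Fin.sum_univ_two]
  rw [Real.sqrt_le_left (by positivity)]
  simp
  nlinarith [abs_nonneg (s - s'), abs_nonneg (t - t'), sq_abs (s - s'), sq_abs (t - t')]

lemma lipschitzWith_coord (L : E2 ≃ₗᵢ[ℝ] E2) (i : Fin 2) : LipschitzWith 1 fun z => L z i := by
  refine LipschitzWith.of_dist_le_mul fun x y => ?_
  rw [NNReal.coe_one, one_mul, ← L.dist_map x y, dist_eq_norm, dist_eq_norm]
  exact PiLp.norm_apply_le (L x - L y) i

lemma abs_coord_sub_le (L : E2 ≃ₗᵢ[ℝ] E2) (i : Fin 2) (z w : E2) : |L z i - L w i| ≤ dist z w := by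
  simpa [Real.dist_eq] using (lipschitzWith_coord L i).dist_le_mul z w

lemma measurePreserving_pt (L : E2 ≃ₗᵢ[ℝ] E2) :
    MeasurePreserving (fun p : ℝ × ℝ => pt L p.1 p.2) volume volume := by
  have h1 := ((volume_preserving_finTwoArrow ℝ).symm)
  have h := (L.symm.measurePreserving).comp
    ((PiLp.volume_preserving_toLp (Fin 2)).comp h1)
  exact h

lemma lintegral_pt (L : E2 ≃ₗᵢ[ℝ] E2) {f : E2 → ℝ≥0∞} (hf : Measurable f) :
    ∫⁻ z, f z = ∫⁻ s, ∫⁻ t, f (pt L s t) := by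
  rw [← (measurePreserving_pt L).lintegral_comp hf, Measure.volume_eq_prod]
  exact lintegral_prod _ (hf.comp (measurePreserving_pt L).measurable).aemeasurable

lemma volume_coord_image_le (L : E2 ≃ₗᵢ[ℝ] E2) (A : Set E2) :
    volume ((fun z => L z 0) '' A) ≤ μH[1] A := by
  rw [← hausdorffMeasure_real]
  simpa using (lipschitzWith_coord L 0).hausdorffMeasure_image_le zero_le_one A

/-! ### Counting the points of a set on parallel lines -/

/-- Cut `E` into strips of height `1 / n`. The number of strips of `E` met by the line over `s` has
integral at most the sum of the lengths of the projected strips, hence at most the length of `E`.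
For large `n` distinct points lie in distinct strips, so the liminf over `n` dominates every finite
count, and Fatou's lemma keeps the integral bound. Measurable hulls of the projections make the
majorant measurable. -/
lemma exists_count_majorant (L : E2 ≃ₗᵢ[ℝ] E2) {E : Set E2} (hE : MeasurableSet E) :
    ∃ q : ℝ → ℝ≥0∞, Measurable q ∧ ∫⁻ s, q s ≤ μH[1] E ∧
      ∀ s, ∀ P : Finset ℝ, (∀ t ∈ P, pt L s t ∈ E) → (P.card : ℝ≥0∞) ≤ q s := by
  set Q : ℕ → ℤ → Set E2 := fun n k => {x ∈ E | ⌊(n : ℝ) * L x 1⌋ = k} with hQ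
  have hmeas : Measurable fun x : E2 => L x 1 := (lipschitzWith_coord L 1).continuous.measurable
  have hQm : ∀ n k, MeasurableSet (Q n k) := fun n k =>
    hE.inter ((measurable_const.mul hmeas).floor (measurableSet_singleton k))
  set q : ℕ → ℝ → ℝ≥0∞ := fun n s => ∑' k : ℤ,
    (toMeasurable volume ((fun z => L z 0) '' Q n k)).indicator 1 s with hq
  have hqm : ∀ n, Measurable (q n) := fun n => Measurable.tsum fun k =>
    measurable_one.indicator (measurableSet_toMeasurable _ _)
  refine ⟨fun s => liminf (fun n => q n s) atTop, Measurable.liminf hqm, ?_, ?_⟩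
  · refine (lintegral_liminf_le hqm).trans ?_
    have : ∀ n, ∫⁻ s, q n s ≤ μH[1] E := fun n => by
      rw [lintegral_tsum fun k =>
        (measurable_one.indicator (measurableSet_toMeasurable _ _)).aemeasurable]
      calc ∑' k, ∫⁻ s, (toMeasurable volume ((fun z => L z 0) '' Q n k)).indicator 1 s
          = ∑' k, volume ((fun z => L z 0) '' Q n k) := by
            congr 1; ext k
            rw [lintegral_indicator_one (measurableSet_toMeasurable _ _), measure_toMeasurable]
        _ ≤ ∑' k, μH[1] (Q n k) := ENNReal.tsum_le_tsum fun k => volume_coord_image_le L _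
        _ = μH[1] (⋃ k, Q n k) := by
            rw [measure_iUnion _ (hQm n)]
            intro k k' hkk
            refine Set.disjoint_left.2 fun x hx hx' => hkk (hx.2.symm.trans hx'.2)
        _ ≤ μH[1] E := measure_mono (Set.iUnion_subset fun k x hx => hx.1)
    exact (liminf_le_liminf (Eventually.of_forall this)).trans (by simp)
  · intro s P hP
    refine le_liminf_of_le (by isBoundedDefault) ?_
    have hinj : ∀ᶠ n : ℕ in atTop, Set.InjOn (fun t : ℝ => ⌊(n : ℝ) * t⌋) P := by
      have : ∀ᶠ n : ℕ in atTop, ∀ t ∈ P, ∀ t' ∈ P, t ≠ t' → ⌊(n : ℝ) * t⌋ ≠ ⌊(n : ℝ) * t'⌋ := by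
        refine (Finset.eventually_all P).2 fun t _ => (Finset.eventually_all P).2 fun t' _ => ?_
        by_cases htt : t = t'
        · simp [htt]
        have hpos : 0 < |t - t'| := abs_pos.2 (sub_ne_zero.2 htt)
        filter_upwards [tendsto_natCast_atTop_atTop.eventually_ge_atTop (|t - t'|⁻¹)] with n hn _ heq
        have h1 := Int.abs_sub_lt_one_of_floor_eq_floor heq
        rw [← mul_sub, abs_mul, abs_of_nonneg (Nat.cast_nonneg n)] at h1
        have h2 := mul_le_mul_of_nonneg_right hn hpos.le
        rw [inv_mul_cancel₀ hpos.ne'] at h2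
        linarith
      filter_upwards [this] with n hn t ht t' ht' heq
      by_contra hne
      exact hn t ht t' ht' hne heq
    filter_upwards [hinj] with n hn
    calc (P.card : ℝ≥0∞) = ((P.image fun t : ℝ => ⌊(n : ℝ) * t⌋).card : ℝ≥0∞) := by
          rw [Finset.card_image_of_injOn hn]
      _ = ∑ k ∈ P.image fun t : ℝ => ⌊(n : ℝ) * t⌋, (1 : ℝ≥0∞) := by simp
      _ ≤ ∑ k ∈ P.image fun t : ℝ => ⌊(n : ℝ) * t⌋,
            (toMeasurable volume ((fun z => L z 0) '' Q n k)).indicator 1 s := by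
          refine Finset.sum_le_sum fun k hk => ?_
          obtain ⟨t, ht, rfl⟩ := Finset.mem_image.1 hk
          rw [Set.indicator_of_mem]
          · simp
          · exact subset_toMeasurable _ _ ⟨pt L s t, ⟨hP t ht, by simp⟩, by simp⟩
      _ ≤ q n s := ENNReal.sum_le_tsum _

/-- Weighted version of the count, from indicators through sums and monotone limits. A majorant,
rather than the sum over the line itself, leaves no measurability to prove for the latter. -/
lemma exists_sum_majorant (L : E2 ≃ₗᵢ[ℝ] E2) {E : Set E2} (hE : MeasurableSet E) {f : E2 → ℝ≥0∞}
    (hf : Measurable f) :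
    ∃ q : ℝ → ℝ≥0∞, Measurable q ∧ ∫⁻ s, q s ≤ ∫⁻ x in E, f x ∂μH[1] ∧
      ∀ s, ∀ P : Finset ℝ, (∀ t ∈ P, pt L s t ∈ E) → ∑ t ∈ P, f (pt L s t) ≤ q s := by
  refine Measurable.ennreal_induction (motive := fun f => ∃ q : ℝ → ℝ≥0∞, Measurable q ∧
    ∫⁻ s, q s ≤ ∫⁻ x in E, f x ∂μH[1] ∧
      ∀ s, ∀ P : Finset ℝ, (∀ t ∈ P, pt L s t ∈ E) → ∑ t ∈ P, f (pt L s t) ≤ q s) ?_ ?_ ?_ hf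
  · intro c A hA
    obtain ⟨q, hqm, hq, hqP⟩ := exists_count_majorant L (hE.inter hA)
    refine ⟨fun s => c * q s, hqm.const_mul c, ?_, fun s P hP => ?_⟩
    · rw [lintegral_const_mul _ hqm, lintegral_indicator_const hA, Measure.restrict_apply hA,
        Set.inter_comm A]
      gcongr
    · classical
      calc ∑ t ∈ P, A.indicator (fun _ => c) (pt L s t)
          = ∑ t ∈ P with pt L s t ∈ A, c := by
            rw [Finset.sum_filter]
            exact Finset.sum_congr rfl fun t _ => by simp [Set.indicator_apply]
        _ = c * ((P.filter fun t => pt L s t ∈ A).card : ℝ≥0∞) := by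
            rw [Finset.sum_const, nsmul_eq_mul, mul_comm]
        _ ≤ c * q s := by
            gcongr
            refine hqP s _ fun t ht => ?_
            rw [Finset.mem_filter] at ht
            exact ⟨hP t ht.1, ht.2⟩
  · intro f g _ hfm hgm ihf ihg
    obtain ⟨q₁, hm₁, h₁, h₁'⟩ := ihf
    obtain ⟨q₂, hm₂, h₂, h₂'⟩ := ihg
    refine ⟨fun s => q₁ s + q₂ s, hm₁.add hm₂, ?_, fun s P hP => ?_⟩
    · rw [lintegral_add_left hm₁]
      simp only [Pi.add_apply]
      rw [lintegral_add_left hfm]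
      exact add_le_add h₁ h₂
    · simp only [Pi.add_apply, Finset.sum_add_distrib]
      exact add_le_add (h₁' s P hP) (h₂' s P hP)
  · intro f hfm hmono ih
    choose q hqm hq hqP using ih
    refine ⟨fun s => liminf (fun n => q n s) atTop, Measurable.liminf hqm, ?_, fun s P hP => ?_⟩
    · refine (lintegral_liminf_le hqm).trans ?_
      refine (liminf_le_liminf (Eventually.of_forall fun n => (hq n).trans
        (lintegral_mono fun x => le_iSup (fun n => f n x) n))).trans (by simp)
    · have h1 : Tendsto (fun n => ∑ t ∈ P, f n (pt L s t)) atTop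
          (𝓝 (∑ t ∈ P, ⨆ n, f n (pt L s t))) :=
        tendsto_finsetSum _ fun t _ => tendsto_atTop_iSup fun m n hmn => hmono hmn _
      rw [← h1.liminf_eq]
      exact liminf_le_liminf (Eventually.of_forall fun n => hqP n s P hP)

/-! ### Variation along lines of piecewise smooth functions -/

/-- Connectedness: in the open interval the cells are disjoint closed sets, so a single one contains
it. -/
lemma Ioo_subset_of_closed_cover {ι : Type*} [Finite ι] {K : ι → Set ℝ} {a b : ℝ} (hab : a < b)
    (hK : ∀ i, IsClosed (K i)) (hcover : Set.Icc a b ⊆ ⋃ i, K i)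
    (hdisj : ∀ p ∈ Set.Ioo a b, ∀ i j, p ∈ K i → p ∈ K j → i = j) :
    ∃ i, Set.Icc a b ⊆ K i := by
  have hm : (a + b) / 2 ∈ Set.Ioo a b := ⟨by linarith, by linarith⟩
  obtain ⟨i, hi⟩ := Set.mem_iUnion.1 (hcover (Set.Ioo_subset_Icc_self hm))
  refine ⟨i, ?_⟩
  have hsub : Set.Ioo a b ⊆ K i := by
    intro p hp
    by_contra hpi
    obtain ⟨j, hj⟩ := Set.mem_iUnion.1 (hcover (Set.Ioo_subset_Icc_self hp))
    have hji : j ≠ i := fun h => hpi (h ▸ hj)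
    have hclosed : IsClosed (⋃ l ∈ {l | l ≠ i}, K l) :=
      (Set.toFinite _).isClosed_biUnion fun l _ => hK l
    obtain ⟨x, hx, hxi, hx'⟩ := isPreconnected_closed_iff.1 isPreconnected_Ioo (K i)
      (⋃ l ∈ {l | l ≠ i}, K l) (hK i) hclosed (fun x hx => by
        obtain ⟨l, hl⟩ := Set.mem_iUnion.1 (hcover (Set.Ioo_subset_Icc_self hx))
        by_cases hli : l = i
        · exact Or.inl (hli ▸ hl)
        · exact Or.inr (Set.mem_biUnion (show l ∈ {l | l ≠ i} from hli) hl))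
      ⟨_, hm, hi⟩ ⟨p, hp, Set.mem_biUnion (show j ∈ {l | l ≠ i} from hji) hj⟩
    obtain ⟨l, hl, hxl⟩ := Set.mem_iUnion₂.1 hx'
    exact hl (hdisj x hx l i hxl hxi)
  rw [← closure_Ioo hab.ne]
  exact closure_minimal hsub (hK i)

/-- Induction on the number of points of `S` in the open interval. If there are none, one cell
contains the whole segment and only a change of cell at `b` can occur; otherwise the segment is cut
at such a point. Jumps are charged at interior points and at `b` but never at `a`, so concatenating
two pieces counts no jump twice. -/
lemma exists_le_add_lintegral_add_sum {ι : Type*} [Finite ι] (K : ι → Set ℝ)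
    (u : ι → ℝ → ℝ≥0∞) (W J : ℝ → ℝ≥0∞) (hK : ∀ i, IsClosed (K i)) (S : Finset ℝ) (m : ℕ) :
    ∀ a b : ℝ, a < b → (S.filter (· ∈ Set.Ioo a b)).card = m →
    (∀ i c d, a ≤ c → c < d → d ≤ b → Set.Icc c d ⊆ K i →
      u i d ≤ u i c + ∫⁻ t in Set.Ioo c d, W t) →
    (∀ p ∈ Set.Ioc a b, ∀ i j, p ∈ K i → p ∈ K j → u j p ≤ u i p + J p) →
    Set.Icc a b ⊆ ⋃ i, K i →
    (∀ p ∈ Set.Ioo a b, ∀ i j, p ∈ K i → p ∈ K j → i ≠ j → p ∈ S) →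
    ∀ j, b ∈ K j → ∃ i, a ∈ K i ∧ u j b ≤ u i a + (∫⁻ t in Set.Ioo a b, W t)
      + ∑ p ∈ insert b (S.filter (· ∈ Set.Ioo a b)), J p := by
  induction m using Nat.strong_induction_on with
  | _ m ih =>
  intro a b hab hm hFT hJ hcover hS j hj
  rcases (S.filter (· ∈ Set.Ioo a b)).eq_empty_or_nonempty with hempty | ⟨p, hp⟩
  · obtain ⟨i, hi⟩ := Ioo_subset_of_closed_cover hab hK hcover fun p hp i j hpi hpj => by
      by_contra hij
      have : p ∈ S.filter (· ∈ Set.Ioo a b) := Finset.mem_filter.2 ⟨hS p hp i j hpi hpj hij, hp⟩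
      rw [hempty] at this
      exact absurd this (Finset.notMem_empty p)
    refine ⟨i, hi (Set.left_mem_Icc.2 hab.le), ?_⟩
    rw [hempty]
    simp only [insert_empty_eq, Finset.sum_singleton]
    exact (hJ b ⟨hab, le_rfl⟩ i j (hi (Set.right_mem_Icc.2 hab.le)) hj).trans
      (add_le_add_left (hFT i a b le_rfl hab le_rfl hi) _)
  · have hpS := (Finset.mem_filter.1 hp).1
    have hpab := (Finset.mem_filter.1 hp).2
    have hlt1 : (S.filter (· ∈ Set.Ioo a p)).card < m := by
      rw [← hm]
      refine Finset.card_lt_card ⟨fun x hx => ?_, fun h => ?_⟩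
      · simp only [Finset.mem_filter, Set.mem_Ioo] at hx ⊢
        exact ⟨hx.1, hx.2.1, hx.2.2.trans hpab.2⟩
      · simpa using h hp
    have hlt2 : (S.filter (· ∈ Set.Ioo p b)).card < m := by
      rw [← hm]
      refine Finset.card_lt_card ⟨fun x hx => ?_, fun h => ?_⟩
      · simp only [Finset.mem_filter, Set.mem_Ioo] at hx ⊢
        exact ⟨hx.1, hpab.1.trans hx.2.1, hx.2.2⟩
      · simpa using h hp
    obtain ⟨i', hi', h1⟩ := ih _ hlt2 p b hpab.2 rfl
      (fun i c d hc hcd hd => hFT i c d (hpab.1.le.trans hc) hcd hd)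
      (fun x hx => hJ x ⟨hpab.1.trans hx.1, hx.2⟩)
      ((Set.Icc_subset_Icc_left hpab.1.le).trans hcover)
      (fun x hx => hS x ⟨hpab.1.trans hx.1, hx.2⟩) j hj
    obtain ⟨i, hi, h2⟩ := ih _ hlt1 a p hpab.1 rfl
      (fun i c d hc hcd hd => hFT i c d hc hcd (hd.trans hpab.2.le))
      (fun x hx => hJ x ⟨hx.1, hx.2.trans hpab.2.le⟩)
      ((Set.Icc_subset_Icc_right hpab.2.le).trans hcover)
      (fun x hx => hS x ⟨hx.1, hx.2.trans hpab.2⟩) i' hi'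
    refine ⟨i, hi, ?_⟩
    have hint : (∫⁻ t in Set.Ioo a p, W t) + (∫⁻ t in Set.Ioo p b, W t)
        ≤ ∫⁻ t in Set.Ioo a b, W t := by
      rw [← lintegral_union measurableSet_Ioo
        (Set.disjoint_left.2 fun x hx hx' => lt_asymm hx.2 hx'.1)]
      refine lintegral_mono_set ?_
      rintro x (hx | hx)
      · exact ⟨hx.1, hx.2.trans hpab.2⟩
      · exact ⟨hpab.1.trans hx.1, hx.2⟩
    have hsum : ∑ x ∈ insert p (S.filter (· ∈ Set.Ioo a p)), J x
        + ∑ x ∈ insert b (S.filter (· ∈ Set.Ioo p b)), J x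
        ≤ ∑ x ∈ insert b (S.filter (· ∈ Set.Ioo a b)), J x := by
      rw [← Finset.sum_union]
      · refine Finset.sum_le_sum_of_subset fun x hx => ?_
        simp only [Finset.mem_union, Finset.mem_insert, Finset.mem_filter, Set.mem_Ioo] at hx ⊢
        rcases hx with (rfl | hx) | (rfl | hx)
        · exact Or.inr ⟨hpS, hpab⟩
        · exact Or.inr ⟨hx.1, hx.2.1, hx.2.2.trans hpab.2⟩
        · exact Or.inl rfl
        · exact Or.inr ⟨hx.1, hpab.1.trans hx.2.1, hx.2.2⟩
      · refine Finset.disjoint_left.2 fun x hx hx' => ?_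
        simp only [Finset.mem_insert, Finset.mem_filter, Set.mem_Ioo] at hx hx'
        have h3 : x ≤ p := by rcases hx with rfl | ⟨_, _, hx⟩ <;> linarith
        have h4 : p < x := by
          rcases hx' with rfl | hx'
          · exact hpab.2
          · exact hx'.2.1
        exact absurd h3 (not_le.2 h4)
    calc u j b ≤ u i' p + (∫⁻ t in Set.Ioo p b, W t)
          + ∑ x ∈ insert b (S.filter (· ∈ Set.Ioo p b)), J x := h1
      _ ≤ (u i a + (∫⁻ t in Set.Ioo a p, W t)
          + ∑ x ∈ insert p (S.filter (· ∈ Set.Ioo a p)), J x) + (∫⁻ t in Set.Ioo p b, W t)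
          + ∑ x ∈ insert b (S.filter (· ∈ Set.Ioo p b)), J x := by gcongr
      _ = u i a + ((∫⁻ t in Set.Ioo a p, W t) + (∫⁻ t in Set.Ioo p b, W t))
          + (∑ x ∈ insert p (S.filter (· ∈ Set.Ioo a p)), J x
          + ∑ x ∈ insert b (S.filter (· ∈ Set.Ioo p b)), J x) := by ring
      _ ≤ _ := by gcongr

/-- `V` has variation at most `A` in `Ω`, in the sense that on almost every line of each direction
its increments over segments in `Ω` are bounded by a function with integral at most `A`. -/
def LineVariation (Ω : Set E2) (V : E2 → ℝ≥0∞) (A : ℝ≥0∞) : Prop :=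
  ∀ L : E2 ≃ₗᵢ[ℝ] E2, ∃ q : ℝ → ℝ≥0∞, Measurable q ∧ ∫⁻ s, q s ≤ A ∧
    ∀ᵐ s, ∀ a b, a < b → (∀ t ∈ Set.Ioc a b, pt L s t ∈ Ω) → V (pt L s b) ≤ V (pt L s a) + q s

/-- A finite cover of `Ω` by compact cells with a `C¹` function on each cell. -/
structure PiecewiseC1 {N : ℕ} (Ω : Set E2) (T : Fin N → Set E2) (v : Fin N → E2 → ℝ) : Prop where
  isCompact : ∀ i, IsCompact (T i)
  cover : Ω ⊆ ⋃ i, T i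
  uniqueDiff : ∀ i, UniqueDiffOn ℝ (T i)
  contDiffOn : ∀ i, ContDiffOn ℝ 1 (v i) (T i)
  inter : ∀ i j, i < j → μH[1] (T i ∩ T j ∩ Ω) ≠ ⊤

/-- The largest value at `x` of the functions on the cells that contain `x`. -/
noncomputable def cellSup {N : ℕ} (T : Fin N → Set E2) (v : Fin N → E2 → ℝ) (x : E2) : ℝ≥0∞ :=
  ⨆ i, (T i).indicator (fun x => ENNReal.ofReal (v i x)) x

/-- Norm of the cellwise gradient, summed over the cells. -/
noncomputable def cellGrad {N : ℕ} (T : Fin N → Set E2) (v : Fin N → E2 → ℝ) (x : E2) : ℝ≥0∞ :=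
  ∑ i, (T i).indicator (fun x => ‖fderivWithin ℝ (v i) (T i) x‖ₑ) x

/-- Total variation of a piecewise `C¹` function: gradient part and jump part. -/
noncomputable def totalVar {N : ℕ} (Ω : Set E2) (T : Fin N → Set E2) (v : Fin N → E2 → ℝ) : ℝ≥0∞ :=
  (∫⁻ x in Ω, cellGrad T v x) +
    ∑ i, ∑ j, if i < j then ∫⁻ x in T i ∩ T j ∩ Ω, ‖v i x - v j x‖ₑ ∂μH[1] else 0

lemma measurable_indicator_of_continuousOn {β : Type*} [TopologicalSpace β] [MeasurableSpace β]
    [BorelSpace β] [Zero β] {f : E2 → β} {s : Set E2} (hf : ContinuousOn f s)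
    (hs : MeasurableSet s) : Measurable (s.indicator f) := by
  classical
  rw [← Set.piecewise_eq_indicator]
  exact hf.measurable_piecewise continuousOn_const hs

namespace PiecewiseC1

variable {N : ℕ} {Ω : Set E2} {T : Fin N → Set E2} {v : Fin N → E2 → ℝ}

lemma measurable_cellSup (H : PiecewiseC1 Ω T v) : Measurable (cellSup T v) :=
  Measurable.iSup fun i => measurable_indicator_of_continuousOn
    (ENNReal.continuous_ofReal.comp_continuousOn (H.contDiffOn i).continuousOn)
    (H.isCompact i).measurableSet

lemma measurable_cellGrad (H : PiecewiseC1 Ω T v) : Measurable (cellGrad T v) :=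
  Finset.measurable_sum _ fun i _ => measurable_indicator_of_continuousOn
    (((H.contDiffOn i).continuousOn_fderivWithin (H.uniqueDiff i) le_rfl).enorm)
    (H.isCompact i).measurableSet

/-- Fundamental theorem of calculus on a segment within one cell; the direction has unit length, so
the derivative along the line is at most the norm of the gradient. -/
lemma le_add_lintegral_cellGrad (H : PiecewiseC1 Ω T v) (L : E2 ≃ₗᵢ[ℝ] E2) {s c d : ℝ} {i : Fin N}
    (hcd : c < d) (hT : ∀ t ∈ Set.Icc c d, pt L s t ∈ T i) (hΩ : ∀ t ∈ Set.Ioc c d, pt L s t ∈ Ω) :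
    ENNReal.ofReal (v i (pt L s d)) ≤ ENNReal.ofReal (v i (pt L s c))
      + ∫⁻ t in Set.Ioo c d, Ω.indicator (cellGrad T v) (pt L s t) := by
  set e := pt L 0 1
  set U' : ℝ → ℝ := fun t => fderivWithin ℝ (v i) (T i) (pt L s t) e
  have hpt : Continuous fun t => pt L s t :=
    (continuous_pt L).comp (continuous_const.prodMk continuous_id)
  have hcont : ContinuousOn (fun t => v i (pt L s t)) (Set.Icc c d) :=
    (H.contDiffOn i).continuousOn.comp hpt.continuousOn hT
  have hcont' : ContinuousOn U' (Set.Icc c d) :=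
    ((((H.contDiffOn i).continuousOn_fderivWithin (H.uniqueDiff i) le_rfl)).comp
      hpt.continuousOn hT).clm_apply continuousOn_const
  have hder : ∀ t ∈ Set.Ioo c d, HasDerivAt (fun t => v i (pt L s t)) (U' t) t := by
    intro t ht
    have h1 : HasDerivAt (fun t => pt L s t) e t := by
      have : (fun t => pt L s t) = fun t => pt L s 0 + t • e := by
        ext1 t
        rw [← pt_add_vertical, zero_add]
      rw [this]
      simpa using ((hasDerivAt_id t).smul_const e).const_add (pt L s 0)
    have h2 := (((H.contDiffOn i).differentiableOn one_ne_zero) _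
      (hT t (Set.Ioo_subset_Icc_self ht))).hasFDerivWithinAt
    have h3 := h2.comp_hasDerivWithinAt (s := Set.Icc c d) t h1.hasDerivWithinAt hT
    exact h3.hasDerivAt (Icc_mem_nhds ht.1 ht.2)
  have hint : IntervalIntegrable U' volume c d :=
    (hcont'.mono (by rw [Set.uIcc_of_le hcd.le])).intervalIntegrable
  have hFTC := intervalIntegral.integral_eq_sub_of_hasDerivAt_of_le hcd.le hcont hder hint
  rw [intervalIntegral.integral_of_le hcd.le, integral_Ioc_eq_integral_Ioo] at hFTC
  have hle : v i (pt L s d) ≤ v i (pt L s c) + ‖∫ t in Set.Ioo c d, U' t‖ := by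
    rw [hFTC]
    have := le_abs_self (v i (pt L s d) - v i (pt L s c))
    rw [Real.norm_eq_abs]; linarith
  refine (ENNReal.ofReal_le_ofReal hle).trans (ENNReal.ofReal_add_le.trans ?_)
  gcongr
  rw [ofReal_norm]
  refine (enorm_integral_le_lintegral_enorm _).trans ?_
  refine setLIntegral_mono' measurableSet_Ioo fun t ht => ?_
  rw [Set.indicator_of_mem (hΩ t (Set.Ioo_subset_Ioc_self ht))]
  refine le_trans ?_ (Finset.single_le_sum (f := fun i => (T i).indicator
    (fun x => ‖fderivWithin ℝ (v i) (T i) x‖ₑ) (pt L s t)) (fun _ _ => zero_le)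
    (Finset.mem_univ i))
  rw [Set.indicator_of_mem (hT t (Set.Ioo_subset_Icc_self ht))]
  refine (ContinuousLinearMap.le_opENorm _ _).trans ?_
  rw [← ofReal_norm e, norm_pt_zero_one]
  simp

/-- The bound on a line is the integral of the cellwise gradient along it plus the majorants of the
sums of interface jumps. The integrals of these over all parallel lines reassemble to the total
variation. -/
lemma lineVariation (H : PiecewiseC1 Ω T v) (hΩ : IsOpen Ω) :
    LineVariation Ω (cellSup T v) (totalVar Ω T v) := by
  classical
  intro L
  set E : Fin N → Fin N → Set E2 := fun i j => T i ∩ T j ∩ Ω with hE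
  have hTm : ∀ i, MeasurableSet (T i) := fun i => (H.isCompact i).measurableSet
  have hEm : ∀ i j, MeasurableSet (E i j) := fun i j =>
    ((hTm i).inter (hTm j)).inter hΩ.measurableSet
  set f : Fin N → Fin N → E2 → ℝ≥0∞ := fun i j => (T i ∩ T j).indicator fun x => ‖v i x - v j x‖ₑ
  have hfm : ∀ i j, Measurable (f i j) := fun i j => measurable_indicator_of_continuousOn
    (((H.contDiffOn i).continuousOn.mono Set.inter_subset_left).sub
      ((H.contDiffOn j).continuousOn.mono Set.inter_subset_right)).enorm ((hTm i).inter (hTm j))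
  choose q hqm hq hqP using fun i j => exists_sum_majorant L (hEm i j) (hfm i j)
  choose r hrm hr hrP using fun i j => exists_count_majorant L (hEm i j)
  have hgm : Measurable fun p : ℝ × ℝ => Ω.indicator (cellGrad T v) (pt L p.1 p.2) :=
    (H.measurable_cellGrad.indicator hΩ.measurableSet).comp (measurePreserving_pt L).measurable
  set g : ℝ → ℝ≥0∞ := fun s => ∫⁻ t, Ω.indicator (cellGrad T v) (pt L s t) with hg
  have hgm' : Measurable g := hgm.lintegral_prod_right'
  refine ⟨fun s => g s + ∑ i, ∑ j, if i < j then q i j s else 0, ?_, ?_, ?_⟩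
  · refine hgm'.add (Finset.measurable_sum _ fun i _ => Finset.measurable_sum _ fun j _ => ?_)
    split_ifs
    · exact hqm i j
    · exact measurable_const
  · rw [lintegral_add_left hgm', lintegral_finsetSum]
    · refine add_le_add ?_ (Finset.sum_le_sum fun i _ => ?_)
      · rw [← lintegral_indicator hΩ.measurableSet,
          lintegral_pt L (H.measurable_cellGrad.indicator hΩ.measurableSet)]
      · rw [lintegral_finsetSum]
        · refine Finset.sum_le_sum fun j _ => ?_
          split_ifs
          · refine (hq i j).trans (le_of_eq (setLIntegral_congr_fun (hEm i j) fun x hx => ?_))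
            exact Set.indicator_of_mem hx.1 _
          · simp
        · intro j _
          split_ifs
          · exact hqm i j
          · exact measurable_const
    · refine fun i _ => Finset.measurable_sum _ fun j _ => ?_
      split_ifs
      · exact hqm i j
      · exact measurable_const
  -- The interfaces have finite length, so their counting majorants are finite almost everywhere;
  -- almost every line therefore meets them in finitely many points, as the induction along the line
  -- requires.
  · have hfin : ∀ᵐ s, ∀ i j, i < j → r i j s < ⊤ := by
      refine ae_all_iff.2 fun i => ae_all_iff.2 fun j => ?_
      by_cases hij : i < j
      · filter_upwards [ae_lt_top (hrm i j) ((hr i j).trans_lt (H.inter i j hij).lt_top).ne]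
          with s hs _ using hs
      · simp [hij]
    filter_upwards [hfin] with s hs a b hab hline
    have hpt : Continuous fun t => pt L s t :=
      (continuous_pt L).comp (continuous_const.prodMk continuous_id)
    have hfinite : ∀ i j, i < j → {t | pt L s t ∈ E i j}.Finite := by
      intro i j hij
      by_contra hinf
      have hinf : {t | pt L s t ∈ E i j}.Infinite := hinf
      refine absurd (hs i j hij) (not_lt.2 (top_le_iff.2 (ENNReal.eq_top_of_forall_nnreal_le ?_)))
      intro x
      obtain ⟨n, hn⟩ := exists_nat_ge x
      obtain ⟨P, hP, hcard⟩ := hinf.exists_subset_card_eq n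
      refine le_trans ?_ (hrP i j s P fun t ht => hP ht)
      rw [hcard]
      exact_mod_cast hn
    set S : Finset ℝ := Finset.univ.biUnion fun i => Finset.univ.biUnion fun j =>
      if hij : i < j then (hfinite i j hij).toFinset else ∅ with hS
    set J : ℝ → ℝ≥0∞ := fun t => ∑ i, ∑ j,
      if i < j then (E i j).indicator (f i j) (pt L s t) else 0 with hJ
    have hclosure : ∀ t ∈ Set.Icc a b, pt L s t ∈ ⋃ i, T i := by
      have hcl : IsClosed (⋃ i, T i) := isClosed_iUnion_of_finite fun i => (H.isCompact i).isClosed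
      have : Set.Icc a b ⊆ (fun t => pt L s t) ⁻¹' ⋃ i, T i := by
        rw [← closure_Ioc hab.ne]
        exact closure_minimal (fun t ht => H.cover (hline t ht)) (hcl.preimage hpt)
      exact this
    have hJterm : ∀ i j t, i < j → pt L s t ∈ T i → pt L s t ∈ T j → pt L s t ∈ Ω →
        ‖v i (pt L s t) - v j (pt L s t)‖ₑ ≤ J t := by
      intro i j t hij hi hj hO
      have h1 := Finset.single_le_sum (f := fun j' => if i < j' then
        (E i j').indicator (f i j') (pt L s t) else 0) (fun _ _ => zero_le) (Finset.mem_univ j)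
      have h2 := Finset.single_le_sum (f := fun i' => ∑ j', if i' < j' then
        (E i' j').indicator (f i' j') (pt L s t) else 0) (fun _ _ => zero_le) (Finset.mem_univ i)
      refine le_trans ?_ (h1.trans h2)
      rw [if_pos hij, Set.indicator_of_mem (show pt L s t ∈ E i j from ⟨⟨hi, hj⟩, hO⟩)]
      exact (Set.indicator_of_mem (show pt L s t ∈ T i ∩ T j from ⟨hi, hj⟩)
        (fun x => ‖v i x - v j x‖ₑ)).ge
    have hmain := exists_le_add_lintegral_add_sum (fun i => (fun t => pt L s t) ⁻¹' T i)
      (fun i t => ENNReal.ofReal (v i (pt L s t)))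
      (fun t => Ω.indicator (cellGrad T v) (pt L s t)) J
      (fun i => (H.isCompact i).isClosed.preimage hpt) S _ a b hab rfl
      (fun i c d hc hcd hd hsub => H.le_add_lintegral_cellGrad L hcd hsub
        fun t ht => hline t ⟨hc.trans_lt ht.1, ht.2.trans hd⟩)
      (fun t ht i j hi hj => by
        have hdiff : i ≠ j → ‖v i (pt L s t) - v j (pt L s t)‖ₑ ≤ J t := by
          intro hij
          rcases lt_or_gt_of_ne hij with h | h
          · exact hJterm i j t h hi hj (hline t ht)
          · have := hJterm j i t h hj hi (hline t ht)
            rwa [← enorm_neg, neg_sub] at this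
        by_cases hij : i = j
        · subst hij; exact le_self_add
        · have hle : v j (pt L s t) ≤ v i (pt L s t) + ‖v i (pt L s t) - v j (pt L s t)‖ := by
            rw [Real.norm_eq_abs]
            linarith [neg_abs_le (v i (pt L s t) - v j (pt L s t))]
          refine (ENNReal.ofReal_le_ofReal hle).trans (ENNReal.ofReal_add_le.trans ?_)
          rw [ofReal_norm]
          gcongr
          exact hdiff hij)
      (fun t ht => by simpa using hclosure t ht)
      (fun t ht i j hi hj hij => by
        have hO := hline t (Set.Ioo_subset_Ioc_self ht)
        simp only [hS, Finset.mem_biUnion, Finset.mem_univ, true_and]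
        rcases lt_or_gt_of_ne hij with h | h
        · refine ⟨i, j, ?_⟩
          rw [dif_pos h, Set.Finite.mem_toFinset]
          exact ⟨⟨hi, hj⟩, hO⟩
        · refine ⟨j, i, ?_⟩
          rw [dif_pos h, Set.Finite.mem_toFinset]
          exact ⟨⟨hj, hi⟩, hO⟩)
    refine iSup_le fun j => ?_
    by_cases hj : pt L s b ∈ T j
    swap
    · rw [Set.indicator_of_notMem hj]; exact zero_le
    rw [Set.indicator_of_mem hj]
    obtain ⟨i, hi, hle⟩ := hmain j hj
    refine hle.trans ?_
    rw [add_assoc]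
    have hVi : ENNReal.ofReal (v i (pt L s a)) ≤ cellSup T v (pt L s a) := by
      refine le_trans (Set.indicator_of_mem (show pt L s a ∈ T i from hi)
        (fun x => ENNReal.ofReal (v i x))).ge
        (le_iSup (fun i => (T i).indicator (fun x => ENNReal.ofReal (v i x)) (pt L s a)) i)
    refine add_le_add hVi (add_le_add (setLIntegral_le_lintegral _ _) ?_)
    rw [hJ, Finset.sum_comm]
    refine Finset.sum_le_sum fun i _ => ?_
    rw [Finset.sum_comm]
    refine Finset.sum_le_sum fun j _ => ?_
    split_ifs with hij
    · calc ∑ t ∈ insert b (S.filter (· ∈ Set.Ioo a b)), (E i j).indicator (f i j) (pt L s t)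
          = ∑ t ∈ (insert b (S.filter (· ∈ Set.Ioo a b))).filter (fun t => pt L s t ∈ E i j),
            f i j (pt L s t) := by
            rw [Finset.sum_filter]
            exact Finset.sum_congr rfl fun t _ => by simp [Set.indicator_apply]
        _ ≤ q i j s := hqP i j s _ fun t ht => (Finset.mem_filter.1 ht).2
    · simp

end PiecewiseC1

/-! ### Lipschitz graphs -/

/-- Inside the ball about `x` of radius `r`, the set `Ω` is the strict epigraph of `φ` in the frame
given by `L`. -/
def IsEpigraphNear (Ω : Set E2) (x : E2) (L : E2 ≃ₗᵢ[ℝ] E2) (r : ℝ) (φ : ℝ → ℝ) : Prop :=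
  ∀ z ∈ Metric.ball x r, (z ∈ Ω ↔ φ (L z 0) < L z 1)

lemma continuous_coord (L : E2 ≃ₗᵢ[ℝ] E2) (i : Fin 2) : Continuous fun z => L z i :=
  (lipschitzWith_coord L i).continuous

/-- Points below the graph have a neighbourhood that misses `Ω`, and points on the graph are limits
from above. Hence the frontier is locally exactly the graph. -/
lemma IsEpigraphNear.mem_frontier_iff {Ω : Set E2} {x z : E2} {L : E2 ≃ₗᵢ[ℝ] E2} {r : ℝ}
    {φ : ℝ → ℝ} (h : IsEpigraphNear Ω x L r φ) (hΩ : IsOpen Ω) (hφ : Continuous φ)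
    (hz : z ∈ Metric.ball x r) : z ∈ frontier Ω ↔ L z 1 = φ (L z 0) := by
  rw [hΩ.frontier_eq, Set.mem_sdiff, h z hz]
  constructor
  · rintro ⟨hcl, hn⟩
    refine le_antisymm (not_lt.1 hn) (not_lt.1 fun hlt => ?_)
    have hopen : IsOpen {w | L w 1 < φ (L w 0)} :=
      isOpen_lt (continuous_coord L 1) (hφ.comp (continuous_coord L 0))
    obtain ⟨w, ⟨hw1, hw2⟩, hw3⟩ := mem_closure_iff.1 hcl _ (hopen.inter Metric.isOpen_ball) ⟨hlt, hz⟩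
    exact lt_asymm hw1 ((h w hw2).1 hw3)
  · intro heq
    refine ⟨?_, heq.le.not_gt⟩
    have hlim : Tendsto (fun t : ℝ => z + t • pt L 0 1) (𝓝[>] 0) (𝓝 z) := by
      have : Continuous fun t : ℝ => z + t • pt L 0 1 := by fun_prop
      simpa using (this.tendsto 0).mono_left nhdsWithin_le_nhds
    refine mem_closure_of_tendsto hlim ?_
    filter_upwards [hlim (Metric.isOpen_ball.mem_nhds hz), self_mem_nhdsWithin] with t ht ht0
    rw [h _ ht]
    beta_reduce
    rw [← pt_coord L z, ← pt_add_vertical]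
    simp only [coord_zero_pt, coord_one_pt]
    rw [heq]
    exact lt_add_of_pos_right _ ht0

/-- Projection of the graph onto its parameter interval does not increase length;
`exists_sum_majorant` is used with the single point of the graph on each line. -/
lemma lintegral_graph_le (L : E2 ≃ₗᵢ[ℝ] E2) {φ : ℝ → ℝ} (hφ : Continuous φ) {I : Set ℝ}
    (hI : MeasurableSet I) {Γ : Set E2} (hΓ : ∀ s ∈ I, pt L s (φ s) ∈ Γ) {V : E2 → ℝ≥0∞}
    (hV : Measurable V) : ∫⁻ s in I, V (pt L s (φ s)) ≤ ∫⁻ x in Γ, V x ∂μH[1] := by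
  set E : Set E2 := {z | L z 0 ∈ I ∧ L z 1 = φ (L z 0)} with hE
  have hEm : MeasurableSet E := ((continuous_coord L 0).measurable hI).inter
    (measurableSet_eq_fun (continuous_coord L 1).measurable
      (hφ.comp (continuous_coord L 0)).measurable)
  have hEΓ : E ⊆ Γ := by
    rintro z ⟨hz, hz'⟩
    have := hΓ _ hz
    rwa [← hz', pt_coord] at this
  obtain ⟨q, _, hq, hqP⟩ := exists_sum_majorant L hEm hV
  calc ∫⁻ s in I, V (pt L s (φ s)) ≤ ∫⁻ s in I, q s :=
        setLIntegral_mono' hI fun s hs => by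
          simpa using hqP s {φ s} (by simp [hE, hs])
    _ ≤ ∫⁻ s, q s := setLIntegral_le_lintegral _ _
    _ ≤ ∫⁻ x in E, V x ∂μH[1] := hq
    _ ≤ _ := lintegral_mono_set hEΓ

lemma exists_frame (u : E2) (hu : ‖u‖ = 1) : ∃ L : E2 ≃ₗᵢ[ℝ] E2, pt L 0 1 = u := by
  have hon : Orthonormal ℝ (({1} : Set (Fin 2)).domRestrict fun _ => u) := by
    refine ⟨fun i => hu, fun i j hij => ?_⟩
    exact absurd (Subsingleton.elim i j) hij
  obtain ⟨b, hb⟩ := hon.exists_orthonormalBasis_extension_of_card_eq (by simp)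
  refine ⟨b.repr, ?_⟩
  have : (!₂[(0 : ℝ), 1] : E2) = EuclideanSpace.single 1 1 := by
    ext i; fin_cases i <;> simp
  rw [pt, this, OrthonormalBasis.repr_symm_single, hb 1 rfl]

/-! ### A Friedrichs inequality for functions of bounded variation along lines -/

/-- The integral over `S` of functions of bounded variation along lines in `Ω` is controlled by the
variation and the boundary values on `Γ`. -/
def IsControlled (Ω Γ S : Set E2) : Prop :=
  ∃ C : ℝ≥0, ∀ (V : E2 → ℝ≥0∞) (A : ℝ≥0∞), Measurable V → LineVariation Ω V A →
    ∫⁻ x in S, V x ≤ C * (A + ∫⁻ x in Γ, V x ∂μH[1])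

namespace IsControlled

variable {Ω Γ S S' : Set E2}

lemma mono (h : IsControlled Ω Γ S) (hS : S' ⊆ S) : IsControlled Ω Γ S' := by
  obtain ⟨C, hC⟩ := h
  exact ⟨C, fun V A hV hA => (lintegral_mono_set hS).trans (hC V A hV hA)⟩

lemma empty : IsControlled Ω Γ ∅ := ⟨0, fun V A _ _ => by simp⟩

lemma union (h : IsControlled Ω Γ S) (h' : IsControlled Ω Γ S') : IsControlled Ω Γ (S ∪ S') := by
  obtain ⟨C, hC⟩ := h
  obtain ⟨C', hC'⟩ := h'
  refine ⟨C + C', fun V A hV hA => (lintegral_union_le _ _ _).trans ?_⟩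
  rw [ENNReal.coe_add, add_mul]
  exact add_le_add (hC V A hV hA) (hC' V A hV hA)

/-- The values at `x` and `x + d` differ by at most the variation on the segment between them.
Integration along each line of direction `d` costs at most the length `2 * R` of the line inside a
ball containing `Ω`. -/
lemma of_translate (hΩ : Bornology.IsBounded Ω) (h : IsControlled Ω Γ S') (hS : MeasurableSet S)
    (d : E2) (hseg : ∀ x ∈ S, ∀ t ∈ Set.Icc (0 : ℝ) 1, x + t • d ∈ Ω) (hd : ∀ x ∈ S, x + d ∈ S') :
    IsControlled Ω Γ S := by
  by_cases hd0 : d = 0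
  · exact h.mono fun x hx => by simpa [hd0] using hd x hx
  obtain ⟨C, hC⟩ := h
  have hτ : 0 < ‖d‖ := norm_pos_iff.2 hd0
  -- The vertical axis points against `d`, so the line runs upwards from `x + d`, where control is
  -- known, to `x`.
  obtain ⟨L, hL⟩ := exists_frame (-(‖d‖⁻¹ • d)) (by
    rw [norm_neg, norm_smul, norm_inv, norm_norm, inv_mul_cancel₀ hτ.ne'])
  have hshift : ∀ s t t', pt L s t' = pt L s t + ((t - t') / ‖d‖) • d := fun s t t' => by
    have := pt_add_vertical L s t (t' - t)
    rw [add_sub_cancel] at this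
    rw [this, hL, smul_neg, ← neg_smul, smul_smul, neg_sub, div_eq_mul_inv]
  obtain ⟨R, hR⟩ := hΩ.exists_norm_le
  have hR' : ∀ x ∈ S, ‖x‖ ≤ R := fun x hx => hR x (by simpa using hseg x hx 0 (by simp))
  refine ⟨C + (2 * R).toNNReal, fun V A hV hA => ?_⟩
  obtain ⟨q, hqm, hq, hae⟩ := hA L
  have hptm := (measurePreserving_pt L).measurable
  have hsub : ∀ s t, pt L s (t - ‖d‖) = pt L s t + d := fun s t => by
    rw [hshift s t, sub_sub_cancel, div_self hτ.ne', one_smul]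
  have hVd : Measurable fun x => S.indicator (fun x => V (x + d)) x :=
    (hV.comp (measurable_id.add_const d)).indicator hS
  have hline : ∀ᵐ s, ∫⁻ t, S.indicator V (pt L s t) ≤
      (∫⁻ t, S.indicator (fun x => V (x + d)) (pt L s t)) + ENNReal.ofReal (2 * R) * q s := by
    filter_upwards [hae] with s hs
    have hm1 : Measurable fun t => S.indicator (fun x => V (x + d)) (pt L s t) :=
      hVd.comp (hptm.comp (measurable_const.prodMk measurable_id))
    calc ∫⁻ t, S.indicator V (pt L s t)
        ≤ ∫⁻ t, (S.indicator (fun x => V (x + d)) (pt L s t)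
            + (Set.Icc (-R) R).indicator (fun _ => q s) t) := by
          refine lintegral_mono fun t => ?_
          by_cases hx : pt L s t ∈ S
          · have htR : t ∈ Set.Icc (-R) R := by
              rw [Set.mem_Icc, ← abs_le]
              have := abs_coord_sub_le L 1 (pt L s t) 0
              simp only [coord_one_pt, map_zero, PiLp.zero_apply, sub_zero,
                dist_zero_right] at this
              exact this.trans (hR' _ hx)
            rw [Set.indicator_of_mem hx, Set.indicator_of_mem hx, Set.indicator_of_mem htR,
              ← hsub s t]
            refine hs (t - ‖d‖) t (by linarith) fun t' ht' => ?_
            rw [hshift s t t']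
            exact hseg _ hx _ ⟨div_nonneg (by linarith [ht'.2]) hτ.le,
              (div_le_one hτ).2 (by linarith [ht'.1])⟩
          · rw [Set.indicator_of_notMem hx]; exact zero_le
      _ = _ := by
          rw [lintegral_add_left hm1, lintegral_indicator_const measurableSet_Icc,
            Real.volume_Icc, mul_comm]
          congr 3; ring
  calc ∫⁻ x in S, V x = ∫⁻ s, ∫⁻ t, S.indicator V (pt L s t) := by
        rw [← lintegral_indicator hS, lintegral_pt L (hV.indicator hS)]
    _ ≤ ∫⁻ s, ((∫⁻ t, S.indicator (fun x => V (x + d)) (pt L s t))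
          + ENNReal.ofReal (2 * R) * q s) := lintegral_mono_ae hline
    _ = (∫⁻ x, S.indicator (fun x => V (x + d)) x) + ENNReal.ofReal (2 * R) * ∫⁻ s, q s := by
        rw [lintegral_add_right _ (hqm.const_mul _), lintegral_const_mul _ hqm, lintegral_pt L hVd]
    _ ≤ (∫⁻ x in S', V x) + ENNReal.ofReal (2 * R) * A := by
        refine add_le_add ?_ (by gcongr)
        calc ∫⁻ x, S.indicator (fun x => V (x + d)) x
            ≤ ∫⁻ x, S'.indicator V (x + d) := by
              refine lintegral_mono fun x => ?_
              by_cases hx : x ∈ S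
              · rw [Set.indicator_of_mem hx, Set.indicator_of_mem (hd x hx)]
              · rw [Set.indicator_of_notMem hx]; exact zero_le
          _ = ∫⁻ x, S'.indicator V x := lintegral_add_right_eq_self _ d
          _ ≤ _ := lintegral_indicator_le _ _
    _ ≤ C * (A + ∫⁻ x in Γ, V x ∂μH[1]) + ENNReal.ofReal (2 * R) * (A + ∫⁻ x in Γ, V x ∂μH[1]) := by
        gcongr
        · exact hC V A hV hA
        · exact le_self_add
    _ = _ := by rw [ENNReal.coe_add, add_mul]; rfl

/-- In a thin strip above an arc of `Γ`, every vertical line starts at a point of `Γ`. The value in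
the strip is thus at most the value on `Γ` plus the variation, and any ball in the strip is
controlled. -/
lemma exists_ball_of_dirichletPart (hΩ : IsLipschitzDomain Ω) (hΓ : IsDirichletPart Ω Γ) :
    ∃ x ∈ Ω, ∃ r > 0, IsControlled Ω Γ (Metric.ball x r) := by
  obtain ⟨⟨p, hp⟩, U, hU, rfl⟩ := hΓ
  obtain ⟨L, r, K, φ, hr, hφ, hgraph⟩ := hΩ.graph p hp.2
  have hep : IsEpigraphNear Ω p L r φ := hgraph
  have hφp : L p 1 = φ (L p 0) :=
    (hep.mem_frontier_iff hΩ.isOpen hφ.continuous (Metric.mem_ball_self hr)).1 hp.2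
  obtain ⟨δ', hδ', hball⟩ := Metric.isOpen_iff.1 hU p hp.1
  set δ := min δ' r with hδ
  have hδ0 : 0 < δ := lt_min hδ' hr
  -- With this width the horizontal offset, the variation of the graph and the strip height `δ / 2`
  -- add up to at most `δ`, so the strip stays in the ball of radius `δ`.
  set ρ := δ / (2 * (1 + K)) with hρ
  have hK : (0 : ℝ) ≤ K := K.2
  have hρ0 : 0 < ρ := by positivity
  have hρK : ρ * (1 + K) = δ / 2 := by rw [hρ]; field_simp
  set I : Set ℝ := Set.Ioo (L p 0 - ρ) (L p 0 + ρ) with hI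
  have hnear : ∀ s ∈ I, ∀ t ∈ Set.Ico (φ s) (φ s + δ / 2), pt L s t ∈ Metric.ball p δ := by
    intro s hs t ht
    rw [Metric.mem_ball, ← pt_coord L p]
    have h1 : |s - L p 0| < ρ := by rw [abs_lt]; constructor <;> linarith [hs.1, hs.2]
    have h2 : |φ s - φ (L p 0)| ≤ K * |s - L p 0| := by
      simpa [Real.dist_eq] using hφ.dist_le_mul s (L p 0)
    have h3 : |t - L p 1| ≤ |t - φ s| + |φ s - φ (L p 0)| := by
      rw [hφp]; exact abs_sub_le _ _ _
    have h4 : |t - φ s| < δ / 2 := by rw [abs_lt]; constructor <;> linarith [ht.1, ht.2]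
    have h5 : (K : ℝ) * |s - L p 0| ≤ K * ρ := by gcongr
    calc _ ≤ _ := dist_pt_le L s t (L p 0) (L p 1)
      _ < δ := by nlinarith
  have hnear' : ∀ s ∈ I, ∀ t ∈ Set.Ioo (φ s) (φ s + δ / 2), pt L s t ∈ Ω := fun s hs t ht => by
    rw [hep _ (Metric.ball_subset_ball (min_le_right _ _) (hnear s hs t (Set.Ioo_subset_Ico_self ht)))]
    simpa using ht.1
  have hbd : ∀ s ∈ I, pt L s (φ s) ∈ U ∩ frontier Ω := fun s hs => by
    have := hnear s hs (φ s) ⟨le_rfl, by linarith⟩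
    refine ⟨hball (Metric.ball_subset_ball (min_le_left _ _) this), ?_⟩
    rw [hep.mem_frontier_iff hΩ.isOpen hφ.continuous
      (Metric.ball_subset_ball (min_le_right _ _) this)]
    simp
  set S : Set E2 := {z | L z 0 ∈ I ∧ L z 1 ∈ Set.Ioo (φ (L z 0)) (φ (L z 0) + δ / 2)} with hS
  have hSo : IsOpen S := by
    refine (isOpen_Ioo.preimage (continuous_coord L 0)).inter (IsOpen.inter ?_ ?_)
    · exact isOpen_lt (hφ.continuous.comp (continuous_coord L 0)) (continuous_coord L 1)
    · exact isOpen_lt (continuous_coord L 1)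
        ((hφ.continuous.comp (continuous_coord L 0)).add continuous_const)
  have hSc : IsControlled Ω (U ∩ frontier Ω) S := by
    refine ⟨(δ / 2).toNNReal, fun V A hV hA => ?_⟩
    obtain ⟨q, hqm, hq, hae⟩ := hA L
    calc ∫⁻ x in S, V x = ∫⁻ s, ∫⁻ t, S.indicator V (pt L s t) := by
          rw [← lintegral_indicator hSo.measurableSet,
            lintegral_pt L (hV.indicator hSo.measurableSet)]
      _ ≤ ∫⁻ s : ℝ, ENNReal.ofReal (δ / 2) * (I.indicator (fun s => V (pt L s (φ s))) s + q s) := by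
          refine lintegral_mono_ae ?_
          filter_upwards [hae] with s hs
          by_cases hsI : s ∈ I
          · rw [Set.indicator_of_mem hsI]
            calc ∫⁻ t, S.indicator V (pt L s t)
                ≤ ∫⁻ t, (Set.Ioo (φ s) (φ s + δ / 2)).indicator
                    (fun _ => V (pt L s (φ s)) + q s) t := by
                  refine lintegral_mono fun t => ?_
                  by_cases ht : t ∈ Set.Ioo (φ s) (φ s + δ / 2)
                  · rw [Set.indicator_of_mem ht]
                    refine (Set.indicator_le_self _ _ _).trans ?_
                    exact hs (φ s) t ht.1 fun t' ht' => hnear' s hsI t' ⟨ht'.1, ht'.2.trans_lt ht.2⟩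
                  · rw [Set.indicator_of_notMem]
                    · exact zero_le
                    · rintro ⟨_, h2⟩
                      exact ht (by simpa using h2)
              _ = _ := by
                  rw [lintegral_indicator_const measurableSet_Ioo, Real.volume_Ioo,
                    add_sub_cancel_left, mul_comm]
          · have : ∀ t, S.indicator V (pt L s t) = 0 := fun t => by
              rw [Set.indicator_of_notMem]
              rintro ⟨h1, _⟩
              exact hsI (by simpa using h1)
            simp [this]
      _ = ENNReal.ofReal (δ / 2) * ((∫⁻ s in I, V (pt L s (φ s))) + ∫⁻ s, q s) := by
          rw [lintegral_const_mul' _ _ ENNReal.ofReal_ne_top, lintegral_add_right _ hqm,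
            lintegral_indicator measurableSet_Ioo]
      _ ≤ ENNReal.ofReal (δ / 2) * ((∫⁻ x in U ∩ frontier Ω, V x ∂μH[1]) + A) := by
          gcongr
          exact lintegral_graph_le L hφ.continuous measurableSet_Ioo hbd hV
      _ = _ := by rw [add_comm A]; rfl
  have hx : pt L (L p 0) (φ (L p 0) + δ / 4) ∈ S := by
    simp only [hS, hI, Set.mem_ofPred_eq, coord_zero_pt, coord_one_pt, Set.mem_Ioo]
    refine ⟨⟨by linarith, by linarith⟩, by linarith, by linarith⟩
  obtain ⟨ε, hε, hεS⟩ := Metric.isOpen_iff.1 hSo _ hx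
  refine ⟨_, hnear' (L p 0) ⟨by linarith, by linarith⟩ _ ⟨by linarith, by linarith⟩, ε, hε,
    hSc.mono hεS⟩

/-- The set of centres of controlled balls is open, meets `Ω`, and is closed relative to `Ω`,
because a small ball at a limit point translates into a controlled ball nearby. Connectedness of `Ω`
then gives every point. -/
lemma exists_ball (hΩ : IsLipschitzDomain Ω) (hΓ : IsDirichletPart Ω Γ) {x : E2} (hx : x ∈ Ω) :
    ∃ r > 0, IsControlled Ω Γ (Metric.ball x r) := by
  set W : Set E2 := {x | ∃ r > 0, IsControlled Ω Γ (Metric.ball x r)} with hW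
  suffices Ω ⊆ W from this hx
  refine hΩ.isConnected.isPreconnected.subset_of_closure_inter_subset ?_ ?_ ?_
  · refine Metric.isOpen_iff.2 fun y ⟨r, hr, hc⟩ => ⟨r, hr, fun z hz => ?_⟩
    exact ⟨r - dist z y, sub_pos.2 hz, hc.mono (Metric.ball_subset_ball' (by linarith))⟩
  · obtain ⟨x, hx, hc⟩ := exists_ball_of_dirichletPart hΩ hΓ
    exact ⟨x, hx, hc⟩
  · rintro z ⟨hzW, hzΩ⟩
    obtain ⟨ε, hε, hball⟩ := Metric.isOpen_iff.1 hΩ.isOpen z hzΩ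
    obtain ⟨y, ⟨ρ', hρ', hc⟩, hzy⟩ := Metric.mem_closure_iff.1 hzW (ε / 2) (by linarith)
    -- The radius must fit inside the controlled ball after translation, and every intermediate
    -- translate must remain in the ball of radius `ε`, which lies in `Ω`.
    refine ⟨min ρ' (ε / 2), lt_min hρ' (by linarith), ?_⟩
    refine of_translate hΩ.isBounded hc Metric.isOpen_ball.measurableSet (y - z) ?_ ?_
    · intro w hw t ht
      refine hball ?_
      rw [Metric.mem_ball, dist_eq_norm]
      have h1 : ‖w - z‖ < ε / 2 := by
        rw [← dist_eq_norm]; exact (Metric.mem_ball.1 hw).trans_le (min_le_right _ _)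
      have h2 : ‖y - z‖ < ε / 2 := by rw [← dist_eq_norm, dist_comm]; exact hzy
      calc ‖w + t • (y - z) - z‖ = ‖(w - z) + t • (y - z)‖ := by congr 1; abel
        _ ≤ ‖w - z‖ + ‖t • (y - z)‖ := norm_add_le _ _
        _ ≤ ‖w - z‖ + 1 * ‖y - z‖ := by
            rw [norm_smul, Real.norm_of_nonneg ht.1]
            gcongr
            exact ht.2
        _ < ε := by linarith
    · intro w hw
      rw [Metric.mem_ball, dist_eq_norm]
      have : w + (y - z) - y = w - z := by abel
      rw [this, ← dist_eq_norm]
      exact (Metric.mem_ball.1 hw).trans_le (min_le_left _ _)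

/-- Moving up by `r / 2` from above the graph stays in `Ω` and carries a neighbourhood of the
boundary point into a controlled interior ball. -/
lemma exists_nhds_frontier (hΩ : IsLipschitzDomain Ω) (hΓ : IsDirichletPart Ω Γ) {x : E2}
    (hx : x ∈ frontier Ω) : ∃ ρ > 0, IsControlled Ω Γ (Metric.ball x ρ ∩ Ω) := by
  obtain ⟨L, r, K, φ, hr, hφ, hgraph⟩ := hΩ.graph x hx
  have hep : IsEpigraphNear Ω x L r φ := hgraph
  have hup : ∀ z ∈ Metric.ball x (r / 2), φ (L z 0) ≤ L z 1 → ∀ t ∈ Set.Icc (0 : ℝ) (r / 2),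
      (φ (L z 0) < L z 1 ∨ 0 < t) → z + t • pt L 0 1 ∈ Ω := by
    intro z hz hz' t ht hor
    have hball : z + t • pt L 0 1 ∈ Metric.ball x r := by
      rw [Metric.mem_ball, dist_eq_norm] at hz ⊢
      calc ‖z + t • pt L 0 1 - x‖ = ‖(z - x) + t • pt L 0 1‖ := by congr 1; abel
        _ ≤ ‖z - x‖ + ‖t • pt L 0 1‖ := norm_add_le _ _
        _ < r := by
            rw [norm_smul, norm_pt_zero_one, mul_one, Real.norm_of_nonneg ht.1]
            linarith [ht.2]
    rw [hep _ hball, ← pt_coord L z, ← pt_add_vertical]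
    simp only [coord_zero_pt, coord_one_pt]
    rcases hor with h | h <;> linarith [ht.1]
  have hx1 : L x 1 = φ (L x 0) :=
    (hep.mem_frontier_iff hΩ.isOpen hφ.continuous (Metric.mem_ball_self hr)).1 hx
  have hy := hup x (Metric.mem_ball_self (by linarith)) hx1.ge (r / 2) ⟨by linarith, le_rfl⟩
    (Or.inr (by linarith))
  obtain ⟨ρ', hρ', hc⟩ := exists_ball hΩ hΓ hy
  refine ⟨min ρ' (r / 2), lt_min hρ' (by linarith), ?_⟩
  refine of_translate hΩ.isBounded hc (Metric.isOpen_ball.inter hΩ.isOpen).measurableSet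
    ((r / 2) • pt L 0 1) ?_ ?_
  · rintro z ⟨hz, hzΩ⟩ t ht
    have hzr := Metric.ball_subset_ball (min_le_right _ _) hz
    have hlt := (hep z (Metric.ball_subset_ball (by linarith) hzr)).1 hzΩ
    rw [smul_smul]
    exact hup z hzr hlt.le _ ⟨by have := ht.1; positivity, by nlinarith [ht.2]⟩ (Or.inl hlt)
  · rintro z ⟨hz, -⟩
    rw [Metric.mem_ball, dist_add_right]
    exact (Metric.mem_ball.1 hz).trans_le (min_le_left _ _)

end IsControlled

/-- Control is stable under finite unions, so the local statements at interior and boundary points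
combine by compactness of the closure. -/
theorem isControlled_of_isLipschitzDomain {Ω Γ : Set E2} (hΩ : IsLipschitzDomain Ω)
    (hΓ : IsDirichletPart Ω Γ) : IsControlled Ω Γ Ω := by
  have hcpt : IsCompact (closure Ω) :=
    Metric.isCompact_of_isClosed_isBounded isClosed_closure hΩ.isBounded.closure
  have : IsControlled Ω Γ (closure Ω ∩ Ω) := by
    refine hcpt.induction_on (p := fun S => IsControlled Ω Γ (S ∩ Ω)) ?_ ?_ ?_ ?_
    · simpa using IsControlled.empty
    · exact fun S S' hSS h => h.mono (Set.inter_subset_inter_left _ hSS)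
    · intro S S' h h'
      rw [Set.union_inter_distrib_right]
      exact h.union h'
    · intro x hx
      by_cases hxΩ : x ∈ Ω
      · obtain ⟨r, hr, hc⟩ := IsControlled.exists_ball hΩ hΓ hxΩ
        exact ⟨_, mem_nhdsWithin_of_mem_nhds (Metric.ball_mem_nhds x hr),
          hc.mono Set.inter_subset_left⟩
      · obtain ⟨r, hr, hc⟩ := IsControlled.exists_nhds_frontier hΩ hΓ
          (x := x) (by rw [hΩ.isOpen.frontier_eq]; exact ⟨hx, hxΩ⟩)
        exact ⟨_, mem_nhdsWithin_of_mem_nhds (Metric.ball_mem_nhds x hr), hc⟩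
  exact this.mono fun x hx => ⟨subset_closure hx, hx⟩

/-! ### Traces on the boundary of a Lipschitz domain -/

lemma eLpNorm_two_sq {α : Type*} [MeasurableSpace α] {μ : Measure α} (f : α → ℝ) :
    eLpNorm f 2 μ ^ 2 = ∫⁻ x, ‖f x‖ₑ ^ 2 ∂μ := by
  have := eLpNorm_nnreal_pow_eq_lintegral (μ := μ) (f := f) (p := 2) two_ne_zero
  simpa using this

lemma ofReal_integral_sq {α : Type*} [MeasurableSpace α] {μ : Measure α} {f : α → ℝ}
    (hf : MemLp f 2 μ) : ENNReal.ofReal (∫ x, f x ^ 2 ∂μ) = ∫⁻ x, ‖f x‖ₑ ^ 2 ∂μ := by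
  rw [ofReal_integral_eq_lintegral_ofReal hf.integrable_sq
    (Eventually.of_forall fun x => sq_nonneg _)]
  congr 1; ext x
  rw [← enorm_pow, Real.enorm_of_nonneg (sq_nonneg _)]

lemma norm_le_sum_apply_single (A : E2 →L[ℝ] ℝ) :
    ‖A‖ ≤ ∑ a, |A (EuclideanSpace.single a 1)| := by
  refine A.opNorm_le_bound (Finset.sum_nonneg fun _ _ => abs_nonneg _) fun x => ?_
  have hx : x = ∑ a, x a • EuclideanSpace.single a (1 : ℝ) := by
    ext i; fin_cases i <;> simp
  calc ‖A x‖ = ‖∑ a, x a * A (EuclideanSpace.single a 1)‖ := by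
        conv_lhs => rw [hx]
        simp
    _ ≤ ∑ a, ‖x a * A (EuclideanSpace.single a 1)‖ := norm_sum_le _ _
    _ ≤ ∑ a, |A (EuclideanSpace.single a 1)| * ‖x‖ := by
        refine Finset.sum_le_sum fun a _ => ?_
        rw [norm_mul, mul_comm]
        exact mul_le_mul_of_nonneg_left (PiLp.norm_apply_le x a) (abs_nonneg _)
    _ = _ := by rw [Finset.sum_mul]

/-- Equality is required on the closure, since the lower endpoint of an admissible segment may lie
on the boundary. -/
lemma LineVariation.congr {Ω : Set E2} {V V' : E2 → ℝ≥0∞} {A : ℝ≥0∞} (h : LineVariation Ω V A)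
    (hV : Set.EqOn V V' (closure Ω)) : LineVariation Ω V' A := by
  intro L
  obtain ⟨q, hqm, hq, hae⟩ := h L
  refine ⟨q, hqm, hq, hae.mono fun s hs a b hab hline => ?_⟩
  have hpt : Continuous fun t => pt L s t :=
    (continuous_pt L).comp (continuous_const.prodMk continuous_id)
  have hsub : Set.Icc a b ⊆ (fun t => pt L s t) ⁻¹' closure Ω := by
    rw [← closure_Ioc hab.ne]
    exact closure_minimal (fun t ht => subset_closure (hline t ht)) (isClosed_closure.preimage hpt)
  rw [← hV (hsub (Set.left_mem_Icc.2 hab.le)), ← hV (hsub (Set.right_mem_Icc.2 hab.le))]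
  exact hs a b hab hline

lemma LineVariation.mono {Ω : Set E2} {V : E2 → ℝ≥0∞} {A A' : ℝ≥0∞} (h : LineVariation Ω V A)
    (hA : A ≤ A') : LineVariation Ω V A' := fun L => by
  obtain ⟨q, hqm, hq, hae⟩ := h L
  exact ⟨q, hqm, hq.trans hA, hae⟩

/-- The negated frame reverses the lines. An upper endpoint of the reversed segment must lie in `Ω`,
so the lower endpoint `a`, possibly on the boundary, is reached as a limit by continuity of `V`. -/
lemma LineVariation.exists_reverse {Ω : Set E2} {V : E2 → ℝ≥0∞} {A : ℝ≥0∞}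
    (h : LineVariation Ω V A) (hV : Continuous V) (L : E2 ≃ₗᵢ[ℝ] E2) :
    ∃ q : ℝ → ℝ≥0∞, Measurable q ∧ ∫⁻ s, q s ≤ A ∧ ∀ᵐ s, ∀ a b, a < b →
      (∀ t ∈ Set.Ioo a b, pt L s t ∈ Ω) → V (pt L s a) ≤ V (pt L s b) + q s := by
  obtain ⟨q, hqm, hq, hae⟩ := h (L.trans (LinearIsometryEquiv.neg ℝ))
  have hneg : ∀ s t, pt (L.trans (LinearIsometryEquiv.neg ℝ)) s t = pt L (-s) (-t) := by
    intro s t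
    have h1 := pt_smul L (-1) s t
    simp only [neg_mul, one_mul] at h1
    rw [h1, pt, pt]
    simp
  refine ⟨fun s => q (-s), hqm.comp measurable_neg, ?_, ?_⟩
  · rwa [lintegral_neg_eq_self q]
  · have := (Measure.measurePreserving_neg (volume : Measure ℝ)).quasiMeasurePreserving.ae hae
    filter_upwards [this] with s hs a b hab hline
    have hpt : Continuous fun t => pt L s t :=
      (continuous_pt L).comp (continuous_const.prodMk continuous_id)
    refine le_of_tendsto (((hV.comp hpt).tendsto a).mono_left
      (nhdsWithin_le_nhds (s := Set.Ioi a))) ?_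
    filter_upwards [Ioo_mem_nhdsGT hab] with a' ha'
    have := hs (-b) (-a') (neg_lt_neg ha'.2) fun t ht => by
      rw [hneg, neg_neg]
      exact hline _ ⟨by linarith [ht.2, ha'.1], by linarith [ht.1]⟩
    simpa [hneg] using this

/-- The parametrization of the graph is Lipschitz with constant `1 + K`, so arc length on it is at
most `1 + K` times the image of Lebesgue measure. -/
lemma lintegral_le_lintegral_graph (L : E2 ≃ₗᵢ[ℝ] E2) {K : ℝ≥0} {φ : ℝ → ℝ}
    (hφ : LipschitzWith K φ) {I : Set ℝ} {Γ : Set E2}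
    (hΓ : ∀ z ∈ Γ, L z 0 ∈ I ∧ L z 1 = φ (L z 0)) {V : E2 → ℝ≥0∞} (hV : Measurable V) :
    ∫⁻ x in Γ, V x ∂μH[1] ≤ (1 + K) * ∫⁻ s in I, V (pt L s (φ s)) := by
  set g : ℝ → E2 := fun s => pt L s (φ s) with hg
  have hgL : LipschitzWith (1 + K) g := LipschitzWith.of_dist_le_mul fun s s' => by
    refine (dist_pt_le L _ _ _ _).trans ?_
    have := hφ.dist_le_mul s s'
    rw [Real.dist_eq, Real.dist_eq] at this
    rw [NNReal.coe_add, NNReal.coe_one, Real.dist_eq, add_mul, one_mul]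
    linarith
  have hgm : Measurable g := hgL.continuous.measurable
  have hle : (μH[1] : Measure E2).restrict Γ ≤ (1 + K : ℝ≥0) • (volume.restrict I).map g := by
    refine Measure.le_iff.2 fun B hB => ?_
    rw [Measure.restrict_apply hB, Measure.smul_apply, Measure.map_apply hgm hB,
      Measure.restrict_apply (hgm hB)]
    calc μH[1] (B ∩ Γ) ≤ μH[1] (g '' (g ⁻¹' B ∩ I)) := by
          refine measure_mono fun z hz => ?_
          obtain ⟨h1, h2⟩ := hΓ z hz.2
          have : g (L z 0) = z := by rw [hg]; simp only; rw [← h2, pt_coord]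
          exact ⟨L z 0, ⟨by rw [Set.mem_preimage, this]; exact hz.1, h1⟩, this⟩
      _ ≤ (1 + K : ℝ≥0) ^ (1 : ℝ) * μH[1] (g ⁻¹' B ∩ I) :=
          hgL.hausdorffMeasure_image_le zero_le_one _
      _ = _ := by
          rw [ENNReal.rpow_one, hausdorffMeasure_real]; rfl
  calc ∫⁻ x in Γ, V x ∂μH[1] ≤ ∫⁻ x, V x ∂((1 + K : ℝ≥0) • (volume.restrict I).map g) :=
        lintegral_mono' hle le_rfl
    _ = _ := by
        rw [lintegral_smul_measure, lintegral_map hV hgm]; simp [ENNReal.smul_def]; rfl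

/-- A boundary value is at most any value above it on the same vertical line plus the variation.
Averaging over the heights up to `r / 2` replaces the interior value by an integral over `Ω`;
compactness of the frontier sums the local bounds. -/
theorem exists_lintegral_frontier_le {Ω : Set E2} (hΩ : IsLipschitzDomain Ω) :
    ∃ C : ℝ≥0, ∀ (V : E2 → ℝ≥0∞) (A : ℝ≥0∞), Continuous V → LineVariation Ω V A →
      ∫⁻ x in frontier Ω, V x ∂μH[1] ≤ C * ((∫⁻ x in Ω, V x) + A) := by
  have hcpt : IsCompact (frontier Ω) := Metric.isCompact_of_isClosed_isBounded isClosed_frontier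
    (hΩ.isBounded.closure.subset frontier_subset_closure)
  have : ∃ C : ℝ≥0, ∀ (V : E2 → ℝ≥0∞) (A : ℝ≥0∞), Continuous V → LineVariation Ω V A →
      ∫⁻ x in frontier Ω ∩ frontier Ω, V x ∂μH[1] ≤ C * ((∫⁻ x in Ω, V x) + A) := by
    refine hcpt.induction_on (p := fun S => ∃ C : ℝ≥0, ∀ (V : E2 → ℝ≥0∞) (A : ℝ≥0∞), Continuous V →
      LineVariation Ω V A →
        ∫⁻ x in S ∩ frontier Ω, V x ∂μH[1] ≤ C * ((∫⁻ x in Ω, V x) + A)) ?_ ?_ ?_ ?_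
    · exact ⟨0, fun V A _ _ => by simp⟩
    · rintro S S' hSS ⟨C, hC⟩
      exact ⟨C, fun V A hV hA => (lintegral_mono_set (Set.inter_subset_inter_left _ hSS)).trans
        (hC V A hV hA)⟩
    · rintro S S' ⟨C, hC⟩ ⟨C', hC'⟩
      refine ⟨C + C', fun V A hV hA => ?_⟩
      rw [Set.union_inter_distrib_right, ENNReal.coe_add, add_mul]
      exact (lintegral_union_le _ _ _).trans (add_le_add (hC V A hV hA) (hC' V A hV hA))
    · intro p hp
      obtain ⟨L, r, K, φ, hr, hφ, hgraph⟩ := hΩ.graph p hp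
      have hep : IsEpigraphNear Ω p L r φ := hgraph
      have hφp : L p 1 = φ (L p 0) :=
        (hep.mem_frontier_iff hΩ.isOpen hφ.continuous (Metric.mem_ball_self hr)).1 hp
      set ρ := r / (2 * (1 + K)) with hρ
      have hK : (0 : ℝ) ≤ K := K.2
      have hρ0 : 0 < ρ := by positivity
      have hρK : ρ * (1 + K) = r / 2 := by rw [hρ]; field_simp
      have hρr : ρ ≤ r := by nlinarith
      set I : Set ℝ := Set.Ioo (L p 0 - ρ) (L p 0 + ρ) with hI
      have hnear : ∀ s ∈ I, ∀ t ∈ Set.Ioo (φ s) (φ s + r / 2), pt L s t ∈ Ω := by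
        intro s hs t ht
        have hb : pt L s t ∈ Metric.ball p r := by
          rw [Metric.mem_ball, ← pt_coord L p]
          have h1 : |s - L p 0| < ρ := by rw [abs_lt]; constructor <;> linarith [hs.1, hs.2]
          have h2 : |φ s - φ (L p 0)| ≤ K * |s - L p 0| := by
            simpa [Real.dist_eq] using hφ.dist_le_mul s (L p 0)
          have h3 : |t - L p 1| ≤ |t - φ s| + |φ s - φ (L p 0)| := by
            rw [hφp]; exact abs_sub_le _ _ _
          have h4 : |t - φ s| < r / 2 := by rw [abs_lt]; constructor <;> linarith [ht.1, ht.2]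
          have h5 : (K : ℝ) * |s - L p 0| ≤ K * ρ := by gcongr
          calc _ ≤ _ := dist_pt_le L s t (L p 0) (L p 1)
            _ < r := by nlinarith
        rw [hep _ hb]
        simpa using ht.1
      have hr2 : ENNReal.ofReal (r / 2) ≠ 0 := by simpa using hr
      refine ⟨Metric.ball p ρ, mem_nhdsWithin_of_mem_nhds (Metric.ball_mem_nhds p hρ0),
        (1 + K) * ((r / 2).toNNReal⁻¹ + 1), fun V A hV hA => ?_⟩
      obtain ⟨q, hqm, hq, hae⟩ := hA.exists_reverse hV L
      have hVφ : Continuous fun s => V (pt L s (φ s)) :=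
        hV.comp ((continuous_pt L).comp (continuous_id.prodMk hφ.continuous))
      have hVm := hV.measurable
      have hgr : ENNReal.ofReal (r / 2) * ∫⁻ s in I, V (pt L s (φ s)) ≤
          (∫⁻ x in Ω, V x) + ENNReal.ofReal (r / 2) * A := by
        calc ENNReal.ofReal (r / 2) * ∫⁻ s in I, V (pt L s (φ s))
            = ∫⁻ s, ENNReal.ofReal (r / 2) * I.indicator (fun s => V (pt L s (φ s))) s := by
              rw [lintegral_const_mul' _ _ ENNReal.ofReal_ne_top,
                lintegral_indicator measurableSet_Ioo]
          _ ≤ ∫⁻ s, ((∫⁻ t, Ω.indicator V (pt L s t)) + ENNReal.ofReal (r / 2) * q s) := by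
              refine lintegral_mono_ae ?_
              filter_upwards [hae] with s hs
              by_cases hsI : s ∈ I
              · rw [Set.indicator_of_mem hsI]
                have hvol : volume (Set.Ioo (φ s) (φ s + r / 2)) = ENNReal.ofReal (r / 2) := by
                  rw [Real.volume_Ioo, add_sub_cancel_left]
                calc ENNReal.ofReal (r / 2) * V (pt L s (φ s))
                    = ∫⁻ t in Set.Ioo (φ s) (φ s + r / 2), V (pt L s (φ s)) := by
                      rw [setLIntegral_const, hvol, mul_comm]
                  _ ≤ ∫⁻ t in Set.Ioo (φ s) (φ s + r / 2), (Ω.indicator V (pt L s t) + q s) := by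
                      refine setLIntegral_mono' measurableSet_Ioo fun t ht => ?_
                      rw [Set.indicator_of_mem (hnear s hsI t ht)]
                      exact hs _ _ ht.1 fun t' ht' => hnear s hsI t' ⟨ht'.1, ht'.2.trans ht.2⟩
                  _ = (∫⁻ t in Set.Ioo (φ s) (φ s + r / 2), Ω.indicator V (pt L s t))
                      + ENNReal.ofReal (r / 2) * q s := by
                      rw [lintegral_add_right _ measurable_const, setLIntegral_const, hvol, mul_comm]
                  _ ≤ _ := add_le_add (setLIntegral_le_lintegral _ _) le_rfl
              · rw [Set.indicator_of_notMem hsI, mul_zero]; exact zero_le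
          _ = (∫⁻ x in Ω, V x) + ENNReal.ofReal (r / 2) * ∫⁻ s, q s := by
              rw [lintegral_add_right _ (hqm.const_mul _), lintegral_const_mul _ hqm,
                ← lintegral_pt L (hVm.indicator hΩ.isOpen.measurableSet),
                lintegral_indicator hΩ.isOpen.measurableSet]
          _ ≤ _ := by gcongr
      have hgr' : ∫⁻ s in I, V (pt L s (φ s)) ≤
          (ENNReal.ofReal (r / 2))⁻¹ * (∫⁻ x in Ω, V x) + A := by
        rw [← ENNReal.mul_le_mul_iff_right hr2 ENNReal.ofReal_ne_top, mul_add, ← mul_assoc,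
          ENNReal.mul_inv_cancel hr2 ENNReal.ofReal_ne_top, one_mul]
        exact hgr
      calc ∫⁻ x in Metric.ball p ρ ∩ frontier Ω, V x ∂μH[1]
          ≤ (1 + K) * ∫⁻ s in I, V (pt L s (φ s)) := by
            refine lintegral_le_lintegral_graph L hφ ?_ hVm
            rintro z ⟨hz, hz'⟩
            refine ⟨?_, (hep.mem_frontier_iff hΩ.isOpen hφ.continuous
              (Metric.ball_subset_ball hρr hz)).1 hz'⟩
            have := abs_lt.1 ((abs_coord_sub_le L 0 z p).trans_lt hz)
            exact ⟨by linarith [this.1], by linarith [this.2]⟩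
        _ ≤ (1 + K) * ((ENNReal.ofReal (r / 2))⁻¹ * (∫⁻ x in Ω, V x) + A) := by gcongr
        _ ≤ (1 + K) * (((ENNReal.ofReal (r / 2))⁻¹ + 1) * ((∫⁻ x in Ω, V x) + A)) := by
            gcongr
            rw [add_mul, mul_add, one_mul]
            refine add_le_add le_self_add le_add_self
        _ = _ := by
            rw [ENNReal.coe_mul, ENNReal.coe_add, ENNReal.coe_add,
              ENNReal.coe_inv (by simpa using hr), mul_assoc]
            rfl
  simpa using this

/-- One large closed ball serves as the only cell, so there are no jumps. The gradient of the square
is `2φ∇φ`, and Young's inequality separates the factors. -/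
lemma lineVariation_sq {Ω : Set E2} (hΩ : IsLipschitzDomain Ω) {φ : E2 → ℝ} (hφ : ContDiff ℝ ∞ φ) :
    LineVariation Ω (fun x => ‖φ x‖ₑ ^ 2)
      (2 * (∫⁻ x in Ω, ‖φ x‖ₑ ^ 2) + ∑ a, ∫⁻ x in Ω, ‖pd Set.univ a φ x‖ₑ ^ 2) := by
  obtain ⟨R, hR⟩ := hΩ.isBounded.closure.subset_ball (0 : E2)
  have hφ2 : ContDiff ℝ 1 fun x => φ x ^ 2 := (hφ.pow 2).of_le (by exact_mod_cast le_top)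
  have hφ1 : ContDiff ℝ 1 φ := hφ.of_le (by exact_mod_cast le_top)
  have hR0 : (Metric.ball (0 : E2) R).Nonempty := hΩ.isConnected.nonempty.mono
    (subset_closure.trans hR)
  set T : Fin 1 → Set E2 := fun _ => Metric.closedBall 0 R with hT
  have H : PiecewiseC1 Ω T fun _ x => φ x ^ 2 :=
    { isCompact := fun _ => isCompact_closedBall _ _
      cover := fun x hx => Set.mem_iUnion.2 ⟨0, Metric.ball_subset_closedBall (hR (subset_closure hx))⟩
      uniqueDiff := fun _ => uniqueDiffOn_convex (convex_closedBall _ _)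
        (hR0.mono (interior_maximal Metric.ball_subset_closedBall Metric.isOpen_ball))
      contDiffOn := fun _ => hφ2.contDiffOn
      inter := fun i j hij => absurd hij (by simp [Subsingleton.elim i j]) }
  have hpdm : ∀ a, Measurable fun x => pd Set.univ a φ x := fun a => by
    simp only [pd, fderivWithin_univ]
    exact ((hφ1.continuous_fderiv one_ne_zero).clm_apply continuous_const).measurable
  refine ((H.lineVariation hΩ.isOpen).congr fun x hx => ?_).mono ?_
  · rw [cellSup, iSup_unique, Set.indicator_of_mem (Metric.ball_subset_closedBall (hR hx)),
      ← enorm_pow, Real.enorm_of_nonneg (sq_nonneg _)]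
  · rw [totalVar]
    simp only [Finset.univ_unique, Finset.sum_singleton, lt_self_iff_false, if_false, add_zero]
    rw [← lintegral_const_mul _ (hφ.continuous.measurable.enorm.pow_const 2),
      ← lintegral_finsetSum _ fun a _ => (hpdm a).enorm.pow_const 2,
      ← lintegral_add_left ((hφ.continuous.measurable.enorm.pow_const 2).const_mul 2)]
    refine setLIntegral_mono' hΩ.isOpen.measurableSet fun x hx => ?_
    have hxT : x ∈ Metric.ball (0 : E2) R := hR (subset_closure hx)
    have hd : fderivWithin ℝ (fun x => φ x ^ 2) (Metric.closedBall 0 R) x =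
        (2 * φ x) • fderiv ℝ φ x := by
      rw [fderivWithin_of_mem_nhds (mem_of_superset (Metric.isOpen_ball.mem_nhds hxT)
        Metric.ball_subset_closedBall)]
      have := ((hφ1.differentiable one_ne_zero x).hasFDerivAt.pow 2).fderiv
      simpa using this
    simp only [cellGrad, Finset.univ_unique, Finset.sum_singleton]
    rw [Set.indicator_of_mem (Metric.ball_subset_closedBall hxT), hd, ← ofReal_norm]
    simp only [← enorm_pow, Real.enorm_of_nonneg (sq_nonneg _)]
    have h2 : 2 * ENNReal.ofReal (φ x ^ 2) = ENNReal.ofReal (2 * φ x ^ 2) := by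
      rw [ENNReal.ofReal_mul zero_le_two, ENNReal.ofReal_ofNat]
    rw [← ENNReal.ofReal_sum_of_nonneg fun _ _ => sq_nonneg _,
      h2, ← ENNReal.ofReal_add (by positivity) (by positivity)]
    refine ENNReal.ofReal_le_ofReal ?_
    rw [norm_smul, norm_mul, Real.norm_ofNat, Real.norm_eq_abs]
    have h1 := norm_le_sum_apply_single (fderiv ℝ φ x)
    have h2 : 2 * |φ x| * ‖fderiv ℝ φ x‖ ≤
        2 * |φ x| * ∑ a, |fderiv ℝ φ x (EuclideanSpace.single a 1)| := by gcongr
    refine h2.trans ?_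
    simp only [pd, fderivWithin_univ, Fin.sum_univ_two]
    nlinarith [sq_nonneg (|φ x| - |fderiv ℝ φ x (EuclideanSpace.single 0 1)|),
      sq_nonneg (|φ x| - |fderiv ℝ φ x (EuclideanSpace.single 1 1)|), sq_abs (φ x),
      sq_abs (fderiv ℝ φ x (EuclideanSpace.single 0 1)),
      sq_abs (fderiv ℝ φ x (EuclideanSpace.single 1 1))]

/-- The bound holds for the smooth approximants by `lineVariation_sq` and passes to the limit,
because they converge to `u` in `H¹(Ω)` and to the trace in `L²(Γ)`. -/
theorem exists_eLpNorm_trace_le {Ω : Set E2} (hΩ : IsLipschitzDomain Ω) :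
    ∃ C : ℝ≥0, ∀ Γ ⊆ frontier Ω, ∀ (u : E2 → ℝ) (Du : Fin 2 → E2 → ℝ) (t : E2 → ℝ),
      IsH1 Ω u Du → IsTrace Ω Γ u Du t →
        eLpNorm t 2 (μH[1].restrict Γ) ≤
          C * (eLpNorm u 2 (volume.restrict Ω) + ∑ a, eLpNorm (Du a) 2 (volume.restrict Ω)) := by
  obtain ⟨C, hC⟩ := exists_lintegral_frontier_le hΩ
  -- Taking roots of a bound with factor `3 * C` would produce a square root; `3 * C ≤ (3 * C + 1) ^
  -- 2` avoids it.
  refine ⟨3 * C + 1, fun Γ hΓ u Du t hu ⟨ht, φ, hφ, h0, h1, h2⟩ => ?_⟩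
  set ν : Measure E2 := μH[1].restrict Γ
  set μ : Measure E2 := volume.restrict Ω
  have hpdm : ∀ m a, AEStronglyMeasurable (fun x => pd Set.univ a (φ m) x) μ := fun m a => by
    simp only [pd, fderivWithin_univ]
    exact ((((hφ m).continuous_fderiv (by simp)).clm_apply continuous_const)).aestronglyMeasurable
  have hsmooth : ∀ m, eLpNorm (φ m) 2 ν ≤ (3 * C + 1 : ℝ≥0) *
      (eLpNorm (φ m) 2 μ + ∑ a, eLpNorm (fun x => pd Set.univ a (φ m) x) 2 μ) := by
    intro m
    have h := hC _ _ ((ENNReal.continuous_pow 2).comp (hφ m).continuous.enorm) (lineVariation_sq hΩ (hφ m))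
    have h' := (lintegral_mono_set hΓ).trans h
    simp only [Function.comp_apply, ← eLpNorm_two_sq] at h'
    rw [← ENNReal.pow_le_pow_left_iff two_ne_zero]
    refine h'.trans ?_
    simp only [Fin.sum_univ_two]
    set x := eLpNorm (φ m) 2 μ
    set y := eLpNorm (fun x => pd Set.univ 0 (φ m) x) 2 μ
    set z := eLpNorm (fun x => pd Set.univ 1 (φ m) x) 2 μ
    rw [ENNReal.coe_add, ENNReal.coe_mul, ENNReal.coe_one, ENNReal.coe_ofNat]
    calc (C : ℝ≥0∞) * (x ^ 2 + (2 * x ^ 2 + (y ^ 2 + z ^ 2)))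
        ≤ C * (x ^ 2 + (2 * x ^ 2 + (y ^ 2 + z ^ 2))) + (9 * C ^ 2 * (x + y + z) ^ 2
          + 3 * C * (x + y + z) ^ 2 + (x + y + z) ^ 2 +
            2 * C * y ^ 2 + 2 * C * z ^ 2 + 6 * C * (x * y + y * z + z * x)) := le_self_add
      _ = _ := by ring
  have hconv : Tendsto (fun m => eLpNorm (fun x => φ m x - t x) 2 ν + (3 * C + 1 : ℝ≥0) *
      ((eLpNorm (fun x => φ m x - u x) 2 μ + eLpNorm u 2 μ) +
        ∑ a, (eLpNorm (fun x => pd Set.univ a (φ m) x - Du a x) 2 μ + eLpNorm (Du a) 2 μ))) atTop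
      (𝓝 (0 + (3 * C + 1 : ℝ≥0) * ((0 + eLpNorm u 2 μ) + ∑ a, (0 + eLpNorm (Du a) 2 μ)))) := by
    refine h2.add (ENNReal.Tendsto.const_mul ((h0.add tendsto_const_nhds).add
      (tendsto_finsetSum _ fun a _ => (h1 a).add tendsto_const_nhds)) (Or.inr ENNReal.coe_ne_top))
  simp only [zero_add] at hconv
  refine ge_of_tendsto' hconv fun m => ?_
  have hφm : ∀ μ : Measure E2, AEStronglyMeasurable (φ m) μ := fun μ =>
    (hφ m).continuous.aestronglyMeasurable
  have htri : ∀ (μ : Measure E2) (f g : E2 → ℝ), AEStronglyMeasurable f μ →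
      AEStronglyMeasurable g μ →
      eLpNorm f 2 μ ≤ eLpNorm (fun x => f x - g x) 2 μ + eLpNorm g 2 μ := by
    intro μ f g hf hg
    have := eLpNorm_add_le (p := 2) (hf.sub hg) hg one_le_two
    rwa [sub_add_cancel] at this
  calc eLpNorm t 2 ν ≤ eLpNorm (fun x => t x - φ m x) 2 ν + eLpNorm (φ m) 2 ν :=
        htri ν t (φ m) ht.1 (hφm ν)
    _ = eLpNorm (fun x => φ m x - t x) 2 ν + eLpNorm (φ m) 2 ν := by
        rw [← eLpNorm_neg]
        congr 2
        ext x; simp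
    _ ≤ _ := by
        refine add_le_add le_rfl ((hsmooth m).trans ?_)
        gcongr with a
        · exact htri μ _ _ (hφm μ) hu.memLp.1
        · exact htri μ _ _ (hpdm m a) (hu.memLp_grad a).1

theorem exists_integral_trace_sq_le {Ω : Set E2} (hΩ : IsLipschitzDomain Ω) :
    ∃ C : ℝ, 0 ≤ C ∧ ∀ Γ ⊆ frontier Ω, ∀ (u : E2 → ℝ) (Du : Fin 2 → E2 → ℝ) (t : E2 → ℝ),
      IsH1 Ω u Du → IsTrace Ω Γ u Du t →
        ∫ x in Γ, t x ^ 2 ∂μH[1] ≤ C * h1NormSq Ω u Du := by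
  obtain ⟨C, hC⟩ := exists_eLpNorm_trace_le hΩ
  refine ⟨3 * C ^ 2, by positivity, fun Γ hΓ u Du t hu ht => ?_⟩
  have hsq : ∀ {μ : Measure E2} {f : E2 → ℝ}, MemLp f 2 μ →
      ∫ x, f x ^ 2 ∂μ = (eLpNorm f 2 μ).toReal ^ 2 := by
    intro μ f hf
    rw [← ENNReal.toReal_pow, eLpNorm_two_sq, ← ofReal_integral_sq hf,
      ENNReal.toReal_ofReal (integral_nonneg fun _ => sq_nonneg _)]
  have h := ENNReal.toReal_mono (ENNReal.mul_ne_top ENNReal.coe_ne_top (ENNReal.add_ne_top.2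
    ⟨hu.memLp.2.ne, (ENNReal.sum_lt_top.2 fun a _ => (hu.memLp_grad a).2).ne⟩))
    (hC Γ hΓ u Du t hu ht)
  rw [ENNReal.toReal_mul, ENNReal.toReal_add hu.memLp.2.ne
    (ENNReal.sum_lt_top.2 fun a _ => (hu.memLp_grad a).2).ne,
    ENNReal.toReal_sum fun a _ => (hu.memLp_grad a).2.ne] at h
  rw [hsq ht.1, h1NormSq, hsq hu.memLp]
  simp only [hsq (hu.memLp_grad _), Fin.sum_univ_two] at h ⊢
  refine (pow_le_pow_left₀ ENNReal.toReal_nonneg h 2).trans ?_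
  rw [mul_pow, ENNReal.coe_toReal]
  set x := (eLpNorm u 2 (volume.restrict Ω)).toReal
  set y := (eLpNorm (Du 0) 2 (volume.restrict Ω)).toReal
  set z := (eLpNorm (Du 1) 2 (volume.restrict Ω)).toReal
  have h1 : (x + (y + z)) ^ 2 ≤ 3 * (x ^ 2 + (y ^ 2 + z ^ 2)) := by
    nlinarith [sq_nonneg (x - y), sq_nonneg (x - z), sq_nonneg (y - z)]
  have h2 : (C : ℝ) ^ 2 * (x + (y + z)) ^ 2 ≤ C ^ 2 * (3 * (x ^ 2 + (y ^ 2 + z ^ 2))) := by gcongr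
  linarith

/-! ### Polynomials in two variables -/

/-- Evaluation of a polynomial at a point of the plane. -/
noncomputable def ev (p : MvPolynomial (Fin 2) ℝ) (x : E2) : ℝ := MvPolynomial.eval (fun b => x b) p

@[simp] lemma ev_add (p q : MvPolynomial (Fin 2) ℝ) (x : E2) : ev (p + q) x = ev p x + ev q x := by
  simp [ev]

@[simp] lemma ev_sub (p q : MvPolynomial (Fin 2) ℝ) (x : E2) : ev (p - q) x = ev p x - ev q x := by
  simp [ev]

@[simp] lemma ev_neg (p : MvPolynomial (Fin 2) ℝ) (x : E2) : ev (-p) x = -ev p x := by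
  simp [ev]

@[simp] lemma ev_mul (p q : MvPolynomial (Fin 2) ℝ) (x : E2) : ev (p * q) x = ev p x * ev q x := by
  simp [ev]

@[simp] lemma ev_C (c : ℝ) (x : E2) : ev (MvPolynomial.C c) x = c := by simp [ev]

@[simp] lemma ev_one (x : E2) : ev 1 x = 1 := by simp [ev]

@[simp] lemma ev_zero (x : E2) : ev 0 x = 0 := by simp [ev]

@[simp] lemma ev_X (a : Fin 2) (x : E2) : ev (MvPolynomial.X a) x = x a := by simp [ev]

@[simp] lemma ev_smul (c : ℝ) (p : MvPolynomial (Fin 2) ℝ) (x : E2) : ev (c • p) x = c * ev p x := by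
  simp [ev]

lemma contDiff_ev (p : MvPolynomial (Fin 2) ℝ) : ContDiff ℝ ∞ (ev p) := by
  induction p using MvPolynomial.induction_on with
  | C c =>
    have : ev (MvPolynomial.C c) = fun _ => c := by ext x; simp
    rw [this]; exact contDiff_const
  | add p q hp hq =>
    have : ev (p + q) = fun x => ev p x + ev q x := by ext x; simp
    rw [this]; exact hp.add hq
  | mul_X p a hp =>
    have : ev (p * MvPolynomial.X a) = fun x => ev p x * x a := by ext x; simp
    rw [this]
    exact hp.mul (EuclideanSpace.proj a : E2 →L[ℝ] ℝ).contDiff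

lemma hasFDerivAt_ev (p : MvPolynomial (Fin 2) ℝ) (x : E2) : HasFDerivAt (ev p)
    (∑ b, ev (MvPolynomial.pderiv b p) x • (EuclideanSpace.proj b : E2 →L[ℝ] ℝ)) x := by
  induction p using MvPolynomial.induction_on with
  | C c =>
    have : ev (MvPolynomial.C c) = fun _ => c := by ext x; simp
    rw [this]
    exact (hasFDerivAt_const c x).congr_fderiv (by simp [ev])
  | add p q hp hq =>
    have : ev (p + q) = fun x => ev p x + ev q x := by ext x; simp
    rw [this]
    exact (hp.add hq).congr_fderiv (by ext v; simp; ring)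
  | mul_X p a hp =>
    have : ev (p * MvPolynomial.X a) = fun x => ev p x * x a := by ext x; simp
    rw [this]
    refine (hp.mul ((EuclideanSpace.proj a : E2 →L[ℝ] ℝ).hasFDerivAt (x := x))).congr_fderiv ?_
    ext v
    fin_cases a <;> simp [Derivation.leibniz, MvPolynomial.pderiv_X, Fin.sum_univ_two] <;> ring

lemma fderiv_ev_apply (p : MvPolynomial (Fin 2) ℝ) (x v : E2) :
    fderiv ℝ (ev p) x v = ∑ b, ev (MvPolynomial.pderiv b p) x * v b := by
  rw [(hasFDerivAt_ev p x).fderiv]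
  simp

lemma totalDegree_pderiv_le (b : Fin 2) (p : MvPolynomial (Fin 2) ℝ) :
    (MvPolynomial.pderiv b p).totalDegree ≤ p.totalDegree := by
  classical
  conv_lhs => rw [← MvPolynomial.support_sum_monomial_coeff p, map_sum]
  refine MvPolynomial.totalDegree_finsetSum_le fun m hm => ?_
  rw [MvPolynomial.pderiv_monomial]
  refine (MvPolynomial.totalDegree_monomial_le _ _).trans ?_
  refine le_trans ?_ (MvPolynomial.le_totalDegree hm)
  rw [Finsupp.sum_fintype _ _ (fun _ => rfl), Finsupp.sum_fintype _ _ (fun _ => rfl)]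
  exact Finset.sum_le_sum fun i _ => Nat.sub_le _ _

/-- An open set contains a product of two intervals, and a polynomial that vanishes on a product of
infinite sets is zero. -/
lemma eq_zero_of_ev_eq_zero {p : MvPolynomial (Fin 2) ℝ} {U : Set E2} (hU : IsOpen U)
    (hne : U.Nonempty) (h : ∀ x ∈ U, ev p x = 0) : p = 0 := by
  obtain ⟨x, hx⟩ := hne
  have hcont : Continuous fun y : Fin 2 → ℝ => (WithLp.toLp 2 y : E2) := PiLp.continuous_toLp 2 _
  have hU' : IsOpen ((fun y : Fin 2 → ℝ => (WithLp.toLp 2 y : E2)) ⁻¹' U) := hU.preimage hcont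
  obtain ⟨ε, hε, hball⟩ := Metric.isOpen_iff.1 hU' (fun i => x i) (by simpa using hx)
  refine MvPolynomial.funext_set (fun i => Metric.ball (x i) ε) (fun i => ?_) fun y hy => ?_
  · rw [Real.ball_eq_Ioo]
    exact Set.Ioo_infinite (by linarith)
  · rw [map_zero]
    refine h _ (hball ?_)
    rw [ball_pi _ hε]
    exact hy

/-- A linear map is bounded by any injective linear map on a finite-dimensional space. -/
lemma exists_norm_le_of_injective {V X Y : Type*} [AddCommGroup V] [Module ℝ V]
    [FiniteDimensional ℝ V] [NormedAddCommGroup X] [NormedSpace ℝ X] [NormedAddCommGroup Y]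
    [NormedSpace ℝ Y] (f : V →ₗ[ℝ] X) (g : V →ₗ[ℝ] Y) (hg : Function.Injective g) :
    ∃ C : ℝ, 0 ≤ C ∧ ∀ v, ‖f v‖ ≤ C * ‖g v‖ := by
  set e := LinearEquiv.ofInjective g hg
  set A : g.range →L[ℝ] X := LinearMap.toContinuousLinearMap (f ∘ₗ e.symm.toLinearMap)
  refine ⟨‖A‖, A.opNorm_nonneg, fun v => ?_⟩
  have := A.le_opNorm (e v)
  have he : ‖e v‖ = ‖g v‖ := rfl
  rw [he] at this
  simpa [A] using this

/-! ### Reference elements -/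

lemma isCompact_refElement (s : RefShape) : IsCompact (refElement s) := by
  refine Metric.isCompact_of_isClosed_isBounded ?_ ?_
  · have h0 : Continuous fun x : E2 => x 0 := (EuclideanSpace.proj 0 : E2 →L[ℝ] ℝ).continuous
    have h1 : Continuous fun x : E2 => x 1 := (EuclideanSpace.proj 1 : E2 →L[ℝ] ℝ).continuous
    cases s
    · exact (isClosed_le continuous_const h0).inter ((isClosed_le continuous_const h1).inter
        (isClosed_le (h0.add h1) continuous_const))
    · exact (isClosed_le continuous_const h0).inter ((isClosed_le h0 continuous_const).inter
        ((isClosed_le continuous_const h1).inter (isClosed_le h1 continuous_const)))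
  · refine (Metric.isBounded_closedBall (x := (0 : E2)) (r := 2)).subset fun x hx => ?_
    rw [mem_closedBall_zero_iff, EuclideanSpace.norm_eq, Real.sqrt_le_left zero_le_two]
    simp only [Real.norm_eq_abs, sq_abs, Fin.sum_univ_two]
    cases s
    · obtain ⟨h0, h1, h2⟩ := hx; nlinarith
    · obtain ⟨h0, h1, h2, h3⟩ := hx; nlinarith

lemma convex_refElement (s : RefShape) : Convex ℝ (refElement s) := by
  intro x hx y hy a b ha hb hab
  cases s
  · obtain ⟨h0, h1, h2⟩ := hx
    obtain ⟨h0', h1', h2'⟩ := hy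
    refine ⟨?_, ?_, ?_⟩ <;> simp only [PiLp.add_apply, PiLp.smul_apply, smul_eq_mul]
    · positivity
    · positivity
    · nlinarith
  · obtain ⟨h0, h1, h2, h3⟩ := hx
    obtain ⟨h0', h1', h2', h3'⟩ := hy
    refine ⟨?_, ?_, ?_, ?_⟩ <;> simp only [PiLp.add_apply, PiLp.smul_apply, smul_eq_mul]
    · positivity
    · nlinarith
    · positivity
    · nlinarith

/-- The strict inequalities that describe the interior of the reference element. -/
lemma mem_interior_refElement (s : RefShape) {x : E2} (h0 : 0 < x 0) (h1 : 0 < x 1)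
    (h : match s with
      | .triangle => x 0 + x 1 < 1
      | .square => x 0 < 1 ∧ x 1 < 1) : x ∈ interior (refElement s) := by
  have c0 : Continuous fun x : E2 => x 0 := (EuclideanSpace.proj 0 : E2 →L[ℝ] ℝ).continuous
  have c1 : Continuous fun x : E2 => x 1 := (EuclideanSpace.proj 1 : E2 →L[ℝ] ℝ).continuous
  cases s
  · refine mem_interior.2 ⟨{x | 0 < x 0} ∩ ({x | 0 < x 1} ∩ {x | x 0 + x 1 < 1}), ?_, ?_, h0, h1, h⟩
    · rintro y ⟨h0, h1, h2⟩
      exact ⟨le_of_lt h0, le_of_lt h1, le_of_lt h2⟩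
    · exact (isOpen_lt continuous_const c0).inter ((isOpen_lt continuous_const c1).inter
        (isOpen_lt (c0.add c1) continuous_const))
  · refine mem_interior.2 ⟨{x | 0 < x 0} ∩ ({x | 0 < x 1} ∩ ({x | x 0 < 1} ∩ {x | x 1 < 1})), ?_, ?_,
      h0, h1, h.1, h.2⟩
    · rintro y ⟨h0, h1, h2, h3⟩
      exact ⟨le_of_lt h0, le_of_lt h2, le_of_lt h1, le_of_lt h3⟩
    · exact (isOpen_lt continuous_const c0).inter ((isOpen_lt continuous_const c1).inter
        ((isOpen_lt c0 continuous_const).inter (isOpen_lt c1 continuous_const)))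

lemma nonempty_interior_refElement (s : RefShape) : (interior (refElement s)).Nonempty := by
  refine ⟨!₂[1 / 4, 1 / 4], mem_interior_refElement s (by simp) (by simp) ?_⟩
  cases s <;> norm_num

/-- Boundary of the reference element. -/
def refBoundary (s : RefShape) : Set E2 := refElement s \ interior (refElement s)

lemma mem_segment_coord {a b x : E2} (t : ℝ) (h0 : 0 ≤ t) (h1 : t ≤ 1)
    (hx : ∀ i, x i = (1 - t) * a i + t * b i) : x ∈ segment ℝ a b := by
  refine ⟨1 - t, t, by linarith, h0, by ring, ?_⟩
  ext i
  simp [hx i]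

/-- Five segments contain the boundaries of both the triangle and the square. -/
lemma hausdorffMeasure_refBoundary_lt_top (s : RefShape) : μH[1] (refBoundary s) < ⊤ := by
  have hseg : ∀ a b : E2, μH[1] (segment ℝ a b) < ⊤ := fun a b => by
    rw [hausdorffMeasure_segment]; exact edist_lt_top _ _
  set S : Set E2 := ((segment ℝ !₂[0, 0] !₂[1, 0] ∪ segment ℝ !₂[0, 0] !₂[0, 1]) ∪
    (segment ℝ !₂[1, 0] !₂[0, 1] ∪ (segment ℝ !₂[1, 0] !₂[1, 1] ∪ segment ℝ !₂[0, 1] !₂[1, 1])))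
  suffices refBoundary s ⊆ S from (measure_mono this).trans_lt (measure_union_lt_top
    (measure_union_lt_top (hseg _ _) (hseg _ _)) (measure_union_lt_top (hseg _ _)
      (measure_union_lt_top (hseg _ _) (hseg _ _))))
  rintro x ⟨hx, hxi⟩
  have hx0 : 0 ≤ x 0 := by cases s <;> exact hx.1
  have hx1 : 0 ≤ x 1 := by
    cases s
    · exact hx.2.1
    · exact hx.2.2.1
  have hx0' : x 0 ≤ 1 := by
    cases s
    · linarith [hx.2.2]
    · exact hx.2.1
  have hx1' : x 1 ≤ 1 := by
    cases s
    · linarith [hx.2.2]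
    · exact hx.2.2.2
  rcases hx0.eq_or_lt with h | h0
  · refine Or.inl (Or.inr (mem_segment_coord (x 1) hx1 hx1' fun i => ?_))
    fin_cases i <;> simp [← h]
  rcases hx1.eq_or_lt with h | h1
  · refine Or.inl (Or.inl (mem_segment_coord (x 0) hx0 hx0' fun i => ?_))
    fin_cases i <;> simp [← h]
  refine Or.inr ?_
  cases s
  · rcases hx.2.2.eq_or_lt with h | h
    · refine Or.inl (mem_segment_coord (x 1) hx1 hx1' fun i => ?_)
      fin_cases i
      · simp; linarith
      · simp
    · exact absurd (mem_interior_refElement .triangle h0 h1 h) hxi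
  · rcases hx0'.eq_or_lt with h | h0'
    · refine Or.inr (Or.inl (mem_segment_coord (x 1) hx1 hx1' fun i => ?_))
      fin_cases i
      · simp [h]
      · simp
    rcases hx1'.eq_or_lt with h | h1'
    · refine Or.inr (Or.inr (mem_segment_coord (x 0) hx0 hx0' fun i => ?_))
      fin_cases i
      · simp
      · simp [h]
    · exact absurd (mem_interior_refElement .square h0 h1 ⟨h0', h1'⟩) hxi

lemma volume_refBoundary (s : RefShape) : volume (refBoundary s) = 0 := by
  refine measure_mono_null ?_ ((convex_refElement s).addHaar_frontier volume)
  exact Set.sdiff_subset_sdiff_left subset_closure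

/-- Degree `k` in each of two variables gives total degree at most `2 * k`; hence bounds on total
degree serve both shapes from here on. -/
lemma totalDegree_le_of_mem_refPoly {s : RefShape} {k : ℕ} {p : MvPolynomial (Fin 2) ℝ}
    (hp : p ∈ refPoly k s) : p.totalDegree ≤ 2 * k := by
  cases s
  · exact ((MvPolynomial.mem_restrictTotalDegree _ _ _).1 hp).trans (by omega)
  · refine Finset.sup_le fun m hm => ?_
    have := (MvPolynomial.mem_restrictDegree _ _ _).1 hp m hm
    rw [Finsupp.sum_fintype _ _ (by simp), Fin.sum_univ_two]
    have h0 := this 0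
    have h1 := this 1
    omega

lemma isFiniteMeasure_restrict_interior (s : RefShape) :
    IsFiniteMeasure (volume.restrict (interior (refElement s)) : Measure E2) :=
  ⟨by
    rw [Measure.restrict_apply_univ]
    exact (measure_mono interior_subset).trans_lt (isCompact_refElement s).measure_lt_top⟩

lemma memLp_ev (s : RefShape) (p : MvPolynomial (Fin 2) ℝ) :
    MemLp (ev p) 2 (volume.restrict (interior (refElement s))) := by
  have := isFiniteMeasure_restrict_interior s
  obtain ⟨B, hB⟩ := (isCompact_refElement s).exists_bound_of_continuousOn
    (contDiff_ev p).continuous.continuousOn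
  refine MemLp.of_bound (contDiff_ev p).continuous.aestronglyMeasurable B ?_
  refine (ae_restrict_iff' isOpen_interior.measurableSet).2 (Eventually.of_forall fun x hx => ?_)
  exact hB x (interior_subset hx)

/-- Polynomials of bounded degree as continuous functions on the reference element. -/
noncomputable def refContinuous (s : RefShape) (D : ℕ) :
    MvPolynomial.restrictTotalDegree (Fin 2) ℝ D →ₗ[ℝ] C(refElement s, ℝ) where
  toFun p := ⟨fun x => ev p x, (contDiff_ev _).continuous.comp continuous_subtype_val⟩
  map_add' p q := by ext x; simp
  map_smul' c p := by ext x; simp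

/-- Polynomials of bounded degree as square integrable functions on the reference element. -/
noncomputable def refLp (s : RefShape) (D : ℕ) :
    MvPolynomial.restrictTotalDegree (Fin 2) ℝ D →ₗ[ℝ]
      Lp ℝ 2 (volume.restrict (interior (refElement s)) : Measure E2) where
  toFun p := (memLp_ev s p).toLp
  map_add' p q := by
    rw [← MemLp.toLp_add]
    congr 1; ext x; simp
  map_smul' c p := by
    simp only [RingHom.id_apply]
    rw [← MemLp.toLp_const_smul]
    congr 1; ext x; simp

/-- Equivalence of norms on the finite-dimensional space of polynomials: a polynomial that vanishes
almost everywhere on the interior is zero, so the embedding into `L²` is injective. -/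
lemma exists_sq_le_integral (s : RefShape) (D : ℕ) : ∃ C : ℝ, 0 ≤ C ∧
    ∀ q : MvPolynomial (Fin 2) ℝ, q.totalDegree ≤ D → ∀ x ∈ refElement s,
      ev q x ^ 2 ≤ C * ∫ z in interior (refElement s), ev q z ^ 2 := by
  have : CompactSpace (refElement s) := isCompact_iff_compactSpace.1 (isCompact_refElement s)
  obtain ⟨C, hC, h⟩ := exists_norm_le_of_injective (refContinuous s D) (refLp s D) (by
    rw [← LinearMap.ker_eq_bot, LinearMap.ker_eq_bot']
    intro p hp
    have h1 : ev p =ᵐ[volume.restrict (interior (refElement s))] fun _ => 0 := by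
      have := (MemLp.toLp_eq_toLp_iff (memLp_ev s p) (MemLp.zero (ε := ℝ))).1
        (hp.trans (MemLp.toLp_zero _).symm)
      exact this
    have h2 := Measure.eqOn_open_of_ae_eq h1 isOpen_interior
      (contDiff_ev p).continuous.continuousOn continuousOn_const
    exact Subtype.ext (eq_zero_of_ev_eq_zero isOpen_interior (nonempty_interior_refElement s)
      fun x hx => h2 hx))
  refine ⟨C ^ 2, sq_nonneg _, fun q hq x hx => ?_⟩
  have h1 := h ⟨q, (MvPolynomial.mem_restrictTotalDegree _ _ _).2 hq⟩
  have h2 := ContinuousMap.norm_coe_le_norm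
    (refContinuous s D ⟨q, (MvPolynomial.mem_restrictTotalDegree _ _ _).2 hq⟩) ⟨x, hx⟩
  have h3 : |ev q x| ≤ C * ‖(memLp_ev s q).toLp‖ := h2.trans h1
  rw [Lp.norm_toLp] at h3
  have h4 : ∫ z in interior (refElement s), ev q z ^ 2 =
      (eLpNorm (ev q) 2 (volume.restrict (interior (refElement s)))).toReal ^ 2 := by
    rw [← ENNReal.toReal_pow, eLpNorm_two_sq, ← ofReal_integral_sq (memLp_ev s q),
      ENNReal.toReal_ofReal (integral_nonneg fun _ => sq_nonneg _)]
  rw [h4, ← mul_pow, ← sq_abs]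
  exact pow_le_pow_left₀ (abs_nonneg _) h3 2

/-- Differentiation is linear on a finite-dimensional space, hence bounded for the maximum norm on
the reference element. -/
lemma exists_abs_pderiv_le (s : RefShape) (D : ℕ) : ∃ C : ℝ, 0 ≤ C ∧
    ∀ (q : MvPolynomial (Fin 2) ℝ) (B : ℝ), q.totalDegree ≤ D →
      (∀ x ∈ refElement s, |ev q x| ≤ B) → ∀ b, ∀ x ∈ refElement s,
        |ev (MvPolynomial.pderiv b q) x| ≤ C * B := by
  have : CompactSpace (refElement s) := isCompact_iff_compactSpace.1 (isCompact_refElement s)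
  have hinj : Function.Injective (refContinuous s D) := by
    rw [← LinearMap.ker_eq_bot, LinearMap.ker_eq_bot']
    intro p hp
    refine Subtype.ext (eq_zero_of_ev_eq_zero isOpen_interior (nonempty_interior_refElement s)
      fun x hx => ?_)
    exact DFunLike.congr_fun hp ⟨x, interior_subset hx⟩
  have hder : ∀ b : Fin 2, ∃ f : MvPolynomial.restrictTotalDegree (Fin 2) ℝ D →ₗ[ℝ]
      C(refElement s, ℝ), ∀ p x, f p x = ev (MvPolynomial.pderiv b p.1) x := fun b =>
    ⟨{  toFun := fun p => ⟨fun x => ev (MvPolynomial.pderiv b p.1) x,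
          (contDiff_ev _).continuous.comp continuous_subtype_val⟩
        map_add' := fun p q => by ext x; simp
        map_smul' := fun c p => by ext x; simp }, fun p x => rfl⟩
  choose f hf using hder
  choose C hC h using fun b => exists_norm_le_of_injective (f b) (refContinuous s D) hinj
  refine ⟨∑ b, C b, Finset.sum_nonneg fun b _ => hC b, fun q B hq hB b x hx => ?_⟩
  have hB0 : 0 ≤ B := (abs_nonneg _).trans (hB x hx)
  set p : MvPolynomial.restrictTotalDegree (Fin 2) ℝ D :=
    ⟨q, (MvPolynomial.mem_restrictTotalDegree _ _ _).2 hq⟩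
  have h1 : ‖refContinuous s D p‖ ≤ B :=
    (ContinuousMap.norm_le _ hB0).2 fun x => hB x x.2
  have h2 := ContinuousMap.norm_coe_le_norm (f b p) ⟨x, hx⟩
  rw [hf] at h2
  calc |ev (MvPolynomial.pderiv b q) x| ≤ ‖f b p‖ := h2
    _ ≤ C b * B := (h b p).trans (mul_le_mul_of_nonneg_left h1 (hC b))
    _ ≤ (∑ b, C b) * B := mul_le_mul_of_nonneg_right
        (Finset.single_le_sum (fun b _ => hC b) (Finset.mem_univ b)) hB0

/-! ### A single isoparametric element -/

/-- The element map with components `P` is injective and shape regular, with size `h`. -/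
structure IsElement (s : RefShape) (k : ℕ) (σ : ℝ) (P : Fin 2 → MvPolynomial (Fin 2) ℝ) (h : ℝ) :
    Prop where
  mem : ∀ a, P a ∈ refPoly k s
  injOn : Set.InjOn (polyMap P) (refElement s)
  sigma_pos : 0 < σ
  size_pos : 0 < h
  upper : ∀ x ∈ refElement s, ∀ v : E2, ‖fderiv ℝ (polyMap P) x v‖ ≤ σ * h * ‖v‖
  lower : ∀ x ∈ refElement s, ∀ v : E2, h * ‖v‖ ≤ σ * ‖fderiv ℝ (polyMap P) x v‖

/-- Jacobian determinant of the map with components `P`. -/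
noncomputable def jac (P : Fin 2 → MvPolynomial (Fin 2) ℝ) : MvPolynomial (Fin 2) ℝ :=
  MvPolynomial.pderiv 0 (P 0) * MvPolynomial.pderiv 1 (P 1)
    - MvPolynomial.pderiv 1 (P 0) * MvPolynomial.pderiv 0 (P 1)

/-- `cofac P a` is mapped by the differential to the Jacobian times the `a`-th basis vector. -/
noncomputable def cofac (P : Fin 2 → MvPolynomial (Fin 2) ℝ) :
    Fin 2 → Fin 2 → MvPolynomial (Fin 2) ℝ :=
  ![![MvPolynomial.pderiv 1 (P 1), -MvPolynomial.pderiv 0 (P 1)],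
    ![-MvPolynomial.pderiv 1 (P 0), MvPolynomial.pderiv 0 (P 0)]]

/-- The vector `cofac P a` at the point `x`. -/
noncomputable def cofacVec (P : Fin 2 → MvPolynomial (Fin 2) ℝ) (a : Fin 2) (x : E2) : E2 :=
  WithLp.toLp 2 fun b => ev (cofac P a b) x

lemma contDiff_polyMap (P : Fin 2 → MvPolynomial (Fin 2) ℝ) : ContDiff ℝ ∞ (polyMap P) :=
  contDiff_euclidean.2 fun a => contDiff_ev (P a)

lemma hasFDerivAt_polyMap (P : Fin 2 → MvPolynomial (Fin 2) ℝ) (x : E2) :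
    HasFDerivAt (polyMap P) (fderiv ℝ (polyMap P) x) x :=
  ((contDiff_polyMap P).differentiable (by simp) x).hasFDerivAt

lemma fderiv_polyMap_apply (P : Fin 2 → MvPolynomial (Fin 2) ℝ) (x v : E2) (a : Fin 2) :
    fderiv ℝ (polyMap P) x v a = ∑ b, ev (MvPolynomial.pderiv b (P a)) x * v b := by
  have h1 : HasFDerivAt (fun y => polyMap P y a)
      ((EuclideanSpace.proj a : E2 →L[ℝ] ℝ) ∘L fderiv ℝ (polyMap P) x) x :=
    (EuclideanSpace.proj a : E2 →L[ℝ] ℝ).hasFDerivAt.comp x (hasFDerivAt_polyMap P x)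
  have h2 : HasFDerivAt (fun y => polyMap P y a) _ x := hasFDerivAt_ev (P a) x
  have := DFunLike.congr_fun (h1.unique h2) v
  simpa using this

lemma fderiv_polyMap_cofacVec (P : Fin 2 → MvPolynomial (Fin 2) ℝ) (x : E2) (a : Fin 2) :
    fderiv ℝ (polyMap P) x (cofacVec P a x) = ev (jac P) x • EuclideanSpace.single a 1 := by
  ext i
  rw [fderiv_polyMap_apply]
  fin_cases a <;> fin_cases i <;> simp [cofacVec, cofac, jac] <;> ring

lemma abs_det_fderiv_polyMap (P : Fin 2 → MvPolynomial (Fin 2) ℝ) (x : E2) :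
    (fderiv ℝ (polyMap P) x).det = ev (jac P) x := by
  rw [ContinuousLinearMap.det, ← LinearMap.det_toMatrix (EuclideanSpace.basisFun (Fin 2) ℝ).toBasis,
    Matrix.det_fin_two]
  simp [LinearMap.toMatrix_apply, fderiv_polyMap_apply, jac]

namespace IsElement

variable {s : RefShape} {k : ℕ} {σ : ℝ} {P : Fin 2 → MvPolynomial (Fin 2) ℝ} {h : ℝ}

lemma totalDegree_le (H : IsElement s k σ P h) (a b : Fin 2) :
    (MvPolynomial.pderiv b (P a)).totalDegree ≤ 2 * k :=
  (totalDegree_pderiv_le _ _).trans (totalDegree_le_of_mem_refPoly (H.mem a))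

lemma totalDegree_jac_le (H : IsElement s k σ P h) : (jac P).totalDegree ≤ 4 * k := by
  refine (MvPolynomial.totalDegree_sub _ _).trans (max_le ?_ ?_) <;>
    refine (MvPolynomial.totalDegree_mul _ _).trans ?_
  · have := H.totalDegree_le 0 0; have := H.totalDegree_le 1 1; omega
  · have := H.totalDegree_le 0 1; have := H.totalDegree_le 1 0; omega

lemma totalDegree_cofac_le (H : IsElement s k σ P h) (a b : Fin 2) :
    (cofac P a b).totalDegree ≤ 2 * k := by
  fin_cases a <;> fin_cases b <;> simp only [cofac] <;> simp [H.totalDegree_le]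

lemma abs_pderiv_le (H : IsElement s k σ P h) {x : E2} (hx : x ∈ refElement s) (a b : Fin 2) :
    |ev (MvPolynomial.pderiv b (P a)) x| ≤ σ * h := by
  have h1 := H.upper x hx (EuclideanSpace.single b 1)
  have h2 := PiLp.norm_apply_le (fderiv ℝ (polyMap P) x (EuclideanSpace.single b 1)) a
  rw [fderiv_polyMap_apply] at h2
  have h3 : ∑ b', ev (MvPolynomial.pderiv b' (P a)) x * (EuclideanSpace.single b (1 : ℝ) : E2) b' =
      ev (MvPolynomial.pderiv b (P a)) x := by
    fin_cases b <;> simp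
  rw [h3] at h2
  simp only [PiLp.norm_single, norm_one, mul_one] at h1
  exact h2.trans h1

lemma abs_jac_le (H : IsElement s k σ P h) {x : E2} (hx : x ∈ refElement s) :
    |ev (jac P) x| ≤ 2 * σ ^ 2 * h ^ 2 := by
  have hσ := mul_pos H.sigma_pos H.size_pos
  simp only [jac, ev_sub, ev_mul]
  refine (abs_sub _ _).trans ?_
  rw [abs_mul, abs_mul]
  have h1 := mul_le_mul (H.abs_pderiv_le hx 0 0) (H.abs_pderiv_le hx 1 1) (abs_nonneg _) hσ.le
  have h2 := mul_le_mul (H.abs_pderiv_le hx 0 1) (H.abs_pderiv_le hx 1 0) (abs_nonneg _) hσ.le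
  nlinarith

/-- The differential sends the cofactor vectors to the Jacobian `J` times unit vectors, so the lower
bound gives `h * ‖cofacVec P a x‖ ≤ σ * |J|`. The cofactors have the same entries as the
differential up to sign and order, and each column of the differential has length at least `h / σ`.
Summing squares yields `J ^ 2 ≥ h ^ 4 / σ ^ 4`. -/
lemma le_abs_jac (H : IsElement s k σ P h) {x : E2} (hx : x ∈ refElement s) :
    h ^ 2 / σ ^ 2 ≤ |ev (jac P) x| := by
  have hσ := H.sigma_pos
  have hh := H.size_pos
  set J := ev (jac P) x
  have hcof : ∀ a, h * ‖cofacVec P a x‖ ≤ σ * |J| := fun a => by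
    have := H.lower x hx (cofacVec P a x)
    rwa [fderiv_polyMap_cofacVec, norm_smul, PiLp.norm_single, norm_one, mul_one] at this
  have hcol : ∀ b : Fin 2, h ^ 2 ≤ σ ^ 2 * ∑ a, ev (MvPolynomial.pderiv b (P a)) x ^ 2 := fun b => by
    have h1 := H.lower x hx (EuclideanSpace.single b 1)
    rw [PiLp.norm_single, norm_one, mul_one, EuclideanSpace.norm_eq] at h1
    have h2 := pow_le_pow_left₀ hh.le h1 2
    rw [mul_pow, Real.sq_sqrt (Finset.sum_nonneg fun _ _ => sq_nonneg _)] at h2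
    have h3 : ∀ a, ev (MvPolynomial.pderiv b (P a)) x =
        fderiv ℝ (polyMap P) x (EuclideanSpace.single b 1) a := fun a => by
      rw [fderiv_polyMap_apply]
      fin_cases b <;> simp
    simpa only [h3, Real.norm_eq_abs, sq_abs] using h2
  have hsq : ∀ a, h ^ 2 * ‖cofacVec P a x‖ ^ 2 ≤ σ ^ 2 * |J| ^ 2 := fun a => by
    have := pow_le_pow_left₀ (by positivity) (hcof a) 2
    rwa [mul_pow, mul_pow] at this
  have e0 := hsq 0
  have e1 := hsq 1
  have f0 := hcol 0
  have f1 := hcol 1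
  rw [EuclideanSpace.norm_eq, Real.sq_sqrt (Finset.sum_nonneg fun _ _ => sq_nonneg _)] at e0 e1
  simp only [cofacVec, cofac, Fin.sum_univ_two, Matrix.cons_val_zero, Matrix.cons_val_one,
    Real.norm_eq_abs, sq_abs, ev_neg, neg_sq] at e0 e1 f0 f1
  rw [div_le_iff₀ (by positivity)]
  refine le_of_sq_le_sq ?_ (by positivity)
  rw [mul_pow, sq_abs]
  set p := ev (MvPolynomial.pderiv 0 (P 0)) x
  set q := ev (MvPolynomial.pderiv 0 (P 1)) x
  set r := ev (MvPolynomial.pderiv 1 (P 0)) x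
  set t := ev (MvPolynomial.pderiv 1 (P 1)) x
  have g1 : h ^ 2 * (p ^ 2 + q ^ 2 + r ^ 2 + t ^ 2) ≤ 2 * σ ^ 2 * J ^ 2 := by linarith
  have g2 : 2 * h ^ 2 ≤ σ ^ 2 * (p ^ 2 + q ^ 2 + r ^ 2 + t ^ 2) := by linarith
  have g3 : h ^ 2 * (2 * h ^ 2) ≤ h ^ 2 * (σ ^ 2 * (p ^ 2 + q ^ 2 + r ^ 2 + t ^ 2)) := by gcongr
  have g4 : σ ^ 2 * (h ^ 2 * (p ^ 2 + q ^ 2 + r ^ 2 + t ^ 2)) ≤ σ ^ 2 * (2 * σ ^ 2 * J ^ 2) := by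
    gcongr
  nlinarith

lemma jac_ne_zero (H : IsElement s k σ P h) {x : E2} (hx : x ∈ refElement s) : ev (jac P) x ≠ 0 := by
  have h1 := H.le_abs_jac hx
  have h2 : 0 < h ^ 2 / σ ^ 2 := by have := H.sigma_pos; have := H.size_pos; positivity
  exact abs_pos.1 (h2.trans_le h1)

lemma exists_equiv (H : IsElement s k σ P h) {x : E2} (hx : x ∈ refElement s) :
    ∃ A : E2 ≃L[ℝ] E2, (A : E2 →L[ℝ] E2) = fderiv ℝ (polyMap P) x := by
  have hinj : Function.Injective (fderiv ℝ (polyMap P) x) := by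
    refine (injective_iff_map_eq_zero _).2 fun v hv => ?_
    have := H.lower x hx v
    rw [hv, norm_zero, mul_zero] at this
    exact norm_le_zero_iff.1 (by nlinarith [H.size_pos, norm_nonneg v])
  exact ⟨(LinearEquiv.ofInjectiveEndo (fderiv ℝ (polyMap P) x : E2 →ₗ[ℝ] E2)
    hinj).toContinuousLinearEquiv, by ext v; rfl⟩

/-- Points of the element near `F x` are images of points near `x`. -/
lemma eventually_preimage_mem (H : IsElement s k σ P h) {x : E2} (hx : x ∈ refElement s)
    {U : Set E2} (hU : U ∈ 𝓝 x) :
    ∀ᶠ z in 𝓝 (polyMap P x), ∀ x' ∈ refElement s, polyMap P x' = z → x' ∈ U := by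
  have hc : IsCompact (polyMap P '' (refElement s \ interior U)) :=
    ((isCompact_refElement s).diff isOpen_interior).image (contDiff_polyMap P).continuous
  have hmem : polyMap P x ∈ (polyMap P '' (refElement s \ interior U))ᶜ := by
    rintro ⟨y, ⟨hy, hyU⟩, hyx⟩
    exact hyU (H.injOn hy hx hyx ▸ mem_interior_iff_mem_nhds.2 hU)
  filter_upwards [hc.isClosed.isOpen_compl.mem_nhds hmem] with z hz x' hx' hxz
  by_contra hx'U
  exact hz ⟨x', ⟨hx', fun h' => hx'U (interior_subset h')⟩, hxz⟩

lemma exists_local_inverse (H : IsElement s k σ P h) {x : E2} (hx : x ∈ refElement s) :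
    ∃ e : OpenPartialHomeomorph E2 E2, x ∈ e.source ∧ (e : E2 → E2) = polyMap P ∧
      ContDiffAt ℝ ∞ e.symm (polyMap P x) := by
  obtain ⟨A, hA⟩ := H.exists_equiv hx
  have hc : ContDiffAt ℝ ∞ (polyMap P) x := (contDiff_polyMap P).contDiffAt
  have hd : HasFDerivAt (polyMap P) (A : E2 →L[ℝ] E2) x := hA ▸ hasFDerivAt_polyMap P x
  exact ⟨hc.toOpenPartialHomeomorph _ hd (by simp), hc.mem_toOpenPartialHomeomorph_source hd (by simp),
    rfl, hc.to_localInverse hd (by simp)⟩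

/-- Locally `u` is `p` composed with a smooth local inverse of the element map. By compactness and
injectivity, points of the element near `polyMap P x` come only from points near `x`, so this holds
up to the boundary. -/
lemma contDiffOn_of_comp (H : IsElement s k σ P h) {u p : E2 → ℝ}
    (hp : ∀ x ∈ refElement s, ContDiffAt ℝ ∞ p x)
    (hu : ∀ x ∈ refElement s, u (polyMap P x) = p x) :
    ContDiffOn ℝ ∞ u (polyMap P '' refElement s) := by
  rintro _ ⟨x, hx, rfl⟩
  obtain ⟨e, hxe, heP, he⟩ := H.exists_local_inverse hx
  have hex : e.symm (polyMap P x) = x := by rw [← heP, e.left_inv hxe]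
  have h1 : ContDiffAt ℝ ∞ (p ∘ e.symm) (polyMap P x) :=
    ContDiffAt.comp _ (by rw [hex]; exact hp x hx) he
  have h2 : ∀ x' ∈ refElement s, x' ∈ e.source → u (polyMap P x') = (p ∘ e.symm) (polyMap P x') :=
    fun x' hx' hs => by
      rw [hu x' hx', Function.comp_apply, ← heP, e.left_inv hs]
  refine h1.contDiffWithinAt.congr_of_eventuallyEq ?_ (h2 x hx hxe)
  have h3 := H.eventually_preimage_mem hx (e.open_source.mem_nhds hxe)
  filter_upwards [nhdsWithin_le_nhds h3, self_mem_nhdsWithin] with z hz hzT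
  obtain ⟨x', hx', rfl⟩ := hzT
  exact h2 x' hx' (hz x' hx' rfl)

/-- Unique differentiability of the convex reference element is carried over by the invertible
differential. This makes derivatives relative to the closed element meaningful at its boundary. -/
lemma uniqueDiffOn_image (H : IsElement s k σ P h) : UniqueDiffOn ℝ (polyMap P '' refElement s) := by
  refine (uniqueDiffOn_convex (convex_refElement s) (nonempty_interior_refElement s)).image
    (f' := fderiv ℝ (polyMap P)) (fun x _ => (hasFDerivAt_polyMap P x).hasFDerivWithinAt)
    fun x hx => ?_
  obtain ⟨A, hA⟩ := H.exists_equiv hx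
  rw [← hA]
  exact A.surjective.denseRange

lemma isOpen_image_interior (H : IsElement s k σ P h) :
    IsOpen (polyMap P '' interior (refElement s)) := by
  refine isOpen_iff_mem_nhds.2 ?_
  rintro _ ⟨x, hx, rfl⟩
  obtain ⟨e, hxe, heP, -⟩ := H.exists_local_inverse (interior_subset hx)
  have := e.image_mem_nhds hxe (isOpen_interior.mem_nhds hx)
  rwa [heP] at this

lemma image_interior_subset (H : IsElement s k σ P h) :
    polyMap P '' interior (refElement s) ⊆ interior (polyMap P '' refElement s) :=
  interior_maximal (Set.image_mono interior_subset) H.isOpen_image_interior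

lemma image_subset_closure (_ : IsElement s k σ P h) :
    polyMap P '' refElement s ⊆ closure (polyMap P '' interior (refElement s)) := by
  refine (Set.image_mono ?_).trans (image_closure_subset_closure_image (contDiff_polyMap P).continuous)
  rw [(convex_refElement s).closure_interior_eq_closure_of_nonempty_interior
    (nonempty_interior_refElement s)]
  exact subset_closure

lemma image_diff_subset (_ : IsElement s k σ P h) {A : Set E2}
    (hA : Disjoint A (polyMap P '' interior (refElement s))) :
    polyMap P '' refElement s ∩ A ⊆ polyMap P '' refBoundary s := by
  rintro _ ⟨⟨x, hx, rfl⟩, hxA⟩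
  exact ⟨x, ⟨hx, fun hxi => Set.disjoint_left.1 hA hxA ⟨x, hxi, rfl⟩⟩, rfl⟩

lemma volume_image_refBoundary (_ : IsElement s k σ P h) :
    volume (polyMap P '' refBoundary s) = 0 :=
  addHaar_image_eq_zero_of_differentiableOn_of_addHaar_eq_zero _
    ((contDiff_polyMap P).differentiable (by simp)).differentiableOn (volume_refBoundary s)

lemma hausdorffMeasure_image_refBoundary_le (H : IsElement s k σ P h) :
    μH[1] (polyMap P '' refBoundary s) ≤ ENNReal.ofReal (σ * h) * μH[1] (refBoundary s) := by
  have hL : LipschitzOnWith (σ * h).toNNReal (polyMap P) (refElement s) := by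
    refine (convex_refElement s).lipschitzOnWith_of_nnnorm_fderiv_le
      (fun x _ => (contDiff_polyMap P).differentiable (by simp) x) fun x hx => ?_
    rw [← NNReal.coe_le_coe, coe_nnnorm, Real.coe_toNNReal _ (mul_pos H.sigma_pos H.size_pos).le]
    exact ContinuousLinearMap.opNorm_le_bound _ (mul_pos H.sigma_pos H.size_pos).le (H.upper x hx)
  have := (hL.mono Set.sdiff_subset).hausdorffMeasure_image_le zero_le_one (s := refBoundary s)
  rwa [ENNReal.rpow_one] at this

lemma lintegral_image_interior (H : IsElement s k σ P h) (f : E2 → ℝ≥0∞) :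
    ∫⁻ z in polyMap P '' interior (refElement s), f z =
      ∫⁻ x in interior (refElement s), ENNReal.ofReal |ev (jac P) x| * f (polyMap P x) := by
  rw [lintegral_image_eq_lintegral_abs_det_fderiv_mul volume isOpen_interior.measurableSet
    (fun x _ => (hasFDerivAt_polyMap P x).hasFDerivWithinAt) (H.injOn.mono interior_subset)]
  simp only [abs_det_fderiv_polyMap]

lemma le_volume_image_interior (H : IsElement s k σ P h) :
    ENNReal.ofReal (h ^ 2 / σ ^ 2) * volume (interior (refElement s)) ≤
      volume (polyMap P '' interior (refElement s)) := by
  have := H.lintegral_image_interior fun _ => 1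
  rw [setLIntegral_one] at this
  rw [this, ← setLIntegral_const]
  refine setLIntegral_mono' isOpen_interior.measurableSet fun x hx => ?_
  rw [mul_one]
  exact ENNReal.ofReal_le_ofReal (H.le_abs_jac (interior_subset hx))

end IsElement

/-! ### Rational functions on an element and inverse estimates -/

/-- The pull-back of `w` to the reference element is a polynomial of degree at most `D` divided by
the `m`-th power of the Jacobian. -/
def IsRat (s : RefShape) (P : Fin 2 → MvPolynomial (Fin 2) ℝ) (m D : ℕ) (w : E2 → ℝ) : Prop :=
  ∃ q : MvPolynomial (Fin 2) ℝ, q.totalDegree ≤ D ∧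
    ∀ x ∈ refElement s, ev (jac P) x ^ m * w (polyMap P x) = ev q x

namespace IsRat

variable {s : RefShape} {k m D : ℕ} {σ h : ℝ} {P : Fin 2 → MvPolynomial (Fin 2) ℝ} {w : E2 → ℝ}

lemma contDiffOn (hw : IsRat s P m D w) (H : IsElement s k σ P h) :
    ContDiffOn ℝ ∞ w (polyMap P '' refElement s) := by
  obtain ⟨q, -, hq⟩ := hw
  refine H.contDiffOn_of_comp (p := fun x => ev q x / ev (jac P) x ^ m) (fun x hx => ?_)
    fun x hx => ?_
  · exact (contDiff_ev q).contDiffAt.div ((contDiff_ev (jac P)).pow m).contDiffAt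
      (pow_ne_zero _ (H.jac_ne_zero hx))
  · rw [← hq x hx, mul_div_cancel_left₀ _ (pow_ne_zero _ (H.jac_ne_zero hx))]

/-- Product and chain rule for the identity `J ^ m * (w ∘ F) = q`, compared on the reference
element, where derivatives are unique. -/
lemma fderivWithin_apply (hw : IsRat s P m D w) (H : IsElement s k σ P h)
    {q : MvPolynomial (Fin 2) ℝ}
    (hq : ∀ x ∈ refElement s, ev (jac P) x ^ m * w (polyMap P x) = ev q x) {x : E2}
    (hx : x ∈ refElement s) (v : E2) :
    ev (jac P) x ^ m * fderivWithin ℝ w (polyMap P '' refElement s) (polyMap P x)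
        (fderiv ℝ (polyMap P) x v) =
      fderiv ℝ (ev q) x v - m * ev (jac P) x ^ (m - 1) * fderiv ℝ (ev (jac P)) x v
        * w (polyMap P x) := by
  have h1 : HasFDerivWithinAt (w ∘ polyMap P) _ (refElement s) x :=
    (((hw.contDiffOn H).differentiableOn (by simp)) _ ⟨x, hx, rfl⟩).hasFDerivWithinAt.comp x
      (hasFDerivAt_polyMap P x).hasFDerivWithinAt (Set.mapsTo_image _ _)
  have hJ : HasFDerivWithinAt (ev (jac P)) (fderiv ℝ (ev (jac P)) x) (refElement s) x :=
    ((contDiff_ev _).differentiable (by simp) x).hasFDerivAt.hasFDerivWithinAt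
  have h2 := (hJ.pow m).mul h1
  have h3 : HasFDerivWithinAt (ev q) (fderiv ℝ (ev q) x) (refElement s) x :=
    ((contDiff_ev _).differentiable (by simp) x).hasFDerivAt.hasFDerivWithinAt
  have h4 : HasFDerivWithinAt (ev q) _ (refElement s) x :=
    h2.congr (fun y hy => (hq y hy).symm) (hq x hx).symm
  have h5 := (uniqueDiffOn_convex (convex_refElement s) (nonempty_interior_refElement s) x hx).eq h3 h4
  have h6 := DFunLike.congr_fun h5 v
  simp at h6
  rw [h6]
  ring

/-- In the cofactor direction the chain rule produces `J` times `∂_a w`; one more factor `J` clears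
the denominator left by `w`. This raises the exponent by two. The degree grows by `2 * k` from the
cofactor and `4 * k` from the Jacobian. -/
lemma pd (hw : IsRat s P m D w) (H : IsElement s k σ P h) (a : Fin 2) :
    IsRat s P (m + 2) (D + 6 * k) (pd (polyMap P '' refElement s) a w) := by
  obtain ⟨q, hqD, hq⟩ := id hw
  refine ⟨∑ b, cofac P a b * (jac P * MvPolynomial.pderiv b q
    - (m : ℝ) • (q * MvPolynomial.pderiv b (jac P))), ?_, fun x hx => ?_⟩
  · refine MvPolynomial.totalDegree_finsetSum_le fun b _ => ?_
    refine (MvPolynomial.totalDegree_mul _ _).trans ?_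
    have h1 := H.totalDegree_cofac_le a b
    have h2 : (jac P * MvPolynomial.pderiv b q
        - (m : ℝ) • (q * MvPolynomial.pderiv b (jac P))).totalDegree ≤ D + 4 * k := by
      have hj := H.totalDegree_jac_le
      refine (MvPolynomial.totalDegree_sub _ _).trans (max_le ?_ ?_)
      · refine (MvPolynomial.totalDegree_mul _ _).trans ?_
        have := totalDegree_pderiv_le b q
        omega
      · refine (MvPolynomial.totalDegree_smul_le _ _).trans
          ((MvPolynomial.totalDegree_mul _ _).trans ?_)
        have := totalDegree_pderiv_le b (jac P)
        omega
    omega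
  · have h1 := hw.fderivWithin_apply H hq hx (cofacVec P a x)
    rw [fderiv_polyMap_cofacVec, map_smul, smul_eq_mul, fderiv_ev_apply, fderiv_ev_apply] at h1
    have h2 := hq x hx
    set J := ev (jac P) x
    -- For `m = 0` the truncated exponent is harmless, since the factor `m` vanishes.
    have h3 : (m : ℝ) * J ^ (m - 1) * J = m * J ^ m := by
      cases m with
      | zero => simp
      | succ n => simp [pow_succ, mul_assoc]
    rw [DGPlate.pd]
    set A := (fderivWithin ℝ w (polyMap P '' refElement s) (polyMap P x)) (EuclideanSpace.single a 1)
    simp only [ev_add, ev_mul, ev_sub, ev_smul, Fin.sum_univ_two, cofacVec] at h1 ⊢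
    rw [← h2]
    have h4 : J ^ (m + 2) * A = J * (J ^ m * (J * A)) := by ring
    rw [h4, h1]
    linear_combination (-(ev (MvPolynomial.pderiv 0 (jac P)) x * ev (cofac P a 0) x +
      ev (MvPolynomial.pderiv 1 (jac P)) x * ev (cofac P a 1) x) * w (polyMap P x)) * h3

end IsRat

lemma abs_le_of_isRat {s : RefShape} {k m : ℕ} {σ h : ℝ} {P : Fin 2 → MvPolynomial (Fin 2) ℝ}
    (H : IsElement s k σ P h) {x : E2} (hx : x ∈ refElement s) (y : ℝ) :
    (h ^ 2 / σ ^ 2) ^ m * |y| ≤ |ev (jac P) x ^ m * y| ∧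
      |ev (jac P) x ^ m * y| ≤ (2 * σ ^ 2 * h ^ 2) ^ m * |y| := by
  rw [abs_mul, abs_pow]
  have := H.sigma_pos
  constructor
  · gcongr; exact H.le_abs_jac hx
  · gcongr; exact H.abs_jac_le hx

/-- The numerator obeys the polynomial estimate on the reference element. The Jacobian bounds
transfer it to `w`, and the change of variables to the element leaves the single factor `1 / h ^ 2`.
-/
theorem exists_sq_le_integral_of_isRat (s : RefShape) (k m D : ℕ) (σ : ℝ) :
    ∃ C : ℝ, 0 ≤ C ∧ ∀ (P : Fin 2 → MvPolynomial (Fin 2) ℝ) (h : ℝ) (w : E2 → ℝ),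
      IsElement s k σ P h → IsRat s P m D w → ∀ x ∈ refElement s,
        w (polyMap P x) ^ 2 ≤
          C / h ^ 2 * ∫ z in polyMap P '' interior (refElement s), w z ^ 2 := by
  obtain ⟨C, hC, hCq⟩ := exists_sq_le_integral s D
  refine ⟨C * (2 * σ ^ 4) ^ (2 * m) * σ ^ 2, by positivity, fun P h w H hw x hx => ?_⟩
  obtain ⟨q, hqD, hq⟩ := id hw
  have hσ := H.sigma_pos
  have hh := H.size_pos
  have hchange : ∫ z in polyMap P '' interior (refElement s), w z ^ 2 =
      ∫ x in interior (refElement s), |ev (jac P) x| * w (polyMap P x) ^ 2 := by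
    rw [integral_image_eq_integral_abs_det_fderiv_smul volume isOpen_interior.measurableSet
      (fun x _ => (hasFDerivAt_polyMap P x).hasFDerivWithinAt) (H.injOn.mono interior_subset)]
    simp only [abs_det_fderiv_polyMap, smul_eq_mul]
  have hcont : ContinuousOn (fun x => |ev (jac P) x| * w (polyMap P x) ^ 2) (refElement s) := by
    refine (contDiff_ev (jac P)).continuous.abs.continuousOn.mul (ContinuousOn.pow ?_ 2)
    exact (hw.contDiffOn H).continuousOn.comp (contDiff_polyMap P).continuous.continuousOn
      (Set.mapsTo_image _ _)
  have hint := (hcont.integrableOn_compact (isCompact_refElement s) (μ := volume)).mono_set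
    interior_subset
  set a := h ^ 2 / σ ^ 2 with ha
  have ha0 : 0 < a := by positivity
  have h1 : (a ^ m * |w (polyMap P x)|) ^ 2 ≤ C * ∫ z in interior (refElement s), ev q z ^ 2 := by
    refine le_trans ?_ (hCq q hqD x hx)
    rw [← sq_abs (ev q x), ← hq x hx]
    exact pow_le_pow_left₀ (by positivity) (abs_le_of_isRat H hx _).1 2
  have h2 : ∫ z in interior (refElement s), ev q z ^ 2 ≤
      (2 * σ ^ 2 * h ^ 2) ^ (2 * m) * a⁻¹ *
        ∫ z in polyMap P '' interior (refElement s), w z ^ 2 := by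
    rw [hchange, ← integral_const_mul]
    refine setIntegral_mono_on ?_ (hint.const_mul _) isOpen_interior.measurableSet fun z hz => ?_
    · exact (memLp_ev s q).integrable_sq
    · have hz' := interior_subset hz
      have h3 := pow_le_pow_left₀ (abs_nonneg _) (abs_le_of_isRat (m := m) H hz' (w (polyMap P z))).2 2
      rw [hq z hz', sq_abs, mul_pow, sq_abs, ← pow_mul, mul_comm m 2] at h3
      refine h3.trans ?_
      have h5 : 1 ≤ a⁻¹ * |ev (jac P) z| := by
        rw [inv_mul_eq_div, one_le_div ha0]
        exact H.le_abs_jac hz'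
      calc (2 * σ ^ 2 * h ^ 2) ^ (2 * m) * w (polyMap P z) ^ 2
          ≤ (2 * σ ^ 2 * h ^ 2) ^ (2 * m) * ((a⁻¹ * |ev (jac P) z|) * w (polyMap P z) ^ 2) := by
            gcongr
            exact le_mul_of_one_le_left (sq_nonneg _) h5
        _ = _ := by ring
  have h4 : a ^ (2 * m) * w (polyMap P x) ^ 2 ≤ C * ((2 * σ ^ 2 * h ^ 2) ^ (2 * m) * a⁻¹ *
        ∫ z in polyMap P '' interior (refElement s), w z ^ 2) := by
    refine le_trans (le_of_eq ?_) (h1.trans (mul_le_mul_of_nonneg_left h2 hC))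
    rw [mul_pow, sq_abs, ← pow_mul, mul_comm m 2]
  rw [← le_div_iff₀' (by positivity)] at h4
  refine h4.trans (le_of_eq ?_)
  -- The upper and lower Jacobian bounds differ by the factor `2 * σ ^ 4`, so the powers of `a`
  -- coming from the denominators cancel and only `a⁻¹` survives.
  have e1 : (2 * σ ^ 2 * h ^ 2) = (2 * σ ^ 4) * a := by rw [ha]; field_simp
  rw [e1, mul_pow (2 * σ ^ 4) a]
  have e2 : a⁻¹ = σ ^ 2 / h ^ 2 := by rw [ha, inv_div]
  rw [e2]
  field_simp

/-- Inverse estimate: numerator and Jacobian both have reference derivatives bounded by their own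
maxima, so differentiation costs only the inverse of the differential, of size `σ / h`. -/
theorem exists_abs_pd_le_of_isRat (s : RefShape) (k m D : ℕ) (σ : ℝ) :
    ∃ C : ℝ, 0 ≤ C ∧ ∀ (P : Fin 2 → MvPolynomial (Fin 2) ℝ) (h : ℝ) (w : E2 → ℝ) (B : ℝ),
      IsElement s k σ P h → IsRat s P m D w → (∀ x ∈ refElement s, |w (polyMap P x)| ≤ B) →
        ∀ a, ∀ x ∈ refElement s,
          |pd (polyMap P '' refElement s) a w (polyMap P x)| ≤ C / h * B := by
  obtain ⟨C₁, hC₁, hCq⟩ := exists_abs_pderiv_le s D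
  obtain ⟨C₂, hC₂, hCJ⟩ := exists_abs_pderiv_le s (4 * k)
  refine ⟨(2 * σ ^ 4) ^ m * (2 * (C₁ + m * C₂)) * |σ|, by positivity,
    fun P h w B H hw hB a x hx => ?_⟩
  obtain ⟨q, hqD, hq⟩ := id hw
  have hσ := H.sigma_pos
  have hh := H.size_pos
  have hB0 : 0 ≤ B := (abs_nonneg _).trans (hB x hx)
  rw [abs_of_pos hσ]
  set j := 2 * σ ^ 2 * h ^ 2 with hj
  have hj0 : 0 < j := by positivity
  have hqB : ∀ b, |ev (MvPolynomial.pderiv b q) x| ≤ C₁ * (j ^ m * B) := fun b => by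
    refine hCq q _ hqD (fun z hz => ?_) b x hx
    rw [← hq z hz]
    exact (abs_le_of_isRat H hz _).2.trans (mul_le_mul_of_nonneg_left (hB z hz) (by positivity))
  have hJB : ∀ b, |ev (MvPolynomial.pderiv b (jac P)) x| ≤ C₂ * j := fun b =>
    hCJ (jac P) _ H.totalDegree_jac_le (fun z hz => H.abs_jac_le hz) b x hx
  have hfd : ∀ (p : MvPolynomial (Fin 2) ℝ) (c : ℝ), (∀ b, |ev (MvPolynomial.pderiv b p) x| ≤ c) →
      ∀ v : E2, |fderiv ℝ (ev p) x v| ≤ 2 * c * ‖v‖ := by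
    intro p c hc v
    rw [fderiv_ev_apply, Fin.sum_univ_two]
    refine (abs_add_le _ _).trans ?_
    rw [abs_mul, abs_mul]
    have h0 := mul_le_mul (hc 0) (PiLp.norm_apply_le v 0) (norm_nonneg _) ((abs_nonneg _).trans (hc 0))
    have h1 := mul_le_mul (hc 1) (PiLp.norm_apply_le v 1) (norm_nonneg _) ((abs_nonneg _).trans (hc 1))
    rw [Real.norm_eq_abs] at h0 h1
    linarith
  obtain ⟨A, hA⟩ := H.exists_equiv hx
  -- The preimage of a unit vector, rather than a cofactor direction, gives the scaling `‖v‖ ≤ σ /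
  -- h` at once.
  set v := A.symm (EuclideanSpace.single a 1) with hv
  have hDv : fderiv ℝ (polyMap P) x v = EuclideanSpace.single a 1 := by
    rw [← hA]; simp [hv]
  have hvn : ‖v‖ ≤ σ / h := by
    have := H.lower x hx v
    rw [hDv, PiLp.norm_single, norm_one, mul_one] at this
    rwa [le_div_iff₀' hh]
  have hmain := hw.fderivWithin_apply H hq hx v
  rw [hDv] at hmain
  change _ * pd (polyMap P '' refElement s) a w (polyMap P x) = _ at hmain
  set y := pd (polyMap P '' refElement s) a w (polyMap P x)
  have hmj : (m : ℝ) * |ev (jac P) x| ^ (m - 1) * j ≤ m * j ^ m := by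
    cases m with
    | zero => simp
    | succ n =>
      rw [Nat.add_sub_cancel, pow_succ, mul_assoc]
      gcongr
      exact H.abs_jac_le hx
  have h1 : (h ^ 2 / σ ^ 2) ^ m * |y| ≤ j ^ m * (2 * (C₁ + m * C₂)) * B * ‖v‖ := by
    refine (abs_le_of_isRat H hx y).1.trans ?_
    rw [hmain]
    refine (abs_sub _ _).trans ?_
    rw [abs_mul, abs_mul, abs_mul, Nat.abs_cast, abs_pow]
    have e1 := hfd q _ hqB v
    have e2 := hfd (jac P) _ hJB v
    have e3 : (m : ℝ) * |ev (jac P) x| ^ (m - 1) * |fderiv ℝ (ev (jac P)) x v| * |w (polyMap P x)| ≤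
        m * |ev (jac P) x| ^ (m - 1) * (2 * (C₂ * j) * ‖v‖) * B := by
      gcongr
      exact hB x hx
    have e4 : (m : ℝ) * |ev (jac P) x| ^ (m - 1) * (2 * (C₂ * j) * ‖v‖) * B ≤
        (m * j ^ m) * (2 * C₂ * ‖v‖ * B) := by
      calc _ = ((m : ℝ) * |ev (jac P) x| ^ (m - 1) * j) * (2 * C₂ * ‖v‖ * B) := by ring
        _ ≤ _ := by gcongr
    linarith
  have h2 : (h ^ 2 / σ ^ 2) ^ m * |y| ≤ j ^ m * (2 * (C₁ + m * C₂)) * B * (σ / h) :=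
    h1.trans (by gcongr)
  rw [← le_div_iff₀' (by positivity)] at h2
  refine h2.trans (le_of_eq ?_)
  have e1 : j = (2 * σ ^ 4) * (h ^ 2 / σ ^ 2) := by rw [hj]; field_simp
  rw [e1, mul_pow (2 * σ ^ 4)]
  field_simp

/-! ### Geometry of the mesh -/

/-- Just below a boundary point there are points outside the closure, so no boundary point is
interior to it. This places the open cores of the elements inside `Ω`. -/
lemma IsLipschitzDomain.interior_closure_subset {Ω : Set E2} (hΩ : IsLipschitzDomain Ω) :
    interior (closure Ω) ⊆ Ω := by
  intro x hx
  by_contra hxΩ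
  have hxf : x ∈ frontier Ω := by
    rw [hΩ.isOpen.frontier_eq]
    exact ⟨interior_subset hx, hxΩ⟩
  obtain ⟨L, r, K, φ, hr, hφ, hgraph⟩ := hΩ.graph x hxf
  have hep : IsEpigraphNear Ω x L r φ := hgraph
  have hx1 := (hep.mem_frontier_iff hΩ.isOpen hφ.continuous (Metric.mem_ball_self hr)).1 hxf
  have hlim : Tendsto (fun t : ℝ => x + t • pt L 0 1) (𝓝[<] 0) (𝓝 x) := by
    have : Continuous fun t : ℝ => x + t • pt L 0 1 := by fun_prop
    simpa using (this.tendsto 0).mono_left nhdsWithin_le_nhds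
  have hev : ∀ᶠ t : ℝ in 𝓝[<] 0, False := by
    filter_upwards [hlim (isOpen_interior.mem_nhds hx), hlim (Metric.ball_mem_nhds x hr),
      self_mem_nhdsWithin] with t ht1 ht2 ht0
    have hlt : L (x + t • pt L 0 1) 1 < φ (L (x + t • pt L 0 1) 0) := by
      rw [← pt_coord L x, ← pt_add_vertical]
      simp only [coord_zero_pt, coord_one_pt]
      rw [← hx1]
      exact add_lt_of_neg_right _ ht0
    have hnot : x + t • pt L 0 1 ∉ frontier Ω := fun h =>
      hlt.ne ((hep.mem_frontier_iff hΩ.isOpen hφ.continuous ht2).1 h)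
    rw [hΩ.isOpen.frontier_eq] at hnot
    exact lt_asymm hlt ((hep _ ht2).1 (by_contra fun h => hnot ⟨interior_subset ht1, h⟩))
  simpa using hev.exists

lemma IsDirichletPart.subset_frontier {Ω Γ : Set E2} (h : IsDirichletPart Ω Γ) : Γ ⊆ frontier Ω := by
  obtain ⟨-, U, -, rfl⟩ := h
  exact Set.inter_subset_right

lemma IsDirichletPart.measurableSet {Ω Γ : Set E2} (h : IsDirichletPart Ω Γ) : MeasurableSet Γ := by
  obtain ⟨-, U, hU, rfl⟩ := h
  exact hU.measurableSet.inter isClosed_frontier.measurableSet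

namespace Mesh

variable {s : RefShape} {k : ℕ} {Ω Γ : Set E2} {σ κ : ℝ} {h : E2 → ℝ}

/-- Image of the interior of the reference element. -/
def core (M : Mesh s k Ω) (i : Fin M.N) : Set E2 := polyMap (M.P i) '' interior (refElement s)

/-- Image of the boundary of the reference element. -/
def rim (M : Mesh s k Ω) (i : Fin M.N) : Set E2 := polyMap (M.P i) '' refBoundary s

/-- A shape regular mesh with positive constant. -/
structure Regular (M : Mesh s k Ω) (σ : ℝ) : Prop where
  pos : 0 < σ
  shape : M.IsShapeRegular σ

lemma isCompact_T (M : Mesh s k Ω) (i : Fin M.N) : IsCompact (M.T i) :=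
  (isCompact_refElement s).image (contDiff_polyMap _).continuous

lemma measurableSet_T (M : Mesh s k Ω) (i : Fin M.N) : MeasurableSet (M.T i) :=
  (M.isCompact_T i).measurableSet

lemma core_subset_T (M : Mesh s k Ω) (i : Fin M.N) : M.core i ⊆ M.T i :=
  Set.image_mono interior_subset

lemma T_subset_closure (M : Mesh s k Ω) (i : Fin M.N) : M.T i ⊆ closure Ω :=
  (Set.subset_iUnion _ i).trans M.cover.subset

lemma exists_mem_T (M : Mesh s k Ω) {x : E2} (hx : x ∈ closure Ω) : ∃ i, x ∈ M.T i :=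
  Set.mem_iUnion.1 (M.cover.superset hx)

lemma size_pos (M : Mesh s k Ω) (i : Fin M.N) : 0 < M.size i := by
  refine Metric.diam_pos ?_ (M.isCompact_T i).isBounded
  refine Set.Nontrivial.image_of_injOn ?_ (M.injOn i)
  obtain ⟨x, hx⟩ := nonempty_interior_refElement s
  obtain ⟨ε, hε, hball⟩ := Metric.isOpen_iff.1 isOpen_interior x hx
  refine ⟨x, interior_subset hx, x + EuclideanSpace.single 0 (ε / 2),
    interior_subset (hball ?_), fun heq => ?_⟩
  · simp [abs_of_pos hε]; linarith
  · have := congrArg (fun z : E2 => z 0) heq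
    simp at this
    exact hε.ne' this

namespace Regular

variable {M : Mesh s k Ω}

lemma isElement (H : M.Regular σ) (i : Fin M.N) : IsElement s k σ (M.P i) (M.size i) :=
  { mem := M.P_mem i
    injOn := M.injOn i
    sigma_pos := H.pos
    size_pos := M.size_pos i
    upper := fun x hx v => (H.shape i x hx v).1
    lower := fun x hx v => (H.shape i x hx v).2 }

lemma isOpen_core (H : M.Regular σ) (i : Fin M.N) : IsOpen (M.core i) :=
  (H.isElement i).isOpen_image_interior

/-- Each element lies in the closure of its open core, so an open core that meets another element
also meets that element's core, contrary to the disjointness of the interiors. -/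
lemma disjoint_core_T (H : M.Regular σ) {i j : Fin M.N} (hij : i ≠ j) :
    Disjoint (M.core i) (M.T j) := by
  refine Set.disjoint_left.2 fun x hxi hxj => ?_
  obtain ⟨z, hzi, hzj⟩ := mem_closure_iff.1 ((H.isElement j).image_subset_closure hxj) _
    (H.isOpen_core i) hxi
  exact Set.disjoint_left.1 (M.disjoint_interior i j hij)
    ((H.isElement i).image_interior_subset hzi) ((H.isElement j).image_interior_subset hzj)

lemma inter_subset_rim (H : M.Regular σ) {i j : Fin M.N} (hij : i ≠ j) :
    M.T i ∩ M.T j ⊆ M.rim i :=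
  (H.isElement i).image_diff_subset (H.disjoint_core_T hij).symm

lemma core_subset (H : M.Regular σ) (hΩ : IsLipschitzDomain Ω) (i : Fin M.N) : M.core i ⊆ Ω :=
  (interior_maximal ((M.core_subset_T i).trans (M.T_subset_closure i)) (H.isOpen_core i)).trans
    hΩ.interior_closure_subset

lemma inter_dirichlet_subset_rim (H : M.Regular σ) (hΩ : IsLipschitzDomain Ω)
    (hΓ : IsDirichletPart Ω Γ) (i : Fin M.N) : M.T i ∩ Γ ⊆ M.rim i := by
  refine (H.isElement i).image_diff_subset (Set.disjoint_left.2 fun x hx hx' => ?_)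
  have := hΓ.subset_frontier hx
  rw [hΩ.isOpen.frontier_eq] at this
  exact this.2 (H.core_subset hΩ i hx')

lemma _root_.DGPlate.Mesh.edge_subset_left (M : Mesh s k Ω) (Γ : Set E2) (i : Fin M.N)
    (o : Option (Fin M.N)) : M.edge Γ i o ⊆ M.T i := by
  cases o with
  | none => exact Set.inter_subset_left
  | some j =>
    simp only [Mesh.edge]
    split_ifs
    · exact fun x hx => hx.1.1
    · exact Set.empty_subset _

lemma _root_.DGPlate.Mesh.edge_some_subset_right (M : Mesh s k Ω) (Γ : Set E2) (i j : Fin M.N) :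
    M.edge Γ i (some j) ⊆ M.T j := by
  simp only [Mesh.edge]
  split_ifs
  · exact fun x hx => hx.1.2
  · exact Set.empty_subset _

lemma edge_subset_rim (H : M.Regular σ) (hΩ : IsLipschitzDomain Ω)
    (hΓ : IsDirichletPart Ω Γ) (i : Fin M.N) (o : Option (Fin M.N)) :
    M.edge Γ i o ⊆ M.rim i := by
  cases o with
  | none => exact H.inter_dirichlet_subset_rim hΩ hΓ i
  | some j =>
    simp only [Mesh.edge]
    split_ifs with hij
    · exact fun x hx => H.inter_subset_rim hij.ne hx.1
    · exact Set.empty_subset _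

lemma edge_some_subset_rim (H : M.Regular σ) (i j : Fin M.N) :
    M.edge Γ i (some j) ⊆ M.rim j := by
  simp only [Mesh.edge]
  split_ifs with hij
  · exact fun x hx => H.inter_subset_rim hij.ne' ⟨hx.1.2, hx.1.1⟩
  · exact Set.empty_subset _

lemma hausdorffMeasure_rim_lt_top (H : M.Regular σ) (i : Fin M.N) : μH[1] (M.rim i) < ⊤ :=
  (H.isElement i).hausdorffMeasure_image_refBoundary_le.trans_lt
    (ENNReal.mul_lt_top ENNReal.ofReal_lt_top (hausdorffMeasure_refBoundary_lt_top s))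

lemma hausdorffMeasure_le (H : M.Regular σ) {i : Fin M.N} {S : Set E2} (hS : S ⊆ M.rim i) :
    (μH[1] S).toReal ≤ σ * (μH[1] (refBoundary s)).toReal * M.size i := by
  have h1 : μH[1] S ≤ _ :=
    (measure_mono hS).trans (H.isElement i).hausdorffMeasure_image_refBoundary_le
  have h2 := ENNReal.toReal_mono (ENNReal.mul_ne_top ENNReal.ofReal_ne_top
    (hausdorffMeasure_refBoundary_lt_top s).ne) h1
  rw [ENNReal.toReal_mul, ENNReal.toReal_ofReal (mul_pos H.pos (M.size_pos i)).le] at h2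
  linarith

lemma _root_.DGPlate.Mesh.measurableSet_edge (M : Mesh s k Ω) (hΩ : IsLipschitzDomain Ω)
    (hΓ : IsDirichletPart Ω Γ) (i : Fin M.N) (o : Option (Fin M.N)) :
    MeasurableSet (M.edge Γ i o) := by
  cases o with
  | none => exact (M.measurableSet_T i).inter hΓ.measurableSet
  | some j =>
    simp only [Mesh.edge]
    split_ifs
    · exact ((M.measurableSet_T i).inter (M.measurableSet_T j)).inter hΩ.isOpen.measurableSet
    · exact MeasurableSet.empty

lemma hausdorffMeasure_edge_lt_top (H : M.Regular σ) (hΩ : IsLipschitzDomain Ω)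
    (hΓ : IsDirichletPart Ω Γ) (i : Fin M.N) (o : Option (Fin M.N)) :
    μH[1] (M.edge Γ i o) < ⊤ :=
  (measure_mono (H.edge_subset_rim hΩ hΓ i o)).trans_lt (H.hausdorffMeasure_rim_lt_top i)

lemma volume_inter (H : M.Regular σ) {i j : Fin M.N} (hij : i ≠ j) : volume (M.T i ∩ M.T j) = 0 :=
  measure_mono_null (H.inter_subset_rim hij) (H.isElement i).volume_image_refBoundary

end Regular

/-- Both sizes are compared with the value of `h` at a common point; this limits the grading of the
mesh even at hanging nodes. -/
lemma IsDensity.size_le {M : Mesh s k Ω} (hh : M.IsDensity κ h) (hκ : 0 < κ) {i j : Fin M.N}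
    {x : E2} (hi : x ∈ M.T i) (hj : x ∈ M.T j) : M.size i ≤ κ ^ 2 * M.size j := by
  have h1 := (hh.2 i x hi).2.1
  have h2 := (hh.2 j x hj).2.2
  nlinarith

open Classical in
/-- The elements that meet `T i`. -/
noncomputable def neighbors (M : Mesh s k Ω) (i : Fin M.N) : Finset (Fin M.N) :=
  Finset.univ.filter fun j => (M.T i ∩ M.T j).Nonempty

lemma mem_neighbors (M : Mesh s k Ω) {i j : Fin M.N} :
    j ∈ M.neighbors i ↔ (M.T i ∩ M.T j).Nonempty := by
  simp [neighbors]

/-- All elements meeting `T i` are comparable to it in size. Their disjoint cores lie in a ball of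
radius proportional to the size of `T i`, and each has area at least a fixed multiple of that size
squared. -/
theorem exists_card_neighbors_le (s : RefShape) (k : ℕ) (σ κ : ℝ) (hκ : 0 < κ) :
    ∃ C : ℝ, 0 ≤ C ∧ ∀ (Ω : Set E2) (M : Mesh s k Ω) (h : E2 → ℝ), M.Regular σ →
      M.IsDensity κ h → ∀ i, ((M.neighbors i).card : ℝ) ≤ C := by
  set v := (volume (interior (refElement s))).toReal with hv
  have hvtop : volume (interior (refElement s)) ≠ ⊤ :=
    ((measure_mono interior_subset).trans_lt (isCompact_refElement s).measure_lt_top).ne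
  have hv0 : 0 < v := ENNReal.toReal_pos
    (isOpen_interior.measure_pos _ (nonempty_interior_refElement s)).ne' hvtop
  set β := (volume (Metric.ball (0 : E2) 1)).toReal
  refine ⟨(1 + κ ^ 2) ^ 2 * β * (κ ^ 4 * σ ^ 2) / v, by positivity, fun Ω M h H hh i => ?_⟩
  have hσ := H.pos
  have hi := M.size_pos i
  obtain ⟨x, hx⟩ := nonempty_interior_refElement s
  have hxT : polyMap (M.P i) x ∈ M.T i := ⟨x, interior_subset hx, rfl⟩
  set B := Metric.closedBall (polyMap (M.P i) x) ((1 + κ ^ 2) * M.size i) with hB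
  have hsub : (⋃ j ∈ M.neighbors i, M.core j) ⊆ B := by
    refine Set.iUnion₂_subset fun j hj z hz => ?_
    obtain ⟨p, hpi, hpj⟩ := M.mem_neighbors.1 hj
    have h1 := Metric.dist_le_diam_of_mem (M.isCompact_T i).isBounded hpi hxT
    have h2 := Metric.dist_le_diam_of_mem (M.isCompact_T j).isBounded (M.core_subset_T j hz) hpj
    have h3 := hh.size_le hκ hpj hpi
    rw [hB, Metric.mem_closedBall]
    have h4 : M.size i = Metric.diam (M.T i) := rfl
    have h5 : M.size j = Metric.diam (M.T j) := rfl
    linarith [dist_triangle z p (polyMap (M.P i) x)]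
  have hdisj : Set.PairwiseDisjoint (M.neighbors i : Set (Fin M.N)) M.core := by
    intro j _ l _ hjl
    exact (H.disjoint_core_T hjl).mono_right (M.core_subset_T l)
  have hvol : ∑ j ∈ M.neighbors i, volume (M.core j) ≤ volume B := by
    rw [← measure_biUnion_finset hdisj fun j _ => (H.isOpen_core j).measurableSet]
    exact measure_mono hsub
  have hBvol : (volume B).toReal = ((1 + κ ^ 2) * M.size i) ^ 2 * β := by
    rw [hB, Measure.addHaar_closedBall _ _ (by positivity), ENNReal.toReal_mul,
      ENNReal.toReal_ofReal (by positivity)]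
    simp [β]
  have hBtop : volume B ≠ ⊤ := (isCompact_closedBall _ _).measure_lt_top.ne
  have hctop : ∀ j ∈ M.neighbors i, volume (M.core j) ≠ ⊤ := fun j _ =>
    ((measure_mono (M.core_subset_T j)).trans_lt (M.isCompact_T j).measure_lt_top).ne
  have hvol' := ENNReal.toReal_mono hBtop hvol
  rw [ENNReal.toReal_sum hctop, hBvol] at hvol'
  have hlow : ∀ j ∈ M.neighbors i, M.size i ^ 2 / (κ ^ 4 * σ ^ 2) * v ≤
      (volume (M.core j)).toReal := by
    intro j hj
    obtain ⟨p, hpi, hpj⟩ := M.mem_neighbors.1 hj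
    have h1 := ENNReal.toReal_mono (hctop j hj) (H.isElement j).le_volume_image_interior
    rw [ENNReal.toReal_mul, ENNReal.toReal_ofReal (by positivity)] at h1
    refine le_trans ?_ h1
    have h2 := pow_le_pow_left₀ hi.le (hh.size_le hκ hpi hpj) 2
    refine mul_le_mul_of_nonneg_right ?_ hv0.le
    rw [div_le_div_iff₀ (by positivity) (by positivity)]
    nlinarith [sq_nonneg σ]
  have hsum := (Finset.card_nsmul_le_sum _ _ _ hlow).trans hvol'
  rw [nsmul_eq_mul] at hsum
  rw [le_div_iff₀ hv0]
  have h6 : ((M.neighbors i).card : ℝ) * v * M.size i ^ 2 ≤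
      ((1 + κ ^ 2) ^ 2 * β * (κ ^ 4 * σ ^ 2)) * M.size i ^ 2 := by
    have := mul_le_mul_of_nonneg_right hsum (show 0 ≤ κ ^ 4 * σ ^ 2 by positivity)
    refine le_trans (le_of_eq ?_) (this.trans (le_of_eq ?_))
    · field_simp
    · ring
  exact le_of_mul_le_mul_right h6 (by positivity)

/-- Being neighbours is symmetric, so after exchanging the sums each `A j` occurs as often as `j`
has neighbours. -/
lemma sum_neighbors_le (M : Mesh s k Ω) {C : ℝ} (hC : ∀ i, ((M.neighbors i).card : ℝ) ≤ C)
    (A : Fin M.N → ℝ) (hA : ∀ i, 0 ≤ A i) :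
    ∑ i, ∑ j ∈ M.neighbors i, (A i + A j) ≤ 2 * C * ∑ i, A i := by
  have h1 : ∑ i, ∑ j ∈ M.neighbors i, A i ≤ C * ∑ i, A i := by
    rw [Finset.mul_sum]
    refine Finset.sum_le_sum fun i _ => ?_
    rw [Finset.sum_const, nsmul_eq_mul]
    exact mul_le_mul_of_nonneg_right (hC i) (hA i)
  have h2 : ∑ i, ∑ j ∈ M.neighbors i, A j = ∑ i, ∑ j ∈ M.neighbors i, A i := by
    rw [Finset.sum_comm' (t' := Finset.univ) (s' := M.neighbors)]
    intro i j
    simp only [Finset.mem_univ, true_and, and_true, mem_neighbors]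
    rw [Set.inter_comm]
  simp only [Finset.sum_add_distrib]
  linarith

end Mesh

/-! ### Integrals over the skeleton -/

lemma memLp_restrict_of_continuousOn {μ : Measure E2} {f : E2 → ℝ} {K S : Set E2}
    (hf : ContinuousOn f K) (hK : IsCompact K) (hS : S ⊆ K) (hSm : MeasurableSet S)
    (hμ : μ S < ⊤) : MemLp f 2 (μ.restrict S) := by
  have : IsFiniteMeasure (μ.restrict S) := ⟨by rwa [Measure.restrict_apply_univ]⟩
  obtain ⟨B, hB⟩ := hK.exists_bound_of_continuousOn hf
  refine MemLp.of_bound ((hf.mono hS).aestronglyMeasurable hSm) B ?_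
  exact (ae_restrict_iff' hSm).2 (Eventually.of_forall fun x hx => hB x (hS hx))

namespace Mesh

variable {s : RefShape} {k : ℕ} {Ω Γ : Set E2} {σ κ : ℝ} {h : E2 → ℝ}

/-- Sum of the squares of the one-sided values. -/
def sideSq (M : Mesh s k Ω) (w : Fin M.N → E2 → ℝ) (i : Fin M.N) : Option (Fin M.N) → E2 → ℝ
  | some j => fun x => w i x ^ 2 + w j x ^ 2
  | none => fun x => w i x ^ 2

lemma sideSq_nonneg (M : Mesh s k Ω) (w : Fin M.N → E2 → ℝ) (i : Fin M.N) (o : Option (Fin M.N))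
    (x : E2) : 0 ≤ M.sideSq w i o x := by
  cases o <;> simp only [sideSq] <;> positivity

lemma avg_sq_le (M : Mesh s k Ω) (w : Fin M.N → E2 → ℝ) (i : Fin M.N) (o : Option (Fin M.N))
    (x : E2) : M.avg w i o x ^ 2 ≤ M.sideSq w i o x := by
  cases o
  · exact le_rfl
  · simp only [avg, sideSq]
    rename_i j
    nlinarith [sq_nonneg (w i x - w j x)]

lemma IsDensity.bounds {M : Mesh s k Ω} (hh : M.IsDensity κ h) {i : Fin M.N} {x : E2}
    (hx : x ∈ M.T i) (hκ : 0 < κ) : 0 < h x ∧ M.size i / κ ≤ h x ∧ h x ≤ κ * M.size i :=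
  ⟨(hh.2 i x hx).1, (div_le_iff₀' hκ).2 (hh.2 i x hx).2.1, (hh.2 i x hx).2.2⟩

section Skeleton

variable {M : Mesh s k Ω}

lemma integrableOn_pow_mul (hκ : 0 < κ) (hh : M.IsDensity κ h)
    (hΩ : IsLipschitzDomain Ω) (hΓ : IsDirichletPart Ω Γ) (p : ℕ) {i : Fin M.N}
    {o : Option (Fin M.N)} {f : E2 → ℝ} (hf : IntegrableOn f (M.edge Γ i o) μH[1]) :
    IntegrableOn (fun x => h x ^ p * f x) (M.edge Γ i o) μH[1] ∧
      IntegrableOn (fun x => (h x ^ p)⁻¹ * f x) (M.edge Γ i o) μH[1] := by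
  have hm := M.measurableSet_edge hΩ hΓ i o
  have hs := M.size_pos i
  constructor
  · refine Integrable.bdd_mul (c := (κ * M.size i) ^ p) hf (hh.1.pow_const p).aestronglyMeasurable ?_
    refine (ae_restrict_iff' hm).2 (Eventually.of_forall fun x hx => ?_)
    obtain ⟨h0, -, h2⟩ := hh.bounds (M.edge_subset_left Γ i o hx) hκ
    rw [Real.norm_of_nonneg (by positivity)]
    gcongr
  · refine Integrable.bdd_mul (c := ((M.size i / κ) ^ p)⁻¹) hf
      (hh.1.pow_const p).inv.aestronglyMeasurable ?_
    refine (ae_restrict_iff' hm).2 (Eventually.of_forall fun x hx => ?_)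
    obtain ⟨h0, h1, -⟩ := hh.bounds (M.edge_subset_left Γ i o hx) hκ
    rw [Real.norm_of_nonneg (by positivity)]
    gcongr

lemma memLp_edge_left (H : M.Regular σ) (hΩ : IsLipschitzDomain Ω) (hΓ : IsDirichletPart Ω Γ)
    {i : Fin M.N} {f : E2 → ℝ} (hf : ContinuousOn f (M.T i)) (o : Option (Fin M.N)) :
    MemLp f 2 (μH[1].restrict (M.edge Γ i o)) :=
  memLp_restrict_of_continuousOn hf (M.isCompact_T i) (M.edge_subset_left Γ i o)
    (M.measurableSet_edge hΩ hΓ i o) (H.hausdorffMeasure_edge_lt_top hΩ hΓ i o)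

lemma memLp_edge_right (H : M.Regular σ) (hΩ : IsLipschitzDomain Ω) (hΓ : IsDirichletPart Ω Γ)
    {i j : Fin M.N} {f : E2 → ℝ} (hf : ContinuousOn f (M.T j)) :
    MemLp f 2 (μH[1].restrict (M.edge Γ i (some j))) :=
  memLp_restrict_of_continuousOn hf (M.isCompact_T j) (M.edge_some_subset_right Γ i j)
    (M.measurableSet_edge hΩ hΓ i _) (H.hausdorffMeasure_edge_lt_top hΩ hΓ i _)

lemma integrableOn_sideSq (H : M.Regular σ) (hΩ : IsLipschitzDomain Ω) (hΓ : IsDirichletPart Ω Γ)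
    {w : Fin M.N → E2 → ℝ} (hw : ∀ i, ContinuousOn (w i) (M.T i)) (i : Fin M.N)
    (o : Option (Fin M.N)) : IntegrableOn (M.sideSq w i o) (M.edge Γ i o) μH[1] := by
  cases o with
  | none => exact (memLp_edge_left H hΩ hΓ (hw i) none).integrable_sq
  | some j =>
    exact (memLp_edge_left H hΩ hΓ (hw i) (some j)).integrable_sq.add
      (memLp_edge_right H hΩ hΓ (hw j)).integrable_sq

lemma abs_skeletonIntegral_le (hΩ : IsLipschitzDomain Ω)
    (hΓ : IsDirichletPart Ω Γ) {F G : Fin M.N → Option (Fin M.N) → E2 → ℝ}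
    (hF : ∀ i o, IntegrableOn (F i o) (M.edge Γ i o) μH[1])
    (hGF : ∀ i o, ∀ x ∈ M.edge Γ i o, |G i o x| ≤ F i o x) :
    |M.skeletonIntegral Γ G| ≤ M.skeletonIntegral Γ F := by
  refine (Finset.abs_sum_le_sum_abs _ _).trans (Finset.sum_le_sum fun i _ => ?_)
  refine (Finset.abs_sum_le_sum_abs _ _).trans (Finset.sum_le_sum fun o _ => ?_)
  exact norm_integral_le_of_norm_le (f := G i o) (hF i o) ((ae_restrict_iff'
    (M.measurableSet_edge hΩ hΓ i o)).2 (Eventually.of_forall fun x hx => hGF i o x hx))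

lemma skeletonIntegral_add {F G : Fin M.N → Option (Fin M.N) → E2 → ℝ}
    (hF : ∀ i o, IntegrableOn (F i o) (M.edge Γ i o) μH[1])
    (hG : ∀ i o, IntegrableOn (G i o) (M.edge Γ i o) μH[1]) :
    M.skeletonIntegral Γ (fun i o x => F i o x + G i o x) =
      M.skeletonIntegral Γ F + M.skeletonIntegral Γ G := by
  simp only [skeletonIntegral, ← Finset.sum_add_distrib]
  exact Finset.sum_congr rfl fun i _ => Finset.sum_congr rfl fun o _ => integral_add (hF i o) (hG i o)

lemma skeletonIntegral_const_mul (c : ℝ) (F : Fin M.N → Option (Fin M.N) → E2 → ℝ) :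
    M.skeletonIntegral Γ (fun i o x => c * F i o x) = c * M.skeletonIntegral Γ F := by
  simp only [skeletonIntegral, Finset.mul_sum, integral_const_mul]

lemma skeletonIntegral_sum {ι : Type*} (S : Finset ι)
    {F : ι → Fin M.N → Option (Fin M.N) → E2 → ℝ}
    (hF : ∀ a ∈ S, ∀ i o, IntegrableOn (F a i o) (M.edge Γ i o) μH[1]) :
    M.skeletonIntegral Γ (fun i o x => ∑ a ∈ S, F a i o x) =
      ∑ a ∈ S, M.skeletonIntegral Γ (F a) := by
  have h1 : ∀ i o, ∫ x in M.edge Γ i o, ∑ a ∈ S, F a i o x ∂μH[1] =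
      ∑ a ∈ S, ∫ x in M.edge Γ i o, F a i o x ∂μH[1] := fun i o =>
    integral_finsetSum S fun a ha => hF a ha i o
  simp only [skeletonIntegral, h1]
  exact (Finset.sum_congr rfl fun i _ => Finset.sum_comm).trans Finset.sum_comm

lemma integral_edge_le (H : M.Regular σ) {S : Set E2} {i : Fin M.N}
    (hS : S ⊆ M.rim i) {f : E2 → ℝ} {B : ℝ} (hB : 0 ≤ B)
    (hf : ∀ x ∈ S, |f x| ≤ B) :
    ∫ x in S, f x ∂μH[1] ≤ σ * (μH[1] (refBoundary s)).toReal * (M.size i * B) := by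
  have h1 : μH[1] S < ⊤ := (measure_mono hS).trans_lt (H.hausdorffMeasure_rim_lt_top i)
  have h2 := norm_setIntegral_le_of_norm_le_const h1 (f := f) (C := B) fun x hx => hf x hx
  refine (le_abs_self _).trans (h2.trans ?_)
  have h3 := mul_le_mul_of_nonneg_left (H.hausdorffMeasure_le hS) hB
  rw [Measure.real]
  linarith

end Skeleton

/-- Scaled trace inequality, summed over the skeleton. -/
theorem exists_skeleton_trace_le (s : RefShape) (k : ℕ) (σ κ : ℝ) (hκ : 0 < κ) (p : ℕ) :
    ∃ C : ℝ, 0 ≤ C ∧ ∀ (Ω Γ : Set E2) (M : Mesh s k Ω) (h : E2 → ℝ), IsLipschitzDomain Ω →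
      IsDirichletPart Ω Γ → M.Regular σ → M.IsDensity κ h →
      ∀ (w : Fin M.N → E2 → ℝ) (b : Fin M.N → ℝ), (∀ i, ContinuousOn (w i) (M.T i)) →
        (∀ i, ∀ x ∈ M.T i, w i x ^ 2 ≤ b i) →
        M.skeletonIntegral Γ (fun i o x => h x ^ p * M.sideSq w i o x) ≤
          C * ∑ i, M.size i ^ (p + 1) * b i := by
  obtain ⟨C, hC, hcard⟩ := exists_card_neighbors_le s k σ κ hκ
  -- Length of the element boundary per unit of size, times the bound on `h ^ p` per `p`-th power of
  -- size. The absolute value makes `c` nonnegative before a mesh, and with it the sign of `σ`, is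
  -- given.
  set c := |σ| * (μH[1] (refBoundary s)).toReal * κ ^ p with hc
  refine ⟨c * (2 * C + 1), by positivity, fun Ω Γ M h hΩ hΓ H hh w b hwc hwb => ?_⟩
  have hc' : c = σ * (μH[1] (refBoundary s)).toReal * κ ^ p := by rw [hc, abs_of_pos H.pos]
  have hc0 : 0 ≤ c := by positivity
  have hb : ∀ i, 0 ≤ b i := fun i => by
    obtain ⟨x, hx⟩ := nonempty_interior_refElement s
    exact (sq_nonneg _).trans (hwb i _ ⟨x, interior_subset hx, rfl⟩)
  set A : Fin M.N → ℝ := fun i => M.size i ^ (p + 1) * b i with hA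
  have hA0 : ∀ i, 0 ≤ A i := fun i => mul_nonneg (pow_nonneg (M.size_pos i).le _) (hb i)
  have hone : ∀ (S : Set E2) (i : Fin M.N), S ⊆ M.rim i → S ⊆ M.T i →
      ∫ x in S, h x ^ p * w i x ^ 2 ∂μH[1] ≤ c * A i := by
    intro S i hSr hST
    have hsz := M.size_pos i
    refine (integral_edge_le H hSr (B := (κ * M.size i) ^ p * b i)
      (mul_nonneg (by positivity) (hb i)) fun x hx => ?_).trans (le_of_eq ?_)
    · obtain ⟨h0, -, h2⟩ := hh.bounds (hST hx) hκ
      rw [abs_of_nonneg (by positivity)]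
      gcongr
      exact hwb i x (hST hx)
    · rw [hc', hA]; ring
  have hint : ∀ i o, IntegrableOn (fun x => h x ^ p * w i x ^ 2) (M.edge Γ i o) μH[1] := fun i o =>
    (integrableOn_pow_mul hκ hh hΩ hΓ p (memLp_edge_left H hΩ hΓ (hwc i) o).integrable_sq).1
  have hint' : ∀ i j, IntegrableOn (fun x => h x ^ p * w j x ^ 2) (M.edge Γ i (some j)) μH[1] :=
    fun i j => (integrableOn_pow_mul hκ hh hΩ hΓ p
      (memLp_edge_right H hΩ hΓ (hwc j)).integrable_sq).1
  -- Only neighbouring pairs have a nonempty interface, and either side may be charged to its own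
  -- rim. The neighbour count thus bounds the whole sum.
  have hpair : ∀ i j, ∫ x in M.edge Γ i (some j), h x ^ p * M.sideSq w i (some j) x ∂μH[1] ≤
      if j ∈ M.neighbors i then c * (A i + A j) else 0 := by
    intro i j
    split_ifs with hj
    · simp only [sideSq, mul_add]
      rw [integral_add (hint i _) (hint' i j)]
      exact add_le_add
        (hone _ i (H.edge_subset_rim hΩ hΓ i _) (M.edge_subset_left Γ i _))
        (hone _ j (H.edge_some_subset_rim i j) (M.edge_some_subset_right Γ i j))
    · have : M.edge Γ i (some j) = ∅ := by
        refine Set.eq_empty_of_forall_notMem fun x hx => hj (M.mem_neighbors.2 ⟨x, ?_⟩)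
        exact ⟨M.edge_subset_left Γ i _ hx, M.edge_some_subset_right Γ i j hx⟩
      rw [this]; simp
  calc M.skeletonIntegral Γ (fun i o x => h x ^ p * M.sideSq w i o x)
      = ∑ i, ((∫ x in M.edge Γ i none, h x ^ p * M.sideSq w i none x ∂μH[1]) +
          ∑ j, ∫ x in M.edge Γ i (some j), h x ^ p * M.sideSq w i (some j) x ∂μH[1]) := by
        simp only [skeletonIntegral, Fintype.sum_option]
    _ ≤ ∑ i, (c * A i + ∑ j, if j ∈ M.neighbors i then c * (A i + A j) else 0) := by
        refine Finset.sum_le_sum fun i _ => add_le_add ?_ (Finset.sum_le_sum fun j _ => hpair i j)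
        exact hone _ i (H.edge_subset_rim hΩ hΓ i _) (M.edge_subset_left Γ i _)
    _ = c * ∑ i, A i + c * ∑ i, ∑ j ∈ M.neighbors i, (A i + A j) := by
        rw [Finset.mul_sum, Finset.mul_sum, ← Finset.sum_add_distrib]
        refine Finset.sum_congr rfl fun i _ => ?_
        rw [Finset.mul_sum, Finset.sum_ite_mem, Finset.univ_inter]
    _ ≤ c * ∑ i, A i + c * (2 * C * ∑ i, A i) := by
        gcongr
        exact M.sum_neighbors_le (hcard Ω M h H hh) A hA0
    _ = _ := by ring

end Mesh

/-! ### Consistency terms -/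

namespace Mesh

variable {s : RefShape} {k : ℕ} {Ω Γ : Set E2} {σ κ : ℝ} {h : E2 → ℝ} {M : Mesh s k Ω}

lemma memLp_inter_T (hΩ : IsLipschitzDomain Ω) {i : Fin M.N} {f : E2 → ℝ}
    (hf : ContinuousOn f (M.T i)) : MemLp f 2 (volume.restrict (Ω ∩ M.T i)) :=
  memLp_restrict_of_continuousOn hf (M.isCompact_T i) Set.inter_subset_right
    (hΩ.isOpen.measurableSet.inter (M.measurableSet_T i))
    ((measure_mono Set.inter_subset_right).trans_lt (M.isCompact_T i).measure_lt_top)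

lemma brokenIntegral_sum {ι : Type*} (S : Finset ι) {F : ι → Fin M.N → E2 → ℝ}
    (hF : ∀ a ∈ S, ∀ i, IntegrableOn (F a i) (Ω ∩ M.T i) volume) :
    M.brokenIntegral (fun i x => ∑ a ∈ S, F a i x) = ∑ a ∈ S, M.brokenIntegral (F a) := by
  have h1 : ∀ i, ∫ x in Ω ∩ M.T i, ∑ a ∈ S, F a i x = ∑ a ∈ S, ∫ x in Ω ∩ M.T i, F a i x :=
    fun i => integral_finsetSum S fun a ha => hF a ha i
  simp only [brokenIntegral, h1]
  exact Finset.sum_comm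

lemma brokenIntegral_nonneg {F : Fin M.N → E2 → ℝ} (hF : ∀ i x, 0 ≤ F i x) :
    0 ≤ M.brokenIntegral F :=
  Finset.sum_nonneg fun i _ => integral_nonneg (hF i)

lemma skeletonIntegral_nonneg (hΩ : IsLipschitzDomain Ω) (hΓ : IsDirichletPart Ω Γ)
    {F : Fin M.N → Option (Fin M.N) → E2 → ℝ}
    (hF : ∀ i o, ∀ x ∈ M.edge Γ i o, 0 ≤ F i o x) : 0 ≤ M.skeletonIntegral Γ F :=
  Finset.sum_nonneg fun i _ => Finset.sum_nonneg fun o _ =>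
    setIntegral_nonneg (M.measurableSet_edge hΩ hΓ i o) (hF i o)

lemma IsRat.continuousOn_T (H : M.Regular σ) {i : Fin M.N} {m D : ℕ} {w : E2 → ℝ}
    (hw : IsRat s (M.P i) m D w) : ContinuousOn w (M.T i) :=
  (hw.contDiffOn (H.isElement i)).continuousOn

lemma integral_core_sq_le (H : M.Regular σ) (hΩ : IsLipschitzDomain Ω) {i : Fin M.N} {w : E2 → ℝ}
    (hw : ContinuousOn w (M.T i)) :
    ∫ z in M.core i, w z ^ 2 ≤ ∫ z in Ω ∩ M.T i, w z ^ 2 :=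
  setIntegral_mono_set (memLp_inter_T hΩ hw).integrable_sq
    (Eventually.of_forall fun _ => sq_nonneg _)
    (Set.subset_inter (H.core_subset hΩ i) (M.core_subset_T i)).eventuallyLE

/-- One power of size comes from the weight and one from the edge length; together they cancel the
`h⁻²` of the pointwise estimate. -/
theorem exists_skeleton_sq_le (s : RefShape) (k m D : ℕ) (σ κ : ℝ) (hκ : 0 < κ) :
    ∃ C : ℝ, 0 ≤ C ∧ ∀ (Ω Γ : Set E2) (M : Mesh s k Ω) (h : E2 → ℝ), IsLipschitzDomain Ω →
      IsDirichletPart Ω Γ → M.Regular σ → M.IsDensity κ h →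
      ∀ w : Fin M.N → E2 → ℝ, (∀ i, IsRat s (M.P i) m D (w i)) →
        M.skeletonIntegral Γ (fun i o x => h x ^ 1 * M.sideSq w i o x) ≤
          C * M.brokenIntegral fun i x => w i x ^ 2 := by
  obtain ⟨C₁, hC₁, h₁⟩ := exists_skeleton_trace_le s k σ κ hκ 1
  obtain ⟨C₂, hC₂, h₂⟩ := exists_sq_le_integral_of_isRat s k m D σ
  refine ⟨C₁ * C₂, by positivity, fun Ω Γ M h hΩ hΓ H hh w hw => ?_⟩
  have hc := fun i => IsRat.continuousOn_T H (hw i)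
  refine (h₁ Ω Γ M h hΩ hΓ H hh w (fun i => C₂ / M.size i ^ 2 * ∫ z in M.core i, w i z ^ 2) hc
    ?_).trans ?_
  · rintro i _ ⟨x, hx, rfl⟩
    exact h₂ _ _ _ (H.isElement i) (hw i) x hx
  · rw [mul_assoc, brokenIntegral, Finset.mul_sum (a := C₂)]
    refine mul_le_mul_of_nonneg_left (Finset.sum_le_sum fun i _ => ?_) hC₁
    have := M.size_pos i
    calc M.size i ^ (1 + 1) * (C₂ / M.size i ^ 2 * ∫ z in M.core i, w i z ^ 2)
        = C₂ * ∫ z in M.core i, w i z ^ 2 := by field_simp; ring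
      _ ≤ _ := by exact mul_le_mul_of_nonneg_left (integral_core_sq_le H hΩ (hc i)) (by positivity)

/-- The inverse estimate costs another `h⁻²` after squaring, which the weight `h ^ 3` in place of
`h` pays for. -/
theorem exists_skeleton_pd_sq_le (s : RefShape) (k m D : ℕ) (σ κ : ℝ) (hκ : 0 < κ) :
    ∃ C : ℝ, 0 ≤ C ∧ ∀ (Ω Γ : Set E2) (M : Mesh s k Ω) (h : E2 → ℝ), IsLipschitzDomain Ω →
      IsDirichletPart Ω Γ → M.Regular σ → M.IsDensity κ h →
      ∀ w : Fin M.N → E2 → ℝ, (∀ i, IsRat s (M.P i) m D (w i)) → ∀ a,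
        M.skeletonIntegral Γ
            (fun i o x => h x ^ 3 * M.sideSq (fun i => pd (M.T i) a (w i)) i o x) ≤
          C * M.brokenIntegral fun i x => w i x ^ 2 := by
  obtain ⟨C₁, hC₁, h₁⟩ := exists_skeleton_trace_le s k σ κ hκ 3
  obtain ⟨C₂, hC₂, h₂⟩ := exists_sq_le_integral_of_isRat s k m D σ
  obtain ⟨C₃, hC₃, h₃⟩ := exists_abs_pd_le_of_isRat s k m D σ
  refine ⟨C₁ * (C₃ ^ 2 * C₂), by positivity, fun Ω Γ M h hΩ hΓ H hh w hw a => ?_⟩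
  have hc := fun i => IsRat.continuousOn_T H (hw i)
  set J : Fin M.N → ℝ := fun i => ∫ z in M.core i, w i z ^ 2 with hJ
  have hJ0 : ∀ i, 0 ≤ J i := fun i => integral_nonneg fun _ => sq_nonneg _
  refine (h₁ Ω Γ M h hΩ hΓ H hh _ (fun i => (C₃ / M.size i) ^ 2 * (C₂ / M.size i ^ 2 * J i))
    (fun i => IsRat.continuousOn_T H ((hw i).pd (H.isElement i) a)) ?_).trans ?_
  · rintro i _ ⟨x, hx, rfl⟩
    have hs := M.size_pos i
    have hB : 0 ≤ C₂ / M.size i ^ 2 * J i := mul_nonneg (by positivity) (hJ0 i)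
    have h4 := h₃ _ _ _ (√(C₂ / M.size i ^ 2 * J i)) (H.isElement i) (hw i)
      (fun x hx => Real.abs_le_sqrt (h₂ _ _ _ (H.isElement i) (hw i) x hx)) a x hx
    have h5 := pow_le_pow_left₀ (abs_nonneg _) h4 2
    rw [sq_abs, mul_pow, Real.sq_sqrt hB] at h5
    exact h5
  · rw [mul_assoc, brokenIntegral, Finset.mul_sum (a := C₃ ^ 2 * C₂)]
    refine mul_le_mul_of_nonneg_left (Finset.sum_le_sum fun i _ => ?_) hC₁
    have := M.size_pos i
    calc M.size i ^ (3 + 1) * ((C₃ / M.size i) ^ 2 * (C₂ / M.size i ^ 2 * J i))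
        = C₃ ^ 2 * C₂ * J i := by field_simp; ring
      _ ≤ _ := by exact mul_le_mul_of_nonneg_left (integral_core_sq_le H hΩ (hc i)) (by positivity)

/-- Weighted Young inequality on the skeleton. -/
lemma abs_skeletonIntegral_mul_le {ι : Type*} [Fintype ι] (hκ : 0 < κ) (hh : M.IsDensity κ h)
    (hΩ : IsLipschitzDomain Ω) (hΓ : IsDirichletPart Ω Γ) (p : ℕ) {ε : ℝ} (hε : 0 < ε)
    {X Y : ι → Fin M.N → Option (Fin M.N) → E2 → ℝ} {Q : Fin M.N → Option (Fin M.N) → E2 → ℝ}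
    (hQ : ∀ i o, IntegrableOn (Q i o) (M.edge Γ i o) μH[1])
    (hX : ∀ i o x, ∑ a, X a i o x ^ 2 ≤ Q i o x)
    (hY : ∀ a i o, MemLp (Y a i o) 2 (μH[1].restrict (M.edge Γ i o))) :
    |M.skeletonIntegral Γ fun i o x => ∑ a, X a i o x * Y a i o x| ≤
      ε * M.skeletonIntegral Γ (fun i o x => h x ^ p * Q i o x) +
      (4 * ε)⁻¹ * M.skeletonIntegral Γ
        (fun i o x => (h x ^ p)⁻¹ * ∑ a, Y a i o x * Y a i o x) := by
  have hY' : ∀ i o, IntegrableOn (fun x => ∑ a, Y a i o x * Y a i o x) (M.edge Γ i o) μH[1] :=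
    fun i o => integrable_finsetSum _ fun a _ => (hY a i o).integrable_mul (hY a i o)
  have i1 := fun i o => (integrableOn_pow_mul hκ hh hΩ hΓ p (hQ i o)).1.const_mul ε
  have i2 := fun i o => (integrableOn_pow_mul hκ hh hΩ hΓ p (hY' i o)).2.const_mul (4 * ε)⁻¹
  rw [← skeletonIntegral_const_mul, ← skeletonIntegral_const_mul, ← skeletonIntegral_add i1 i2]
  refine abs_skeletonIntegral_le hΩ hΓ (fun i o => (i1 i o).add (i2 i o)) fun i o x hx => ?_
  have hh0 := (hh.bounds (M.edge_subset_left Γ i o hx) hκ).1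
  have ht : 0 < h x ^ p := pow_pos hh0 p
  calc |∑ a, X a i o x * Y a i o x| ≤ ∑ a, |X a i o x * Y a i o x| :=
        Finset.abs_sum_le_sum_abs _ _
    _ ≤ ∑ a, (ε * h x ^ p * X a i o x ^ 2 +
          (4 * ε)⁻¹ * (h x ^ p)⁻¹ * (Y a i o x * Y a i o x)) := by
        refine Finset.sum_le_sum fun a _ => ?_
        generalize X a i o x = u
        generalize Y a i o x = v
        generalize h x ^ p = t at ht
        have e : ε * t * u ^ 2 + (4 * ε)⁻¹ * t⁻¹ * (v * v) - |u * v|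
            = (2 * ε * t * |u| - |v|) ^ 2 / (4 * ε * t) := by
          rw [abs_mul, ← sq_abs u, ← abs_mul_abs_self v]
          field_simp
          ring
        have : 0 ≤ (2 * ε * t * |u| - |v|) ^ 2 / (4 * ε * t) := by positivity
        linarith
    _ = ε * h x ^ p * ∑ a, X a i o x ^ 2 +
          (4 * ε)⁻¹ * (h x ^ p)⁻¹ * ∑ a, Y a i o x * Y a i o x := by
        rw [Finset.sum_add_distrib, Finset.mul_sum, Finset.mul_sum]
    _ ≤ _ := by
        have := mul_le_mul_of_nonneg_left (hX i o x) (by positivity : 0 ≤ ε * h x ^ p)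
        linarith

end Mesh

lemma abs_outerNormal_apply_le (T : Set E2) (x : E2) (b : Fin 2) : |outerNormal T x b| ≤ 1 := by
  have h1 : ‖outerNormal T x‖ ≤ 1 := by
    unfold outerNormal
    split_ifs with hn
    · exact hn.choose_spec.1.le
    · simp
  exact (PiLp.norm_apply_le (outerNormal T x) b).trans h1

namespace DGField

variable {s : RefShape} {k : ℕ} {Ω Γ : Set E2} {σ κ : ℝ} {h : E2 → ℝ} {M : Mesh s k Ω}
  {y : DGField M}

lemma IsDG.isRat_val (hy : y.IsDG) (n : Fin 3) (i : Fin M.N) :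
    IsRat s (M.P i) 0 (2 * k) (y.val i n) := by
  obtain ⟨p, hp, h⟩ := hy i n
  refine ⟨p, totalDegree_le_of_mem_refPoly hp, fun x hx => ?_⟩
  rw [pow_zero, one_mul]
  exact h x hx

lemma IsDG.isRat_d1 (hy : y.IsDG) (H : M.Regular σ) (n : Fin 3) (a : Fin 2) (i : Fin M.N) :
    IsRat s (M.P i) 2 (2 * k + 6 * k) (y.d1 n a i) :=
  (hy.isRat_val n i).pd (H.isElement i) a

lemma IsDG.isRat_d2 (hy : y.IsDG) (H : M.Regular σ) (n : Fin 3) (a b : Fin 2) (i : Fin M.N) :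
    IsRat s (M.P i) 4 (2 * k + 6 * k + 6 * k) (y.d2 n a b i) :=
  (hy.isRat_d1 H n a i).pd (H.isElement i) b

lemma IsDG.isRat_d3 (hy : y.IsDG) (H : M.Regular σ) (n : Fin 3) (a b c : Fin 2) (i : Fin M.N) :
    IsRat s (M.P i) 6 (2 * k + 6 * k + 6 * k + 6 * k) (y.d3 n a b c i) :=
  (hy.isRat_d2 H n a b i).pd (H.isElement i) c

lemma sum_avgNormalGrad_sq_le (y : DGField M) (i : Fin M.N) (o : Option (Fin M.N)) (x : E2) :
    ∑ q : Fin 3 × Fin 2, y.avgNormalGrad q.1 q.2 i o x ^ 2 ≤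
      ∑ r : Fin 3 × Fin 2 × Fin 2, 2 * M.sideSq (y.d2 r.1 r.2.1 r.2.2) i o x := by
  simp only [Fintype.sum_prod_type]
  refine Finset.sum_le_sum fun n _ => Finset.sum_le_sum fun a _ => ?_
  simp only [avgNormalGrad, Fin.sum_univ_two]
  have h0 := M.avg_sq_le (y.d2 n a 0) i o x
  have h1 := M.avg_sq_le (y.d2 n a 1) i o x
  have n0 := (sq_le_one_iff_abs_le_one _).2 (abs_outerNormal_apply_le (M.T i) x 0)
  have n1 := (sq_le_one_iff_abs_le_one _).2 (abs_outerNormal_apply_le (M.T i) x 1)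
  generalize M.avg _ i o x = u at *
  generalize M.avg _ i o x = v at *
  generalize outerNormal (M.T i) x 0 = p at *
  generalize outerNormal (M.T i) x 1 = q at *
  have e0 := mul_le_mul_of_nonneg_right n0 (sq_nonneg u)
  have e1 := mul_le_mul_of_nonneg_right n1 (sq_nonneg v)
  nlinarith [sq_nonneg (p * u - q * v)]

lemma avg_sum_eq (y : DGField M) (n : Fin 3) (b : Fin 2) (i : Fin M.N) (o : Option (Fin M.N))
    (x : E2) : M.avg (fun l z => ∑ a, y.d3 n a a b l z) i o x =
      M.avg (y.d3 n 0 0 b) i o x + M.avg (y.d3 n 1 1 b) i o x := by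
  cases o <;> simp only [Mesh.avg, Fin.sum_univ_two]
  ring

lemma sum_avgNormalLap_sq_le (y : DGField M) (i : Fin M.N) (o : Option (Fin M.N)) (x : E2) :
    ∑ n, y.avgNormalLap n i o x ^ 2 ≤
      ∑ r : Fin 3 × Fin 2 × Fin 2, 4 * M.sideSq (y.d3 r.1 r.2.1 r.2.1 r.2.2) i o x := by
  simp only [Fintype.sum_prod_type]
  refine Finset.sum_le_sum fun n _ => ?_
  simp only [avgNormalLap, avg_sum_eq, ← Finset.mul_sum]
  simp only [Fin.sum_univ_two]
  have h00 := M.avg_sq_le (y.d3 n 0 0 0) i o x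
  have h01 := M.avg_sq_le (y.d3 n 0 0 1) i o x
  have h10 := M.avg_sq_le (y.d3 n 1 1 0) i o x
  have h11 := M.avg_sq_le (y.d3 n 1 1 1) i o x
  have n0 := (sq_le_one_iff_abs_le_one _).2 (abs_outerNormal_apply_le (M.T i) x 0)
  have n1 := (sq_le_one_iff_abs_le_one _).2 (abs_outerNormal_apply_le (M.T i) x 1)
  generalize outerNormal (M.T i) x 0 = p at *
  generalize outerNormal (M.T i) x 1 = q at *
  generalize M.avg (y.d3 n 0 0 0) i o x = a at *
  generalize M.avg (y.d3 n 0 0 1) i o x = b at *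
  generalize M.avg (y.d3 n 1 1 0) i o x = c at *
  generalize M.avg (y.d3 n 1 1 1) i o x = d at *
  have e0 := mul_le_mul_of_nonneg_right n0 (sq_nonneg (a + c))
  have e1 := mul_le_mul_of_nonneg_right n1 (sq_nonneg (b + d))
  have e2 : (p * (a + c) + q * (b + d)) ^ 2 ≤ 2 * (p ^ 2 * (a + c) ^ 2 + q ^ 2 * (b + d) ^ 2) := by
    nlinarith [sq_nonneg (p * (a + c) - q * (b + d))]
  nlinarith [sq_nonneg (a - c), sq_nonneg (b - d)]

lemma IsDG.memLp_jump (hy : y.IsDG) (H : M.Regular σ) (hΩ : IsLipschitzDomain Ω)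
    (hΓ : IsDirichletPart Ω Γ) (n : Fin 3) (hb : MemLp (y.bdVal n) 2 (μH[1].restrict Γ))
    (i : Fin M.N) (o : Option (Fin M.N)) :
    MemLp (y.jump n i o) 2 (μH[1].restrict (M.edge Γ i o)) := by
  have hc := fun i => Mesh.IsRat.continuousOn_T H (hy.isRat_val n i)
  cases o with
  | none =>
    exact (Mesh.memLp_edge_left H hΩ hΓ (hc i) none).sub
      (hb.mono_measure (Measure.restrict_mono Set.inter_subset_right le_rfl))
  | some j =>
    exact (Mesh.memLp_edge_left H hΩ hΓ (hc i) (some j)).sub (Mesh.memLp_edge_right H hΩ hΓ (hc j))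

lemma IsDG.memLp_jumpGrad (hy : y.IsDG) (H : M.Regular σ) (hΩ : IsLipschitzDomain Ω)
    (hΓ : IsDirichletPart Ω Γ) (n : Fin 3) (a : Fin 2)
    (hb : MemLp (y.bdGrad n a) 2 (μH[1].restrict Γ)) (i : Fin M.N) (o : Option (Fin M.N)) :
    MemLp (y.jumpGrad n a i o) 2 (μH[1].restrict (M.edge Γ i o)) := by
  have hc := fun i => Mesh.IsRat.continuousOn_T H (hy.isRat_d1 H n a i)
  cases o with
  | none =>
    exact (Mesh.memLp_edge_left H hΩ hΓ (hc i) none).sub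
      (hb.mono_measure (Measure.restrict_mono Set.inter_subset_right le_rfl))
  | some j =>
    exact (Mesh.memLp_edge_left H hΩ hΓ (hc i) (some j)).sub (Mesh.memLp_edge_right H hΩ hΓ (hc j))

lemma IsDG.hessInner_self (hy : y.IsDG) (H : M.Regular σ) (hΩ : IsLipschitzDomain Ω) :
    hessInner M y y = ∑ r : Fin 3 × Fin 2 × Fin 2,
      M.brokenIntegral fun i x => y.d2 r.1 r.2.1 r.2.2 i x ^ 2 := by
  rw [← Mesh.brokenIntegral_sum]
  · simp only [hessInner, Fintype.sum_prod_type, sq]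
  · exact fun r _ i => (Mesh.memLp_inter_T hΩ
      (Mesh.IsRat.continuousOn_T H (hy.isRat_d2 H r.1 r.2.1 r.2.2 i))).integrable_sq

/-- The consistency terms are controlled by the broken Hessian and the penalty terms. -/
theorem exists_abs_cons_le (s : RefShape) (k : ℕ) (σ κ : ℝ) (hκ : 0 < κ) :
    ∃ C : ℝ, 0 ≤ C ∧ ∀ (Ω Γ : Set E2) (M : Mesh s k Ω) (h : E2 → ℝ), IsLipschitzDomain Ω →
      IsDirichletPart Ω Γ → M.Regular σ → M.IsDensity κ h →
      ∀ y : DGField M, y.IsDG → (∀ n, MemLp (y.bdVal n) 2 (μH[1].restrict Γ)) →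
        (∀ n a, MemLp (y.bdGrad n a) 2 (μH[1].restrict Γ)) → ∀ ε > 0,
        |consGrad M Γ y y| ≤ ε * (C * hessInner M y y) + (4 * ε)⁻¹ * penGrad M Γ h y y ∧
        |consLap M Γ y y| ≤ ε * (C * hessInner M y y) + (4 * ε)⁻¹ * penVal M Γ h y y := by
  obtain ⟨C₁, hC₁, h₁⟩ := Mesh.exists_skeleton_sq_le s k 4 (2 * k + 6 * k + 6 * k) σ κ hκ
  obtain ⟨C₂, hC₂, h₂⟩ := Mesh.exists_skeleton_pd_sq_le s k 4 (2 * k + 6 * k + 6 * k) σ κ hκ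
  -- The factor `2` comes from the two components of the normal derivative. The factor `8` is `4`
  -- from the normal derivative of the Laplacian, times two because each pure second derivative is
  -- differentiated in both directions.
  refine ⟨2 * C₁ + 8 * C₂, by positivity, fun Ω Γ M h hΩ hΓ H hh y hy hbv hbg ε hε => ?_⟩
  have hB := hy.hessInner_self H hΩ
  have hnn : ∀ r : Fin 3 × Fin 2 × Fin 2,
      0 ≤ M.brokenIntegral fun i x => y.d2 r.1 r.2.1 r.2.2 i x ^ 2 := fun r =>
    Mesh.brokenIntegral_nonneg fun _ _ => sq_nonneg _
  have hB0 : 0 ≤ hessInner M y y := hB ▸ Finset.sum_nonneg fun r _ => hnn r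
  constructor
  · have hQ := fun i o (r : Fin 3 × Fin 2 × Fin 2) => (Mesh.integrableOn_sideSq H hΩ hΓ
      (fun i => Mesh.IsRat.continuousOn_T H (hy.isRat_d2 H r.1 r.2.1 r.2.2 i)) i o).const_mul 2
    have key := Mesh.abs_skeletonIntegral_mul_le hκ hh hΩ hΓ 1 hε
      (X := fun (q : Fin 3 × Fin 2) i o x => y.avgNormalGrad q.1 q.2 i o x)
      (Y := fun q i o x => y.jumpGrad q.1 q.2 i o x)
      (fun i o => integrable_finsetSum Finset.univ fun r _ => hQ i o r) y.sum_avgNormalGrad_sq_le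
      (fun q => hy.memLp_jumpGrad H hΩ hΓ q.1 q.2 (hbg _ _))
    simp only [Finset.mul_sum] at key
    rw [Mesh.skeletonIntegral_sum Finset.univ
      (fun r _ i o => (Mesh.integrableOn_pow_mul hκ hh hΩ hΓ 1 (hQ i o r)).1)] at key
    have e1 : ∑ r : Fin 3 × Fin 2 × Fin 2, M.skeletonIntegral Γ
        (fun i o x => h x ^ 1 * (2 * M.sideSq (y.d2 r.1 r.2.1 r.2.2) i o x)) ≤
        (2 * C₁ + 8 * C₂) * hessInner M y y := by
      refine le_trans ?_ (mul_le_mul_of_nonneg_right (by linarith : 2 * C₁ ≤ 2 * C₁ + 8 * C₂) hB0)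
      rw [hB, Finset.mul_sum]
      refine Finset.sum_le_sum fun r _ => ?_
      simp only [mul_left_comm _ (2 : ℝ)]
      rw [Mesh.skeletonIntegral_const_mul, mul_assoc]
      gcongr
      exact h₁ Ω Γ M h hΩ hΓ H hh _ (hy.isRat_d2 H r.1 r.2.1 r.2.2)
    have e2 := mul_le_mul_of_nonneg_left e1 hε.le
    simp only [consGrad, penGrad]
    simp only [Fintype.sum_prod_type, pow_one, ← Finset.mul_sum] at key e2
    linarith
  · have hQ := fun i o (r : Fin 3 × Fin 2 × Fin 2) => (Mesh.integrableOn_sideSq H hΩ hΓ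
      (fun i => Mesh.IsRat.continuousOn_T H (hy.isRat_d3 H r.1 r.2.1 r.2.1 r.2.2 i)) i o).const_mul 4
    have key := Mesh.abs_skeletonIntegral_mul_le hκ hh hΩ hΓ 3 hε
      (X := fun n i o x => y.avgNormalLap n i o x)
      (Y := fun n i o x => y.jump n i o x)
      (fun i o => integrable_finsetSum Finset.univ fun r _ => hQ i o r) y.sum_avgNormalLap_sq_le
      (fun n => hy.memLp_jump H hΩ hΓ n (hbv _))
    simp only [Finset.mul_sum] at key
    rw [Mesh.skeletonIntegral_sum Finset.univ
      (fun r _ i o => (Mesh.integrableOn_pow_mul hκ hh hΩ hΓ 3 (hQ i o r)).1)] at key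
    have e1 : ∑ r : Fin 3 × Fin 2 × Fin 2, M.skeletonIntegral Γ
        (fun i o x => h x ^ 3 * (4 * M.sideSq (y.d3 r.1 r.2.1 r.2.1 r.2.2) i o x)) ≤
        (2 * C₁ + 8 * C₂) * hessInner M y y := by
      refine le_trans ?_ (mul_le_mul_of_nonneg_right (by linarith : 8 * C₂ ≤ 2 * C₁ + 8 * C₂) hB0)
      -- The third derivative is a first derivative of the second derivative `d2`, so the inverse
      -- estimate is applied to `d2` itself and the Hessian appears rather than `y`.
      have e3 : ∀ r : Fin 3 × Fin 2 × Fin 2, M.skeletonIntegral Γ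
          (fun i o x => h x ^ 3 * (4 * M.sideSq (y.d3 r.1 r.2.1 r.2.1 r.2.2) i o x)) ≤
          4 * C₂ * M.brokenIntegral fun i x => y.d2 r.1 r.2.1 r.2.1 i x ^ 2 := by
        intro r
        simp only [mul_left_comm _ (4 : ℝ)]
        rw [Mesh.skeletonIntegral_const_mul, mul_assoc]
        gcongr
        exact h₂ Ω Γ M h hΩ hΓ H hh _ (hy.isRat_d2 H r.1 r.2.1 r.2.1) r.2.2
      refine (Finset.sum_le_sum fun r _ => e3 r).trans ?_
      rw [hB, ← Finset.mul_sum]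
      simp only [Fintype.sum_prod_type, Finset.mul_sum]
      refine Finset.sum_le_sum fun n _ => ?_
      simp only [Fin.sum_univ_two]
      have := fun a b => mul_nonneg hC₂ (hnn (n, a, b))
      have a0 := this 0 0
      have a1 := this 0 1
      have a2 := this 1 0
      have a3 := this 1 1
      dsimp only at a0 a1 a2 a3
      nlinarith
    have e2 := mul_le_mul_of_nonneg_left e1 hε.le
    simp only [consLap, penVal]
    simp only [← Finset.mul_sum] at key
    linarith

end DGField

/-! ### Broken Poincaré inequality -/

namespace Mesh

variable {s : RefShape} {k : ℕ} {Ω Γ : Set E2} {σ κ : ℝ} {h : E2 → ℝ} {M : Mesh s k Ω}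

/-- Jump of an elementwise defined function, with boundary datum `bd`. -/
def jmp (M : Mesh s k Ω) (w : Fin M.N → E2 → ℝ) (bd : E2 → ℝ) (i : Fin M.N) :
    Option (Fin M.N) → E2 → ℝ
  | some j => fun x => w i x - w j x
  | none => fun x => w i x - bd x

lemma memLp_jmp (H : M.Regular σ) (hΩ : IsLipschitzDomain Ω) (hΓ : IsDirichletPart Ω Γ)
    {w : Fin M.N → E2 → ℝ} (hw : ∀ i, ContinuousOn (w i) (M.T i)) {bd : E2 → ℝ}
    (hb : MemLp bd 2 (μH[1].restrict Γ)) (i : Fin M.N) (o : Option (Fin M.N)) :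
    MemLp (M.jmp w bd i o) 2 (μH[1].restrict (M.edge Γ i o)) := by
  cases o with
  | none =>
    exact (memLp_edge_left H hΩ hΓ (hw i) none).sub
      (hb.mono_measure (Measure.restrict_mono Set.inter_subset_right le_rfl))
  | some j => exact (memLp_edge_left H hΩ hΓ (hw i) (some j)).sub (memLp_edge_right H hΩ hΓ (hw j))

/-- Distinct elements overlap in a null set, so integrals over the elements add up without
multiplicity. -/
lemma sum_setLIntegral_le (H : M.Regular σ) (hΩ : IsLipschitzDomain Ω) (f : E2 → ℝ≥0∞) :
    ∑ i, ∫⁻ x in Ω ∩ M.T i, f x ≤ ∫⁻ x in Ω, f x := by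
  rw [← tsum_fintype (L := .unconditional _), ← lintegral_iUnion₀
    (fun i => (hΩ.isOpen.measurableSet.inter (M.measurableSet_T i)).nullMeasurableSet)]
  · exact lintegral_mono_set (Set.iUnion_subset fun i => Set.inter_subset_left)
  · exact fun i j hij => measure_mono_null
      (Set.inter_subset_inter Set.inter_subset_right Set.inter_subset_right) (H.volume_inter hij)

lemma brokenIntegral_sq_le (H : M.Regular σ) (hΩ : IsLipschitzDomain Ω) {f : E2 → ℝ}
    (hf : MemLp f 2 (volume.restrict Ω)) :
    M.brokenIntegral (fun _ x => f x ^ 2) ≤ ∫ x in Ω, f x ^ 2 := by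
  rw [← ENNReal.ofReal_le_ofReal_iff (integral_nonneg fun _ => sq_nonneg _), brokenIntegral,
    ENNReal.ofReal_sum_of_nonneg fun i _ => integral_nonneg fun _ => sq_nonneg _,
    ofReal_integral_sq hf]
  refine le_trans (le_of_eq (Finset.sum_congr rfl fun i _ => ?_)) (sum_setLIntegral_le H hΩ _)
  exact ofReal_integral_sq (hf.mono_measure (Measure.restrict_mono Set.inter_subset_left le_rfl))

lemma piecewiseC1 (H : M.Regular σ)
    {v : Fin M.N → E2 → ℝ} (hv : ∀ i, ContDiffOn ℝ 1 (v i) (M.T i)) :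
    PiecewiseC1 Ω M.T v where
  isCompact := M.isCompact_T
  cover := fun _ hx => Set.mem_iUnion.2 (M.exists_mem_T (subset_closure hx))
  uniqueDiff i := (H.isElement i).uniqueDiffOn_image
  contDiffOn := hv
  inter i _ hij := ((measure_mono (Set.inter_subset_left.trans (H.inter_subset_rim hij.ne))).trans_lt
    (H.hausdorffMeasure_rim_lt_top i)).ne

lemma size_le_diam (M : Mesh s k Ω) (hΩ : IsLipschitzDomain Ω) (i : Fin M.N) :
    M.size i ≤ Metric.diam (closure Ω) :=
  Metric.diam_mono (M.T_subset_closure i) hΩ.isBounded.closure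

/-- Young's inequality for the product `(a + b)(a - b)`, with weight `t` to match the density. -/
lemma abs_sq_sub_sq_le {t δ a b : ℝ} (ht : 0 < t) (hδ : 0 < δ) :
    |a ^ 2 - b ^ 2| ≤ δ * (t * (a ^ 2 + b ^ 2)) + (2 * δ)⁻¹ * (t⁻¹ * (a - b) ^ 2) := by
  have e : (δ / 2) * (t * (a + b) ^ 2) + (2 * δ)⁻¹ * (t⁻¹ * (a - b) ^ 2) - |a ^ 2 - b ^ 2|
      = (δ * t * |a + b| - |a - b|) ^ 2 / (2 * δ * t) := by
    rw [sq_sub_sq, abs_mul, ← sq_abs (a + b), ← sq_abs (a - b)]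
    field_simp
    ring
  have h1 : 0 ≤ (δ * t * |a + b| - |a - b|) ^ 2 / (2 * δ * t) := by positivity
  have h2 : δ / 2 * (t * (a + b) ^ 2) ≤ δ * (t * (a ^ 2 + b ^ 2)) := by
    nlinarith [mul_nonneg (mul_pos hδ ht).le (sq_nonneg (a - b))]
  linarith

/-- Young's inequality for `2w∇w`; the small multiple of `w ^ 2` is absorbed later. -/
lemma enorm_fderivWithin_sq_le {T : Set E2} (hT : UniqueDiffOn ℝ T) {w : E2 → ℝ}
    (hw : ContDiffOn ℝ 1 w T) {x : E2} (hx : x ∈ T) {ε : ℝ} (hε : 0 < ε) :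
    ‖fderivWithin ℝ (fun z => w z ^ 2) T x‖ ≤
      ε * w x ^ 2 + 2 / ε * ∑ a, pd T a w x ^ 2 := by
  refine (norm_le_sum_apply_single _).trans ?_
  have hd : HasFDerivWithinAt w (fderivWithin ℝ w T x) T x :=
    (hw.differentiableOn one_ne_zero x hx).hasFDerivWithinAt
  have hp : ∀ a, fderivWithin ℝ (fun z => w z ^ 2) T x (EuclideanSpace.single a 1) =
      2 * w x * pd T a w x := by
    intro a
    rw [(hd.pow 2).fderivWithin (hT x hx)]
    simp [pd]
  simp only [hp, Fin.sum_univ_two]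
  have key : ∀ u v : ℝ, |2 * u * v| ≤ ε / 2 * u ^ 2 + 2 / ε * v ^ 2 := by
    intro u v
    have e : ε / 2 * u ^ 2 + 2 / ε * v ^ 2 - |2 * u * v| = (ε * |u| - 2 * |v|) ^ 2 / (2 * ε) := by
      rw [abs_mul, abs_mul, ← sq_abs u, ← sq_abs v, abs_two]
      field_simp
      ring
    have : 0 ≤ (ε * |u| - 2 * |v|) ^ 2 / (2 * ε) := by positivity
    linarith
  have := key (w x) (pd T 0 w x)
  have := key (w x) (pd T 1 w x)
  linarith

section

variable {w : Fin M.N → E2 → ℝ}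

lemma ofReal_brokenIntegral_sq_le (H : M.Regular σ) (hΩ : IsLipschitzDomain Ω)
    (hw : ∀ i, ContinuousOn (w i) (M.T i)) :
    ENNReal.ofReal (M.brokenIntegral fun i x => w i x ^ 2) ≤
      ∫⁻ x in Ω, cellSup M.T (fun i x => w i x ^ 2) x := by
  rw [brokenIntegral, ENNReal.ofReal_sum_of_nonneg fun i _ => integral_nonneg fun _ => sq_nonneg _]
  refine le_trans (Finset.sum_le_sum fun i _ => ?_) (sum_setLIntegral_le H hΩ _)
  rw [ofReal_integral_eq_lintegral_ofReal (memLp_inter_T hΩ (hw i)).integrable_sq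
    (Eventually.of_forall fun x => sq_nonneg _)]
  refine setLIntegral_mono' (hΩ.isOpen.measurableSet.inter (M.measurableSet_T i)) fun x hx => ?_
  refine le_trans ?_ (le_iSup _ i)
  rw [Set.indicator_of_mem hx.2]

lemma lintegral_cellGrad_sq_le (H : M.Regular σ) (hΩ : IsLipschitzDomain Ω)
    (hw : ∀ i, ContDiffOn ℝ 1 (w i) (M.T i)) (hd : ∀ i a, ContinuousOn (pd (M.T i) a (w i)) (M.T i))
    {ε : ℝ} (hε : 0 < ε) :
    ∫⁻ x in Ω, cellGrad M.T (fun i x => w i x ^ 2) x ≤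
      ENNReal.ofReal (ε * (M.brokenIntegral fun i x => w i x ^ 2) +
        2 / ε * ∑ a, M.brokenIntegral fun i x => pd (M.T i) a (w i) x ^ 2) := by
  have hv : ∀ i, ContDiffOn ℝ 1 (fun x => w i x ^ 2) (M.T i) := fun i => (hw i).pow 2
  have hu : ∀ i, UniqueDiffOn ℝ (M.T i) := fun i => (H.isElement i).uniqueDiffOn_image
  have hm : ∀ i, Measurable ((M.T i).indicator
      fun x => ‖fderivWithin ℝ (fun x => w i x ^ 2) (M.T i) x‖ₑ) := fun i =>
    measurable_indicator_of_continuousOn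
      ((hv i).continuousOn_fderivWithin (hu i) le_rfl).enorm (M.measurableSet_T i)
  simp only [cellGrad]
  rw [lintegral_finsetSum _ fun i _ => hm i, ← brokenIntegral_sum Finset.univ fun a _ i =>
    (memLp_inter_T hΩ (hd i a)).integrable_sq]
  simp only [brokenIntegral, Finset.mul_sum (a := ε), Finset.mul_sum (a := 2 / ε),
    ← integral_const_mul, ← Finset.sum_add_distrib]
  have hi1 : ∀ i, IntegrableOn (fun x => ε * w i x ^ 2) (Ω ∩ M.T i) := fun i =>
    (memLp_inter_T hΩ (hw i).continuousOn).integrable_sq.const_mul ε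
  have hi2 : ∀ i, IntegrableOn (fun x => ∑ a, 2 / ε * pd (M.T i) a (w i) x ^ 2) (Ω ∩ M.T i) :=
    fun i => integrable_finsetSum _ fun a _ => (memLp_inter_T hΩ (hd i a)).integrable_sq.const_mul _
  rw [ENNReal.ofReal_sum_of_nonneg]
  · refine Finset.sum_le_sum fun i _ => ?_
    have hi : Integrable (fun x => ε * w i x ^ 2 + ∑ a, 2 / ε * pd (M.T i) a (w i) x ^ 2)
        (volume.restrict (Ω ∩ M.T i)) := (hi1 i).add (hi2 i)
    rw [setLIntegral_indicator (M.measurableSet_T i), Set.inter_comm,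
      ← integral_add (hi1 i) (hi2 i), ofReal_integral_eq_lintegral_ofReal hi]
    · refine setLIntegral_mono' (hΩ.isOpen.measurableSet.inter (M.measurableSet_T i)) fun x hx => ?_
      rw [← ofReal_norm]
      refine ENNReal.ofReal_le_ofReal ((enorm_fderivWithin_sq_le (hu i) (hw i) hx.2 hε).trans ?_)
      rw [Finset.mul_sum]
    · exact Eventually.of_forall fun x => by positivity
  · exact fun i _ => add_nonneg (integral_nonneg fun x => by positivity)
      (integral_nonneg fun x => by positivity)

/-- Interior jumps of `w ^ 2` are split by `abs_sq_sub_sq_le`. On `Γ` the square is at most `2(w -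
bd)² + 2 bd²`. The supremum over the elements at a boundary point, rather than their sum, lets the
datum enter once however many elements meet there. -/
lemma lintegral_jump_sq_add_le (hκ : 0 < κ) (hh : M.IsDensity κ h) (H : M.Regular σ)
    (hΩ : IsLipschitzDomain Ω) (hΓ : IsDirichletPart Ω Γ) (hw : ∀ i, ContinuousOn (w i) (M.T i))
    {bd : E2 → ℝ} (hb : MemLp bd 2 (μH[1].restrict Γ)) {δ : ℝ} (hδ : 0 < δ) :
    (∑ i, ∑ j, if i < j then
        ∫⁻ x in M.T i ∩ M.T j ∩ Ω, ‖w i x ^ 2 - w j x ^ 2‖ₑ ∂μH[1] else 0) +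
      ∫⁻ x in Γ, cellSup M.T (fun i x => w i x ^ 2) x ∂μH[1] ≤
    ENNReal.ofReal (δ * M.skeletonIntegral Γ (fun i o x => h x ^ 1 * M.sideSq w i o x) +
      ((2 * δ)⁻¹ + 2 * κ * Metric.diam (closure Ω)) *
        M.skeletonIntegral Γ (fun i o x => (h x ^ 1)⁻¹ * M.jmp w bd i o x ^ 2) +
      2 * ∫ x in Γ, bd x ^ 2 ∂μH[1]) := by
  -- The first summand serves the interior jumps. The second uses `h ≤ κ * diam` to turn the
  -- unweighted boundary term into one weighted by `h⁻¹`.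
  set c := (2 * δ)⁻¹ + 2 * κ * Metric.diam (closure Ω) with hc
  have hd0 : 0 ≤ 2 * κ * Metric.diam (closure Ω) := mul_nonneg (by positivity) Metric.diam_nonneg
  have hc0 : (2 * δ)⁻¹ ≤ c := by linarith
  have hδ' : 0 < (2 * δ)⁻¹ := by positivity
  set G : Fin M.N → Option (Fin M.N) → E2 → ℝ := fun i o x =>
    δ * (h x ^ 1 * M.sideSq w i o x) + c * ((h x ^ 1)⁻¹ * M.jmp w bd i o x ^ 2) with hGdef
  have i1 := fun i o =>
    (integrableOn_pow_mul hκ hh hΩ hΓ 1 (integrableOn_sideSq H hΩ hΓ hw i o)).1.const_mul δ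
  have i2 := fun i o =>
    (integrableOn_pow_mul hκ hh hΩ hΓ 1 (memLp_jmp H hΩ hΓ hw hb i o).integrable_sq).2.const_mul c
  have hG : ∀ i o, IntegrableOn (G i o) (M.edge Γ i o) μH[1] := fun i o => (i1 i o).add (i2 i o)
  have hpos : ∀ i o, ∀ x ∈ M.edge Γ i o, 0 < h x := fun i o x hx =>
    (hh.2 i x (M.edge_subset_left Γ i o hx)).1
  have hG0 : ∀ i o, ∀ x ∈ M.edge Γ i o, 0 ≤ G i o x := fun i o x hx => by
    have := hpos i o x hx
    have := M.sideSq_nonneg w i o x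
    have : 0 ≤ c := hδ'.le.trans hc0
    positivity
  have hbd : Integrable (fun x => 2 * bd x ^ 2) (μH[1].restrict Γ) := hb.integrable_sq.const_mul 2
  have hsome : ∀ i j, (if i < j then
      ∫⁻ x in M.T i ∩ M.T j ∩ Ω, ‖w i x ^ 2 - w j x ^ 2‖ₑ ∂μH[1] else 0) ≤
      ∫⁻ x in M.edge Γ i (some j), ENNReal.ofReal (G i (some j) x) ∂μH[1] := by
    intro i j
    split_ifs with hij
    · have he : M.edge Γ i (some j) = M.T i ∩ M.T j ∩ Ω := if_pos hij
      rw [← he]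
      refine setLIntegral_mono' (M.measurableSet_edge hΩ hΓ i _) fun x hx => ?_
      rw [← ofReal_norm]
      refine ENNReal.ofReal_le_ofReal ?_
      have ht := hpos i _ x hx
      refine (abs_sq_sub_sq_le ht hδ).trans ?_
      simp only [hGdef, sideSq, jmp, pow_one]
      gcongr
    · exact zero_le
  have hnone : ∫⁻ x in Γ, cellSup M.T (fun i x => w i x ^ 2) x ∂μH[1] ≤
      (∑ i, ∫⁻ x in M.edge Γ i none, ENNReal.ofReal (G i none x) ∂μH[1]) +
        ∫⁻ x in Γ, ENNReal.ofReal (2 * bd x ^ 2) ∂μH[1] := by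
    have he : ∀ i, ∫⁻ x in M.edge Γ i none, ENNReal.ofReal (G i none x) ∂μH[1] =
        ∫⁻ x in Γ, (M.T i).indicator (fun x => ENNReal.ofReal (G i none x)) x ∂μH[1] := fun i => by
      rw [setLIntegral_indicator (M.measurableSet_T i)]; rfl
    have hm : ∀ i, AEMeasurable ((M.T i).indicator (fun x => ENNReal.ofReal (G i none x)))
        (μH[1].restrict Γ) := fun i => by
      rw [aemeasurable_indicator_iff (M.measurableSet_T i),
        Measure.restrict_restrict (M.measurableSet_T i)]
      exact (hG i none).aemeasurable.ennreal_ofReal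
    simp only [he]
    rw [← lintegral_finsetSum' _ fun i _ => hm i,
      ← lintegral_add_right' _ hbd.aemeasurable.ennreal_ofReal]
    refine setLIntegral_mono' hΓ.measurableSet fun x hx => iSup_le fun i => ?_
    by_cases hxi : x ∈ M.T i
    · rw [Set.indicator_of_mem hxi]
      have hxe : x ∈ M.edge Γ i none := ⟨hxi, hx⟩
      have ht := hpos i none x hxe
      have h1 : 2 * (w i x - bd x) ^ 2 ≤ G i none x := by
        have h2 : h x ≤ κ * Metric.diam (closure Ω) := (hh.2 i x hxi).2.2.trans
          (mul_le_mul_of_nonneg_left (M.size_le_diam hΩ i) hκ.le)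
        have h3 : 2 ≤ c * (h x)⁻¹ := by
          rw [← div_eq_mul_inv, le_div_iff₀ ht]
          linarith
        have h4 := mul_le_mul_of_nonneg_right h3 (sq_nonneg (w i x - bd x))
        have h5 : 0 ≤ δ * (h x * w i x ^ 2) := by positivity
        simp only [hGdef, sideSq, jmp, pow_one]
        linarith
      calc ENNReal.ofReal (w i x ^ 2) ≤ ENNReal.ofReal (G i none x + 2 * bd x ^ 2) :=
            ENNReal.ofReal_le_ofReal (by nlinarith [sq_nonneg (w i x - 2 * bd x)])
        _ ≤ ENNReal.ofReal (G i none x) + ENNReal.ofReal (2 * bd x ^ 2) := ENNReal.ofReal_add_le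
        _ ≤ _ := by
            gcongr
            refine le_trans ?_ (Finset.single_le_sum (f := fun i => (M.T i).indicator
              (fun x => ENNReal.ofReal (G i none x)) x) (fun _ _ => zero_le) (Finset.mem_univ i))
            rw [Set.indicator_of_mem hxi]
    · rw [Set.indicator_of_notMem hxi]
      exact zero_le
  have hint0 : ∀ i o, 0 ≤ ∫ x in M.edge Γ i o, G i o x ∂μH[1] := fun i o =>
    setIntegral_nonneg (M.measurableSet_edge hΩ hΓ i o) (hG0 i o)
  have hto : ∀ i o, ENNReal.ofReal (∫ x in M.edge Γ i o, G i o x ∂μH[1]) =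
      ∫⁻ x in M.edge Γ i o, ENNReal.ofReal (G i o x) ∂μH[1] := fun i o =>
    ofReal_integral_eq_lintegral_ofReal (hG i o)
      ((ae_restrict_iff' (M.measurableSet_edge hΩ hΓ i o)).2 (Eventually.of_forall (hG0 i o)))
  have hR : ENNReal.ofReal (M.skeletonIntegral Γ G) =
      ∑ i, ∑ o, ∫⁻ x in M.edge Γ i o, ENNReal.ofReal (G i o x) ∂μH[1] := by
    rw [skeletonIntegral, ENNReal.ofReal_sum_of_nonneg fun i _ =>
      Finset.sum_nonneg fun o _ => hint0 i o]
    refine Finset.sum_congr rfl fun i _ => ?_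
    rw [ENNReal.ofReal_sum_of_nonneg fun o _ => hint0 i o]
    exact Finset.sum_congr rfl fun o _ => hto i o
  rw [← skeletonIntegral_const_mul, ← skeletonIntegral_const_mul, ← skeletonIntegral_add i1 i2,
    ← integral_const_mul, ENNReal.ofReal_add (skeletonIntegral_nonneg hΩ hΓ hG0)
      (integral_nonneg fun x => by positivity), hR,
    ofReal_integral_eq_lintegral_ofReal hbd (Eventually.of_forall fun x => by positivity)]
  refine (add_le_add (Finset.sum_le_sum fun i _ => Finset.sum_le_sum fun j _ => hsome i j)
    hnone).trans (le_of_eq ?_)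
  simp only [Fintype.sum_option, Finset.sum_add_distrib]
  ring

end

/-- Broken Poincaré inequality with jump penalty and boundary datum. -/
theorem exists_broken_poincare (k m D : ℕ) (σ : ℝ) (hκ : 0 < κ) (hΩ : IsLipschitzDomain Ω)
    (hΓ : IsDirichletPart Ω Γ) :
    ∃ C : ℝ, 0 ≤ C ∧ ∀ (M : Mesh s k Ω) (h : E2 → ℝ), M.Regular σ → M.IsDensity κ h →
      ∀ (w : Fin M.N → E2 → ℝ) (bd : E2 → ℝ), (∀ i, IsRat s (M.P i) m D (w i)) →
        MemLp bd 2 (μH[1].restrict Γ) →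
        (M.brokenIntegral fun i x => w i x ^ 2) ≤
          C * ((∑ a, M.brokenIntegral fun i x => pd (M.T i) a (w i) x ^ 2) +
            M.skeletonIntegral Γ (fun i o x => (h x)⁻¹ * M.jmp w bd i o x ^ 2) +
            ∫ x in Γ, bd x ^ 2 ∂μH[1]) := by
  obtain ⟨C₀, hC₀⟩ := isControlled_of_isLipschitzDomain hΩ hΓ
  obtain ⟨C₁, hC₁, h₁⟩ := exists_skeleton_sq_le s k m D σ κ hκ
  -- With these choices the gradient part and the jump part each return at most a quarter of the
  -- left side; for the jump part `C₁` converts the skeleton term into the `L²` norm. Half of the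
  -- left side remains, whence the factor `2` in the constant.
  set ε : ℝ := 1 / (4 * (C₀ + 1)) with hε'
  set δ : ℝ := 1 / (4 * (C₀ + 1) * (C₁ + 1)) with hδ'
  have hC00 : (0 : ℝ) ≤ C₀ := C₀.2
  have hε : 0 < ε := by positivity
  have hδ : 0 < δ := by positivity
  set c := (2 * δ)⁻¹ + 2 * κ * Metric.diam (closure Ω) with hc
  have hd0 : 0 ≤ 2 * κ * Metric.diam (closure Ω) := mul_nonneg (by positivity) Metric.diam_nonneg
  have hc0 : 0 ≤ c := by positivity
  refine ⟨2 * C₀ * (2 / ε + c + 2), by positivity, fun M h H hh w bd hw hb => ?_⟩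
  have hwC : ∀ i, ContDiffOn ℝ 1 (w i) (M.T i) := fun i =>
    ((hw i).contDiffOn (H.isElement i)).of_le (by norm_cast)
  have hwc := fun i => (hwC i).continuousOn
  have hdc : ∀ i a, ContinuousOn (pd (M.T i) a (w i)) (M.T i) := fun i a =>
    IsRat.continuousOn_T H ((hw i).pd (H.isElement i) a)
  have hp := piecewiseC1 H (v := fun i x => w i x ^ 2) fun i => (hwC i).pow 2
  have key := hC₀ _ _ hp.measurable_cellSup (hp.lineVariation hΩ.isOpen)
  have k1 := ofReal_brokenIntegral_sq_le H hΩ hwc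
  have k2 := lintegral_cellGrad_sq_le H hΩ hwC hdc hε
  have k3 := lintegral_jump_sq_add_le hκ hh H hΩ hΓ hwc hb hδ
  have k4 := h₁ Ω Γ M h hΩ hΓ H hh w hw
  set B := M.brokenIntegral fun i x => w i x ^ 2
  set A := ∑ a, M.brokenIntegral fun i x => pd (M.T i) a (w i) x ^ 2
  set Z := M.skeletonIntegral Γ (fun i o x => h x ^ 1 * M.sideSq w i o x)
  have hJ : M.skeletonIntegral Γ (fun i o x => (h x ^ 1)⁻¹ * M.jmp w bd i o x ^ 2) =
    M.skeletonIntegral Γ (fun i o x => (h x)⁻¹ * M.jmp w bd i o x ^ 2) := by simp only [pow_one]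
  rw [hJ] at k3
  have hJ0 : 0 ≤ M.skeletonIntegral Γ (fun i o x => (h x)⁻¹ * M.jmp w bd i o x ^ 2) :=
    skeletonIntegral_nonneg hΩ hΓ fun i o x hx => by
      have := (hh.2 i x (M.edge_subset_left Γ i o hx)).1
      positivity
  set J := M.skeletonIntegral Γ (fun i o x => (h x)⁻¹ * M.jmp w bd i o x ^ 2)
  have hI0 : 0 ≤ ∫ x in Γ, bd x ^ 2 ∂μH[1] := integral_nonneg fun _ => sq_nonneg _
  set I := ∫ x in Γ, bd x ^ 2 ∂μH[1]
  have hZ0 : 0 ≤ Z := skeletonIntegral_nonneg hΩ hΓ fun i o x hx => by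
    have := (hh.2 i x (M.edge_subset_left Γ i o hx)).1
    have := M.sideSq_nonneg w i o x
    positivity
  have hB0 : 0 ≤ B := brokenIntegral_nonneg fun _ _ => sq_nonneg _
  have hA0 : 0 ≤ A := Finset.sum_nonneg fun _ _ => brokenIntegral_nonneg fun _ _ => sq_nonneg _
  have hR0 : 0 ≤ (ε * B + 2 / ε * A) + (δ * Z + c * J + 2 * I) := by positivity
  have hle : B ≤ C₀ * ((ε * B + 2 / ε * A) + (δ * Z + c * J + 2 * I)) := by
    rw [← ENNReal.ofReal_le_ofReal_iff (by positivity)]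
    refine k1.trans (key.trans ?_)
    rw [ENNReal.ofReal_mul hC00, ENNReal.ofReal_coe_nnreal,
      ENNReal.ofReal_add (by positivity) (by positivity)]
    refine mul_le_mul_right ?_ _
    rw [totalVar, add_assoc]
    exact add_le_add k2 k3
  have e1 : C₀ * (ε * B) ≤ B / 4 := by
    have : C₀ * ε ≤ 1 / 4 := by
      rw [hε', mul_one_div, div_le_div_iff₀ (by positivity) (by norm_num)]
      linarith
    nlinarith
  have e2 : C₀ * (δ * Z) ≤ B / 4 := by
    have h2 : C₀ * δ * C₁ ≤ 1 / 4 := by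
      rw [hδ', mul_one_div, div_mul_eq_mul_div, div_le_div_iff₀ (by positivity) (by norm_num)]
      nlinarith [mul_nonneg hC00 hC₁]
    have h3 : C₀ * δ * Z ≤ C₀ * δ * (C₁ * B) := mul_le_mul_of_nonneg_left k4 (by positivity)
    have h4 := mul_le_mul_of_nonneg_right h2 hB0
    linarith
  have e3 : (2 / ε + c + 2) * (A + J + I) ≥ 2 / ε * A + c * J + 2 * I := by
    have a1 : 0 ≤ 2 / ε := by positivity
    nlinarith [mul_nonneg a1 hJ0, mul_nonneg a1 hI0, mul_nonneg hc0 hA0, mul_nonneg hc0 hI0]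
  have e4 := mul_le_mul_of_nonneg_left e3 hC00
  linarith

end Mesh

/-! ### Coercivity -/

namespace Mesh

variable {s : RefShape} {k : ℕ} {Ω : Set E2} {M : Mesh s k Ω} {σ κ : ℝ} {h : E2 → ℝ}

/-- No sign of `σ` is assumed. Enlarging the constant only weakens the conditions, so it may be
taken positive. -/
lemma IsShapeRegular.regular (H : M.IsShapeRegular σ) : M.Regular (max σ 1) where
  pos := lt_max_of_lt_right one_pos
  shape i x hx v := by
    have h1 := (M.size_pos i).le
    obtain ⟨h2, h3⟩ := H i x hx v
    exact ⟨h2.trans (by gcongr; exact le_max_left _ _), h3.trans (by gcongr; exact le_max_left _ _)⟩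

lemma IsDensity.max_one (hh : M.IsDensity κ h) : M.IsDensity (max κ 1) h := by
  refine ⟨hh.1, fun i x hx => ?_⟩
  have h1 := (M.size_pos i).le
  obtain ⟨h0, h2, h3⟩ := hh.2 i x hx
  exact ⟨h0, h2.trans (by gcongr; exact le_max_left _ _), h3.trans (by gcongr; exact le_max_left _ _)⟩

end Mesh

namespace DGField

variable {s : RefShape} {k : ℕ} {Ω Γ : Set E2} {σ κ : ℝ} {h : E2 → ℝ} {M : Mesh s k Ω}
  {y : DGField M}

lemma jump_eq (y : DGField M) (n : Fin 3) : y.jump n = M.jmp (fun i => y.val i n) (y.bdVal n) := by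
  funext i o; cases o <;> rfl

lemma jumpGrad_eq (y : DGField M) (n : Fin 3) (a : Fin 2) :
    y.jumpGrad n a = M.jmp (y.d1 n a) (y.bdGrad n a) := by
  funext i o; cases o <;> rfl

lemma IsDG.penGrad_self (hy : y.IsDG) (hκ : 0 < κ) (hh : M.IsDensity κ h) (H : M.Regular σ)
    (hΩ : IsLipschitzDomain Ω) (hΓ : IsDirichletPart Ω Γ)
    (hb : ∀ n a, MemLp (y.bdGrad n a) 2 (μH[1].restrict Γ)) :
    penGrad M Γ h y y = ∑ n, ∑ a,
      M.skeletonIntegral Γ fun i o x => (h x)⁻¹ * y.jumpGrad n a i o x ^ 2 := by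
  have := Mesh.skeletonIntegral_sum (M := M) (Γ := Γ) (Finset.univ : Finset (Fin 3 × Fin 2))
    (F := fun r i o x => (h x ^ 1)⁻¹ * y.jumpGrad r.1 r.2 i o x ^ 2)
    fun r _ i o => (Mesh.integrableOn_pow_mul hκ hh hΩ hΓ 1
      (hy.memLp_jumpGrad H hΩ hΓ r.1 r.2 (hb _ _) i o).integrable_sq).2
  simp only [Fintype.sum_prod_type, pow_one] at this
  rw [← this]
  simp only [penGrad, Finset.mul_sum, sq]

lemma IsDG.penVal_self (hy : y.IsDG) (hκ : 0 < κ) (hh : M.IsDensity κ h) (H : M.Regular σ)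
    (hΩ : IsLipschitzDomain Ω) (hΓ : IsDirichletPart Ω Γ)
    (hb : ∀ n, MemLp (y.bdVal n) 2 (μH[1].restrict Γ)) :
    penVal M Γ h y y = ∑ n,
      M.skeletonIntegral Γ fun i o x => (h x ^ 3)⁻¹ * y.jump n i o x ^ 2 := by
  rw [← Mesh.skeletonIntegral_sum (Finset.univ : Finset (Fin 3))
    (F := fun r i o x => (h x ^ 3)⁻¹ * y.jump r i o x ^ 2)
    fun r _ i o => (Mesh.integrableOn_pow_mul hκ hh hΩ hΓ 3
      (hy.memLp_jump H hΩ hΓ r (hb _) i o).integrable_sq).2]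
  simp only [penVal, Finset.mul_sum, sq]

lemma penGrad_self_nonneg (hΩ : IsLipschitzDomain Ω) (hΓ : IsDirichletPart Ω Γ)
    (hh : M.IsDensity κ h) (y : DGField M) : 0 ≤ penGrad M Γ h y y :=
  Mesh.skeletonIntegral_nonneg hΩ hΓ fun i o x hx => mul_nonneg
    (inv_nonneg.2 (hh.2 i x (M.edge_subset_left Γ i o hx)).1.le)
    (Finset.sum_nonneg fun _ _ => Finset.sum_nonneg fun _ _ => mul_self_nonneg _)

lemma penVal_self_nonneg (hΩ : IsLipschitzDomain Ω) (hΓ : IsDirichletPart Ω Γ)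
    (hh : M.IsDensity κ h) (y : DGField M) : 0 ≤ penVal M Γ h y y :=
  Mesh.skeletonIntegral_nonneg hΩ hΓ fun i o x hx => mul_nonneg
    (inv_nonneg.2 (pow_nonneg (hh.2 i x (M.edge_subset_left Γ i o hx)).1.le 3))
    (Finset.sum_nonneg fun _ _ => mul_self_nonneg _)

lemma hessInner_self_nonneg (y : DGField M) : 0 ≤ hessInner M y y :=
  Mesh.brokenIntegral_nonneg fun _ _ => Finset.sum_nonneg fun _ _ => Finset.sum_nonneg fun _ _ =>
    Finset.sum_nonneg fun _ _ => mul_self_nonneg _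

/-- Change of the weight in the jump penalty. -/
lemma skeleton_jump_le (hy : y.IsDG) (hκ : 0 < κ) (hh : M.IsDensity κ h) (H : M.Regular σ)
    (hΩ : IsLipschitzDomain Ω) (hΓ : IsDirichletPart Ω Γ) (n : Fin 3)
    (hb : MemLp (y.bdVal n) 2 (μH[1].restrict Γ)) :
    M.skeletonIntegral Γ (fun i o x => (h x)⁻¹ * y.jump n i o x ^ 2) ≤
      (κ * Metric.diam (closure Ω)) ^ 2 *
        M.skeletonIntegral Γ fun i o x => (h x ^ 3)⁻¹ * y.jump n i o x ^ 2 := by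
  rw [← Mesh.skeletonIntegral_const_mul]
  refine (le_abs_self _).trans (Mesh.abs_skeletonIntegral_le hΩ hΓ (fun i o =>
    (Mesh.integrableOn_pow_mul hκ hh hΩ hΓ 3
      (hy.memLp_jump H hΩ hΓ n hb i o).integrable_sq).2.const_mul _) fun i o x hx => ?_)
  have hxT := M.edge_subset_left Γ i o hx
  obtain ⟨h0, -, h2⟩ := hh.2 i x hxT
  have h3 : h x ≤ κ * Metric.diam (closure Ω) :=
    h2.trans (mul_le_mul_of_nonneg_left (M.size_le_diam hΩ i) hκ.le)
  rw [abs_of_nonneg (by positivity), ← mul_assoc]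
  gcongr
  calc (h x)⁻¹ = h x ^ 2 * (h x ^ 3)⁻¹ := by field_simp
    _ ≤ _ := by gcongr

/-- The `L²` norm is controlled by the discrete `H²` norm and the data. -/
theorem exists_l2_le (k : ℕ) (σ : ℝ) (hκ : 0 < κ) (hΩ : IsLipschitzDomain Ω)
    (hΓ : IsDirichletPart Ω Γ) :
    ∃ C : ℝ, 0 ≤ C ∧ ∀ (M : Mesh s k Ω) (h : E2 → ℝ), M.Regular σ → M.IsDensity κ h →
      ∀ (g : Fin 3 → E2 → ℝ) (Dg : Fin 3 → Fin 2 → E2 → ℝ)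
        (Φ : Fin 3 → Fin 2 → E2 → ℝ) (DΦ : Fin 3 → Fin 2 → Fin 2 → E2 → ℝ),
        (∀ n, IsH1 Ω (g n) (Dg n)) → (∀ n a, IsH1 Ω (Φ n a) (DΦ n a)) →
        ∀ y : DGField M, IsDiscreteFn M Γ g Dg Φ DΦ y →
          ∑ n, M.brokenIntegral (fun i x => y.val i n x ^ 2) ≤
            C * (h2NormSq M Γ h y + ((∑ n, h1NormSq Ω (g n) (Dg n)) +
              ∑ n, ∑ a, h1NormSq Ω (Φ n a) (DΦ n a))) := by
  obtain ⟨Ct, hCt, ht⟩ := exists_integral_trace_sq_le hΩ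
  obtain ⟨Ca, hCa, ha⟩ :=
    Mesh.exists_broken_poincare (s := s) k 2 (2 * k + 6 * k) σ hκ hΩ hΓ
  obtain ⟨Cb, hCb, hb⟩ := Mesh.exists_broken_poincare (s := s) k 0 (2 * k) σ hκ hΩ hΓ
  set d := (κ * Metric.diam (closure Ω)) ^ 2 with hd
  have hd0 : 0 ≤ d := sq_nonneg _
  refine ⟨Cb * (Ca * (1 + Ct) + d + 1 + Ct), by positivity,
    fun M h H hh g Dg Φ DΦ hg hΦ y hy => ?_⟩
  have hbv := fun n => (hy.traceVal n).1
  have hbg := fun n a => (hy.traceGrad n a).1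
  have hyd := hy.isDG
  have hΓf := hΓ.subset_frontier
  have t1 := fun n => ht Γ hΓf _ _ _ (hg n) (hy.traceVal n)
  have t2 := fun n a => ht Γ hΓf _ _ _ (hΦ n a) (hy.traceGrad n a)
  -- Poincaré for the first derivatives with datum `Φ`, then for the values with datum `g`: together
  -- they lead from the Hessian down to `y`.
  have p1 := fun n a => ha M h H hh (y.d1 n a) (y.bdGrad n a) (hyd.isRat_d1 H n a) (hbg n a)
  have p2 := fun n => hb M h H hh (fun i => y.val i n) (y.bdVal n) (hyd.isRat_val n) (hbv n)
  have p3 := fun n => skeleton_jump_le hyd hκ hh H hΩ hΓ n (hbv n)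
  simp only [← jumpGrad_eq, ← jump_eq] at p1 p2
  have eP1 := hyd.penGrad_self hκ hh H hΩ hΓ hbg
  have eP0 := hyd.penVal_self hκ hh H hΩ hΓ hbv
  have eH := hyd.hessInner_self H hΩ
  simp only [Fintype.sum_prod_type] at eH
  have n1 := penGrad_self_nonneg hΩ hΓ hh y
  have n0 := penVal_self_nonneg hΩ hΓ hh y
  have nH := hessInner_self_nonneg y
  have hG0 : 0 ≤ ∑ n, h1NormSq Ω (g n) (Dg n) := Finset.sum_nonneg fun n _ =>
    add_nonneg (integral_nonneg fun _ => sq_nonneg _)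
      (Finset.sum_nonneg fun _ _ => integral_nonneg fun _ => sq_nonneg _)
  have hΦ0 : 0 ≤ ∑ n, ∑ a, h1NormSq Ω (Φ n a) (DΦ n a) := Finset.sum_nonneg fun n _ =>
    Finset.sum_nonneg fun a _ => add_nonneg (integral_nonneg fun _ => sq_nonneg _)
      (Finset.sum_nonneg fun _ _ => integral_nonneg fun _ => sq_nonneg _)
  have s1 : ∑ n, ∑ a, M.brokenIntegral (fun i x => y.d1 n a i x ^ 2) ≤
      Ca * (hessInner M y y + penGrad M Γ h y y +
        Ct * ∑ n, ∑ a, h1NormSq Ω (Φ n a) (DΦ n a)) := by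
    rw [eP1, eH]
    simp only [Finset.mul_sum (a := Ct), ← Finset.sum_add_distrib, Finset.mul_sum (a := Ca)]
    refine Finset.sum_le_sum fun n _ => Finset.sum_le_sum fun a _ => (p1 n a).trans ?_
    exact mul_le_mul_of_nonneg_left (add_le_add le_rfl (t2 n a)) hCa
  have s2 : ∑ n, M.brokenIntegral (fun i x => y.val i n x ^ 2) ≤
      Cb * ((∑ n, ∑ a, M.brokenIntegral (fun i x => y.d1 n a i x ^ 2)) +
        d * penVal M Γ h y y + Ct * ∑ n, h1NormSq Ω (g n) (Dg n)) := by
    rw [eP0]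
    simp only [Finset.mul_sum (a := Ct), Finset.mul_sum (a := d), ← Finset.sum_add_distrib]
    rw [Finset.mul_sum]
    refine Finset.sum_le_sum fun n _ => (p2 n).trans ?_
    exact mul_le_mul_of_nonneg_left (add_le_add (add_le_add le_rfl (p3 n)) (t1 n)) hCb
  refine s2.trans ?_
  rw [mul_assoc]
  refine mul_le_mul_of_nonneg_left ?_ hCb
  rw [h2NormSq]
  set P1 := penGrad M Γ h y y
  set P0 := penVal M Γ h y y
  set HH := hessInner M y y
  set G := ∑ n, h1NormSq Ω (g n) (Dg n)
  set F := ∑ n, ∑ a, h1NormSq Ω (Φ n a) (DΦ n a)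
  have a1 : Ca * (HH + P1 + Ct * F) ≤ Ca * (1 + Ct) * (HH + P1 + P0 + (G + F)) := by
    rw [mul_assoc]
    refine mul_le_mul_of_nonneg_left ?_ hCa
    nlinarith [mul_nonneg hCt nH, mul_nonneg hCt n1, mul_nonneg hCt n0, mul_nonneg hCt hG0]
  have a2 : d * P0 ≤ d * (HH + P1 + P0 + (G + F)) := mul_le_mul_of_nonneg_left (by linarith) hd0
  have a3 : Ct * G ≤ Ct * (HH + P1 + P0 + (G + F)) := mul_le_mul_of_nonneg_left (by linarith) hCt
  linarith

/-- Young's inequality with a free weight `t`, so that the `L²` norm of `y` can be made a small part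
of the discrete norm. -/
lemma load_le (hy : y.IsDG) (H : M.Regular σ) (hΩ : IsLipschitzDomain Ω)
    {f : Fin 3 → E2 → ℝ} (hf : ∀ n, MemLp (f n) 2 (volume.restrict Ω)) {t : ℝ} (ht : 0 < t) :
    M.brokenIntegral (fun i x => ∑ n, f n x * y.val i n x) ≤
      (4 * t)⁻¹ * (∑ n, ∫ x in Ω, f n x ^ 2) +
        t * ∑ n, M.brokenIntegral (fun i x => y.val i n x ^ 2) := by
  have hv := fun i n => Mesh.memLp_inter_T hΩ (Mesh.IsRat.continuousOn_T H (hy.isRat_val n i))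
  have hf' : ∀ i n, MemLp (f n) 2 (volume.restrict (Ω ∩ M.T i)) := fun i n =>
    (hf n).mono_measure (Measure.restrict_mono Set.inter_subset_left le_rfl)
  rw [Mesh.brokenIntegral_sum (F := fun n i x => f n x * y.val i n x) _
    fun n _ i => (hf' i n).integrable_mul (hv i n), Finset.mul_sum,
    Finset.mul_sum, ← Finset.sum_add_distrib]
  refine Finset.sum_le_sum fun n _ => ?_
  refine le_trans ?_ (add_le_add (mul_le_mul_of_nonneg_left (Mesh.brokenIntegral_sq_le H hΩ (hf n))
    (by positivity : 0 ≤ (4 * t)⁻¹)) le_rfl)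
  simp only [Mesh.brokenIntegral, Finset.mul_sum, ← Finset.sum_add_distrib]
  refine Finset.sum_le_sum fun i _ => ?_
  rw [← integral_const_mul, ← integral_const_mul, ← integral_add
    ((hf' i n).integrable_sq.const_mul _) ((hv i n).integrable_sq.const_mul _)]
  refine integral_mono ((hf' i n).integrable_mul (hv i n))
    (((hf' i n).integrable_sq.const_mul _).add ((hv i n).integrable_sq.const_mul _)) fun x => ?_
  have e : (4 * t)⁻¹ * f n x ^ 2 + t * y.val i n x ^ 2 - f n x * y.val i n x =
      (f n x - 2 * t * y.val i n x) ^ 2 / (4 * t) := by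
    field_simp
    ring
  have : 0 ≤ (f n x - 2 * t * y.val i n x) ^ 2 / (4 * t) := by positivity
  show f n x * y.val i n x ≤ (4 * t)⁻¹ * f n x ^ 2 + t * y.val i n x ^ 2
  linarith

end DGField

end DGPlate

/-! ### Choice of the constants and absorption -/

open MeasureTheory DGPlate
theorem lemma2p4 (s : RefShape) (k : ℕ) (hk : 2 ≤ k) (σ κ : ℝ) :
    ∃ γ > (0 : ℝ), ∃ c > (0 : ℝ),
      ∀ (Ω Γ : Set E2), IsLipschitzDomain Ω → IsDirichletPart Ω Γ →
        ∃ CF > (0 : ℝ), ∀ γ₀ ≥ γ, ∀ γ₁ ≥ γ,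
          ∀ (M : Mesh s k Ω) (h : E2 → ℝ), M.IsShapeRegular σ → M.IsDensity κ h →
          ∀ (g : Fin 3 → E2 → ℝ) (Dg : Fin 3 → Fin 2 → E2 → ℝ)
            (Φ : Fin 3 → Fin 2 → E2 → ℝ) (DΦ : Fin 3 → Fin 2 → Fin 2 → E2 → ℝ)
            (f : Fin 3 → E2 → ℝ),
            (∀ n, IsH1 Ω (g n) (Dg n)) → (∀ n a, IsH1 Ω (Φ n a) (DΦ n a)) →
            (∀ n, MemLp (f n) 2 (volume.restrict Ω)) →
            ∀ y : DGField M, IsDiscreteFn M Γ g Dg Φ DΦ y →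
              h2NormSq M Γ h y ≤ c * (energy M Γ h γ₀ γ₁ f y + CF * dataR Ω g Dg Φ DΦ f) := by
  have hκ : 0 < max κ 1 := lt_max_of_lt_right one_pos
  obtain ⟨C, hC, hcons⟩ := DGField.exists_abs_cons_le s k (max σ 1) (max κ 1) hκ
  -- Each consistency term takes at most an eighth of the Hessian, so the energy retains a quarter
  -- of it.
  set ε : ℝ := 1 / (8 * (C + 1)) with hε
  have hε0 : 0 < ε := by positivity
  -- Half of this threshold is `(4 * ε)⁻¹ + 1 / 4`: the first summand pays for Young's inequality,
  -- the second leaves a quarter of each penalty. The load takes another eighth of the whole norm,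
  -- hence the factor `8`. Both constants are fixed before `Ω` and `Γ`.
  refine ⟨(2 * ε)⁻¹ + 1 / 2, by positivity, 8, by norm_num, fun Ω Γ hΩ hΓ => ?_⟩
  obtain ⟨CP, hCP, hP⟩ := DGField.exists_l2_le (s := s) k (max σ 1) hκ hΩ hΓ
  -- The weight makes the `L²` norm of `y` cost at most an eighth of the discrete norm and of the
  -- boundary data. The latter gives the `1 / 8` in the data constant below, while `(4 * t)⁻¹` pays
  -- for `f`.
  set t : ℝ := 1 / (8 * (CP + 1)) with ht
  have ht0 : 0 < t := by positivity
  refine ⟨1 / 8 + (4 * t)⁻¹, by positivity, fun γ₀ hγ₀ γ₁ hγ₁ M h hM hh'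
    g Dg Φ DΦ f hg hΦ hf y hy => ?_⟩
  have H := hM.regular
  have hh := hh'.max_one
  obtain ⟨c1, c2⟩ := hcons Ω Γ M h hΩ hΓ H hh y hy.isDG (fun n => (hy.traceVal n).1)
    (fun n a => (hy.traceGrad n a).1) ε hε0
  have l2 := hP M h H hh g Dg Φ DΦ hg hΦ y hy
  have load := DGField.load_le hy.isDG H hΩ hf ht0
  have n1 := DGField.penGrad_self_nonneg hΩ hΓ hh y
  have n0 := DGField.penVal_self_nonneg hΩ hΓ hh y
  have nH := DGField.hessInner_self_nonneg y
  have hG0 : 0 ≤ (∑ n, h1NormSq Ω (g n) (Dg n)) + ∑ n, ∑ a, h1NormSq Ω (Φ n a) (DΦ n a) :=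
    add_nonneg (Finset.sum_nonneg fun n _ => add_nonneg (integral_nonneg fun _ => sq_nonneg _)
      (Finset.sum_nonneg fun _ _ => integral_nonneg fun _ => sq_nonneg _))
      (Finset.sum_nonneg fun n _ =>
        Finset.sum_nonneg fun a _ => add_nonneg (integral_nonneg fun _ => sq_nonneg _)
          (Finset.sum_nonneg fun _ _ => integral_nonneg fun _ => sq_nonneg _))
  have hF0 : 0 ≤ ∑ n, ∫ x in Ω, f n x ^ 2 :=
    Finset.sum_nonneg fun n _ => integral_nonneg fun _ => sq_nonneg _
  simp only [h2NormSq, energy, aH, dataR] at l2 ⊢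
  set P1 := penGrad M Γ h y y
  set P0 := penVal M Γ h y y
  set HH := hessInner M y y
  set B := (∑ n, h1NormSq Ω (g n) (Dg n)) + ∑ n, ∑ a, h1NormSq Ω (Φ n a) (DΦ n a)
  set F := ∑ n, ∫ x in Ω, f n x ^ 2
  set Y := ∑ n, M.brokenIntegral (fun i x => y.val i n x ^ 2)
  set LL := M.brokenIntegral (fun i x => ∑ n, f n x * y.val i n x)
  have e1 : ε * (C * HH) ≤ HH / 8 := by
    have : ε * C ≤ 1 / 8 := by
      rw [hε, div_mul_eq_mul_div, div_le_div_iff₀ (by positivity) (by norm_num)]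
      linarith
    nlinarith
  have e2 : t * Y ≤ (HH + P1 + P0 + B) / 8 := by
    have h1 : t * CP ≤ 1 / 8 := by
      rw [ht, div_mul_eq_mul_div, div_le_div_iff₀ (by positivity) (by norm_num)]
      linarith
    have h2 := mul_le_mul_of_nonneg_left l2 ht0.le
    have h3 := mul_le_mul_of_nonneg_right h1 (by linarith : 0 ≤ HH + P1 + P0 + B)
    linarith
  have e3 : (4 * ε)⁻¹ = (2 * ε)⁻¹ / 2 := by field_simp; norm_num
  rw [e3] at c1 c2
  have e4 := mul_le_mul_of_nonneg_right hγ₁ n1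
  have e5 := mul_le_mul_of_nonneg_right hγ₀ n0
  have e6 : 0 ≤ (4 * t)⁻¹ * B := by positivity
  have c1' := (abs_le.1 c1).2
  have c2' := (abs_le.1 c2).1
  linarith
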